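/- Let $T>0$, $\mathbb T^3=\mathbb R^3/\mathbb Z^3$ and $\theta\in(\tfrac12,\tfrac23]$. For $v:\mathbb T^3\to\mathbb R^3$ put $$\|v\|_{B^\theta_{3,\infty}}=\|v\|_{L^3(\mathbb T^3)}+\sup_{h\in\mathbb R^3\setminus\{0\}}\frac{\|v(\cdot+h)-v\|_{L^3(\mathbb T^3)}}{|h|^\theta},\qquad \|v\|_{H^{1/2}}=\|v\|_{L^2(\mathbb T^3)}+\Big(\iint_{\mathbb T^3\times\mathbb T^3}\frac{|v(x)-v(y)|^2}{|x-y|^{4}}\,dx\,dy\Big)^{1/2},$$ where $|x-y|$ is the flat distance on $\mathbb T^3$. Let $u\in L^\infty((0,T);B^\theta_{3,\infty}(\mathbb T^3))$ be a weak solution of the incompressible Euler equations on $\mathbb T^3\times(0,T)$; that is, $u\in L^2_{\rm loc}(\mathbb T^3\times(0,T);\mathbb R^3)$ and there is $p\in L^1_{\rm loc}(\mathbb T^3\times(0,T))$ such that $$\int_0^T\!\!\int_{\mathbb T^3}\big[\partial_t\phi\cdot u+u\otimes u:\nabla\phi+p\,\operatorname{div}\phi\big]\,dx\,dt=0\qquad\forall\,\phi\in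 C^\infty_c(\mathbb T^3\times(0,T);\mathbb R^3),$$ and, for a.e. $t\in(0,T)$, $\int_{\mathbb T^3}u(x,t)\cdot\nabla\psi(x)\,dx=0$ for all $\psi\in C^\infty(\mathbb T^3)$. Then for a.e. $t\in(0,T)$ the total helicity $$H(t)=\langle\operatorname{curl}u(t),u(t)\rangle$$ is well defined as a duality pairing between $H^{-1/2}(\mathbb T^3)$ and $H^{1/2}(\mathbb T^3)$, i.e. as the limit of the distributional pairings $\langle\operatorname{curl}u(t),\varphi\rangle$ as $\varphi\in C^\infty(\mathbb T^3;\mathbb R^3)$ tends to $u(t)$ in $H^{1/2}$, and $H\in L^1_{\rm loc}(0,T)$. If moreover the distributional derivative $H'$ of $H$ on $(0,T)$ is not zero, then the Hausdorff dimension of its support satisfies $$\dim_{\mathcal H}(\operatorname{Spt}H')\ \ge\ \frac{2\theta-1}{1-\theta},$$ where $\operatorname{Spt}H'$ is the complement in $(0,T)$ of the largest open set $A\subset(0,T)$ such that $H'(\eta)=0$ for every $\eta\in C^\infty_c(A)$. -/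

import Mathlib

open MeasureTheory Set Filter Topology
open scoped ENNReal ContDiff Distributions LineDeriv

noncomputable section

namespace EulerHelicity

/-- Vectors of `ℝ³`, with the Euclidean norm. -/
abbrev E3 : Type := EuclideanSpace ℝ (Fin 3)

/-- The flat torus `𝕋³ = ℝ³ / ℤ³`, with its normalized Lebesgue measure. -/
abbrev T3 : Type := UnitAddTorus (Fin 3)

/-- The covering map `ℝ³ → 𝕋³`. -/
def proj (y : Fin 3 → ℝ) : T3 := fun i => (y i : UnitAddCircle)

/-- The partial derivative `∂ᵢ f` of a function on the torus. -/
def pd (i : Fin 3) (f : T3 → ℝ) (x : T3) : ℝ :=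
  deriv (fun s : ℝ => f (x + proj (Pi.single i s))) 0

/-- Smoothness of a map on the torus: its periodic lift to `ℝ³` is `C^∞`. -/
def IsSmooth {F : Type*} [NormedAddCommGroup F] [NormedSpace ℝ F] (f : T3 → F) : Prop :=
  ContDiff ℝ ∞ fun y : Fin 3 → ℝ => f (proj y)

/-- `φ ∈ C^∞_c(𝕋³ × (0,T); ℝ³)`. -/
structure IsTestField (T : ℝ) (φ : ℝ → T3 → E3) : Prop where
  smooth : ContDiff ℝ ∞ fun q : ℝ × (Fin 3 → ℝ) => φ q.1 (proj q.2)
  compact : HasCompactSupport (Function.uncurry φ)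
  support : tsupport (Function.uncurry φ) ⊆ Ioo 0 T ×ˢ univ

/-- `(u, p)` is a weak solution of the incompressible Euler equations on `𝕋³ × (0,T)`. -/
structure IsWeakEulerSolution (T : ℝ) (u : ℝ → T3 → E3) (p : ℝ → T3 → ℝ) : Prop where
  velocity_L2loc : ∀ K : Set (ℝ × T3), IsCompact K → K ⊆ Ioo 0 T ×ˢ univ →
    MemLp (Function.uncurry u) 2 (volume.restrict K)
  pressure_L1loc : ∀ K : Set (ℝ × T3), IsCompact K → K ⊆ Ioo 0 T ×ˢ univ →
    MemLp (Function.uncurry p) 1 (volume.restrict K)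
  momentum : ∀ φ : ℝ → T3 → E3, IsTestField T φ →
    ∫ t in Ioo 0 T, ∫ x : T3,
      ((∑ i, deriv (fun s => φ s x i) t * u t x i)
        + (∑ i, ∑ j, u t x i * u t x j * pd j (fun y => φ t y i) x)
        + p t x * ∑ i, pd i (fun y => φ t y i) x) = 0
  divergence_free : ∀ᵐ t ∂(volume.restrict (Ioo 0 T)), ∀ ψ : T3 → ℝ, IsSmooth ψ →
    ∫ x : T3, ∑ i, u t x i * pd i ψ x = 0

/-- The norm `‖v‖_{L^p} + sup_{h ≠ 0} ‖v(· + h) - v‖_{L^p} / |h|^θ` of the Besov space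
`B^θ_{p,∞}(𝕋³)`, with value `∞` outside the space. -/
def besovNorm (θ : ℝ) (p : ℝ≥0∞) (v : T3 → E3) : ℝ≥0∞ :=
  eLpNorm v p volume +
    ⨆ (h : E3) (_ : h ≠ 0),
      eLpNorm (fun x => v (x + proj h) - v x) p volume / ENNReal.ofReal (‖h‖ ^ θ)

/-- `u ∈ L^∞((0,T); B^θ_{p,∞}(𝕋³))`. -/
structure MemLinftyBesov (T θ : ℝ) (p : ℝ≥0∞) (u : ℝ → T3 → E3) : Prop where
  measurable : AEStronglyMeasurable (Function.uncurry u) (volume.restrict (Ioo 0 T ×ˢ univ))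
  bound : ∃ C : ℝ, ∀ᵐ t ∂(volume.restrict (Ioo 0 T)), besovNorm θ p (u t) ≤ ENNReal.ofReal C

/-- The Euclidean distance from `z` to the origin in `𝕋³`. -/
def torusAbs (z : T3) : ℝ := Real.sqrt (∑ i, ‖z i‖ ^ 2)

/-- The norm of the fractional Sobolev space `H^{1/2}(𝕋³)`: the `L²` norm plus the Gagliardo
seminorm, whose kernel is `|x - y|^{-(d+1)}` with `d = 3`. -/
def sobolevHalfNorm (v : T3 → E3) : ℝ≥0∞ :=
  eLpNorm v 2 volume +
    (∫⁻ x : T3, ∫⁻ y : T3, ‖v x - v y‖ₑ ^ 2 / ENNReal.ofReal (torusAbs (x - y) ^ 4))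
      ^ (1 / 2 : ℝ)

/-- The smooth vector fields on the torus. -/
abbrev SmoothField : Type := {φ : T3 → E3 // IsSmooth φ}

/-- The distributional derivative `∂ᵢ f`, tested with `ψ`. -/
def distPartial (i : Fin 3) (f ψ : T3 → ℝ) : ℝ := -∫ x : T3, f x * pd i ψ x

/-- The distributional vorticity `curl v`, tested with the smooth field `φ`. -/
def distCurl (v : T3 → E3) (φ : SmoothField) : ℝ :=
  (distPartial 1 (v · 2) (φ.1 · 0) - distPartial 2 (v · 1) (φ.1 · 0))
    + (distPartial 2 (v · 0) (φ.1 · 1) - distPartial 0 (v · 2) (φ.1 · 1))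
    + (distPartial 0 (v · 1) (φ.1 · 2) - distPartial 1 (v · 0) (φ.1 · 2))

/-- The filter of smooth fields that converge to `v` in `H^{1/2}(𝕋³)`. -/
def smoothApprox (v : T3 → E3) : Filter SmoothField :=
  comap (fun φ => sobolevHalfNorm (φ.1 - v)) (𝓝 0)

/-- `L` is the duality pairing `⟨curl v, v⟩` between `H^{-1/2}` and `H^{1/2}`: the smooth fields
accumulate at `v` in `H^{1/2}`, and `⟨curl v, φ⟩ → L` as the smooth field `φ` tends to `v` in
`H^{1/2}`. -/
def HasHelicity (v : T3 → E3) (L : ℝ) : Prop :=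
  (smoothApprox v).NeBot ∧ Tendsto (distCurl v) (smoothApprox v) (𝓝 L)

/-- The total helicity `⟨curl v, v⟩` of a field `v`, the number `L` with `HasHelicity v L`. -/
def helicity (v : T3 → E3) : ℝ := limUnder (smoothApprox v) (distCurl v)

/-- The open interval `(0,T)`. -/
def timeInterval (T : ℝ) : TopologicalSpace.Opens ℝ := ⟨Ioo 0 T, isOpen_Ioo⟩

/-- The distribution `η ↦ ∫ η H` on `(0,T)` given by a locally integrable function `H`. -/
def regularDistribution (T : ℝ) (H : ℝ → ℝ) : 𝓓'(timeInterval T, ℝ) :=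
  ContinuousLinearMap.toUniformConvergenceCLM _ _ _
    (TestFunction.integralAgainstBilinCLM (ContinuousLinearMap.mul ℝ ℝ) volume H)

/-- The distributional derivative `H'` on `(0,T)` of the total helicity `H(t) = ⟨ω(t), u(t)⟩`. -/
def helicityDeriv (T : ℝ) (u : ℝ → T3 → E3) : 𝓓'(timeInterval T, ℝ) :=
  ∂_{(1 : ℝ)} (regularDistribution T fun t => helicity (u t))

/-- The support in `(0,T)` of a distribution on `(0,T)`. -/
def spt {T : ℝ} (F : 𝓓'(timeInterval T, ℝ)) : Set ℝ :=
  Ioo 0 T ∩ Distribution.dsupport F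

end EulerHelicity

end

open scoped Convolution

/-!
Write `H_ε` for the helicity of the mollification of `u` at scale `ε`. Testing the Euler equations
with the doubly mollified vorticity turns the momentum flux of `u` into the commutator of
mollification and multiplication, which by the identity of Constantin, E and Titi bounds the flux
by `C ε ^ (3θ - 2)`. Since the helicity form is symmetric, the increment of `H_ε` between two times
is a linear pairing controlled by this flux, plus an error quadratic in the length of the time
interval, which bisection removes: `H_ε` is Lipschitz with constant `C ε ^ (3θ - 2)`. On the other
hand `|H - H_ε| ≤ C ε ^ (2θ - 1)`, by telescoping over dyadic scales. At `ε = |t - s| ^ β` with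
`β = 1 / (1 - θ)` the two errors balance, and `H` is Hölder continuous with exponent
`α = (2θ - 1) / (1 - θ)`.

Off `Spt H'` the function `H` is locally constant. If `Spt H'` has dimension less than `α`, its
image under `H` has dimension less than `1`, while the rest of the interval has a countable image.
So the image of the whole interval, being connected, is a point, and `H` is constant.
-/

noncomputable section

namespace EulerHelicity

/-! ### Calculus on the torus -/

lemma proj_add (y z : Fin 3 → ℝ) : proj (y + z) = proj y + proj z := by
  ext
  simp [proj]

lemma proj_neg (y : Fin 3 → ℝ) : proj (-y) = -proj y := by
  ext
  simp [proj]

lemma proj_sub (y z : Fin 3 → ℝ) : proj (y - z) = proj y - proj z := by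
  rw [sub_eq_add_neg, proj_add, proj_neg, sub_eq_add_neg]

lemma proj_zero : proj 0 = 0 := by
  ext
  simp [proj]

lemma isOpenQuotientMap_proj : IsOpenQuotientMap proj :=
  IsOpenQuotientMap.piMap (f := fun (_ : Fin 3) (s : ℝ) => (s : UnitAddCircle))
    fun _ => QuotientAddGroup.isOpenQuotientMap_mk

lemma proj_surjective : Function.Surjective proj := isOpenQuotientMap_proj.surjective

lemma proj_add_proj_single (y : Fin 3 → ℝ) (i : Fin 3) (s : ℝ) :
    proj y + proj (Pi.single i s) = proj (y + s • Pi.single i (1 : ℝ)) := by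
  rw [proj_add, ← Pi.single_smul, smul_eq_mul, mul_one]

section Smooth

variable {F : Type*} [NormedAddCommGroup F] [NormedSpace ℝ F] {f g : T3 → F}

lemma IsSmooth.continuous (hf : IsSmooth f) : Continuous f :=
  isOpenQuotientMap_proj.isQuotientMap.continuous_iff.2 (ContDiff.continuous hf)

lemma IsSmooth.const (c : F) : IsSmooth fun _ : T3 => c := contDiff_const

lemma IsSmooth.add (hf : IsSmooth f) (hg : IsSmooth g) : IsSmooth fun x => f x + g x :=
  ContDiff.add hf hg

lemma IsSmooth.sub (hf : IsSmooth f) (hg : IsSmooth g) : IsSmooth fun x => f x - g x :=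
  ContDiff.sub hf hg

lemma IsSmooth.comp_sub_left (hf : IsSmooth f) (x : T3) : IsSmooth fun y => f (x - y) := by
  obtain ⟨z, rfl⟩ := proj_surjective x
  simp only [IsSmooth, ← proj_sub]
  exact ContDiff.comp (g := fun y => f (proj y)) hf (contDiff_const.sub contDiff_id)

end Smooth

section PartialDerivative

variable {f g : T3 → ℝ}

lemma IsSmooth.mul (hf : IsSmooth f) (hg : IsSmooth g) : IsSmooth fun x => f x * g x :=
  ContDiff.mul hf hg

lemma IsSmooth.comp {φ : ℝ → ℝ} (hφ : ContDiff ℝ ∞ φ) (hf : IsSmooth f) :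
    IsSmooth fun x => φ (f x) :=
  hφ.comp hf

lemma IsSmooth.hasDerivAt_single (hf : IsSmooth f) (i : Fin 3) (y : Fin 3 → ℝ) :
    HasDerivAt (fun s : ℝ => f (proj y + proj (Pi.single i s)))
      (fderiv ℝ (fun y => f (proj y)) y (Pi.single i 1)) 0 := by
  have hline : HasDerivAt (fun s : ℝ => y + s • (Pi.single i 1 : Fin 3 → ℝ)) (Pi.single i 1) 0 := by
    simpa using ((hasDerivAt_id (0 : ℝ)).smul_const (Pi.single i 1 : Fin 3 → ℝ)).const_add y
  have hf' : HasFDerivAt (fun y => f (proj y)) (fderiv ℝ (fun y => f (proj y)) y)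
      (y + (0 : ℝ) • (Pi.single i 1 : Fin 3 → ℝ)) := by
    simpa using (ContDiff.differentiable hf (by simp) y).hasFDerivAt
  simp only [proj_add_proj_single]
  exact hf'.comp_hasDerivAt (0 : ℝ) hline

lemma IsSmooth.pd_proj (hf : IsSmooth f) (i : Fin 3) (y : Fin 3 → ℝ) :
    pd i f (proj y) = fderiv ℝ (fun y => f (proj y)) y (Pi.single i 1) :=
  (hf.hasDerivAt_single i y).deriv

protected lemma IsSmooth.pd (hf : IsSmooth f) (i : Fin 3) : IsSmooth (pd i f) := by
  simp only [IsSmooth, hf.pd_proj i]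
  exact (ContDiff.fderiv_right hf (by simp)).clm_apply contDiff_const

lemma IsSmooth.hasDerivAt_zero (hf : IsSmooth f) (i : Fin 3) (x : T3) :
    HasDerivAt (fun s : ℝ => f (x + proj (Pi.single i s))) (pd i f x) 0 := by
  obtain ⟨y, rfl⟩ := proj_surjective x
  exact (hf.hasDerivAt_single i y).differentiableAt.hasDerivAt

lemma IsSmooth.hasDerivAt (hf : IsSmooth f) (i : Fin 3) (x : T3) (s : ℝ) :
    HasDerivAt (fun s : ℝ => f (x + proj (Pi.single i s)))
      (pd i f (x + proj (Pi.single i s))) s := by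
  have h := HasDerivAt.comp_sub_const (x := s) (a := s)
    (f := fun r : ℝ => f (x + proj (Pi.single i s) + proj (Pi.single i r)))
    (by simpa using hf.hasDerivAt_zero i (x + proj (Pi.single i s)))
  simpa only [add_assoc, ← proj_add, ← Pi.single_add, add_sub_cancel] using h

/-- The differential of `f` at `x`, a linear form on the tangent space `ℝ³` of the torus. -/
def differential (f : T3 → ℝ) (x : T3) : (Fin 3 → ℝ) →L[ℝ] ℝ :=
  ∑ i, pd i f x • ContinuousLinearMap.proj i

lemma differential_apply (f : T3 → ℝ) (x : T3) (v : Fin 3 → ℝ) :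
    differential f x v = ∑ i, pd i f x * v i := by
  simp [differential]

lemma IsSmooth.continuous_differential (hf : IsSmooth f) : Continuous (differential f) :=
  continuous_finsetSum _ fun i _ => (hf.pd i).continuous.smul continuous_const

lemma IsSmooth.hasFDerivAt (hf : IsSmooth f) (y : Fin 3 → ℝ) :
    HasFDerivAt (fun y => f (proj y)) (differential f (proj y)) y := by
  refine (ContDiff.differentiable hf (by simp) y).hasFDerivAt.congr_fderiv ?_
  ext v
  have hv : v = ∑ i, v i • (Pi.single i 1 : Fin 3 → ℝ) := pi_eq_sum_univ' v
  conv_lhs => rw [hv, map_sum]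
  simp only [map_smul, smul_eq_mul, differential_apply, hf.pd_proj, mul_comm]

lemma pd_const (c : ℝ) (i : Fin 3) : pd i (fun _ => c) = fun _ => 0 := by
  ext x
  simp [pd]

lemma pd_add (hf : IsSmooth f) (hg : IsSmooth g) (i : Fin 3) (x : T3) :
    pd i (fun x => f x + g x) x = pd i f x + pd i g x :=
  ((hf.hasDerivAt_zero i x).add (hg.hasDerivAt_zero i x)).deriv

lemma pd_sub (hf : IsSmooth f) (hg : IsSmooth g) (i : Fin 3) (x : T3) :
    pd i (fun x => f x - g x) x = pd i f x - pd i g x :=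
  ((hf.hasDerivAt_zero i x).sub (hg.hasDerivAt_zero i x)).deriv

lemma pd_neg (hf : IsSmooth f) (i : Fin 3) (x : T3) :
    pd i (fun x => -f x) x = -pd i f x :=
  (hf.hasDerivAt_zero i x).neg.deriv

lemma pd_const_mul (hf : IsSmooth f) (c : ℝ) (i : Fin 3) (x : T3) :
    pd i (fun x => c * f x) x = c * pd i f x :=
  ((hf.hasDerivAt_zero i x).const_mul c).deriv

lemma pd_mul (hf : IsSmooth f) (hg : IsSmooth g) (i : Fin 3) (x : T3) :
    pd i (fun x => f x * g x) x = pd i f x * g x + f x * pd i g x := by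
  have h := ((hf.hasDerivAt_zero i x).mul (hg.hasDerivAt_zero i x)).deriv
  simp only [Pi.single_zero, proj_zero, add_zero] at h
  exact h

lemma pd_comp {φ : ℝ → ℝ} (hφ : Differentiable ℝ φ) (hf : IsSmooth f) (i : Fin 3) (x : T3) :
    pd i (fun x => φ (f x)) x = deriv φ (f x) * pd i f x := by
  have h := (hφ (f (x + proj (Pi.single i 0)))).hasDerivAt.comp (0 : ℝ) (hf.hasDerivAt_zero i x)
  simp only [Pi.single_zero, proj_zero, add_zero] at h
  exact h.deriv

lemma pd_comp_sub_left (hf : IsSmooth f) (i : Fin 3) (x y : T3) :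
    pd i (fun y => f (x - y)) y = -pd i f (x - y) := by
  have h := HasDerivAt.scomp (0 : ℝ)
    (by simpa using hf.hasDerivAt_zero i (x - y)) (hasDerivAt_neg (0 : ℝ))
  have hline : ∀ s : ℝ, x - (y + proj (Pi.single i s)) = x - y + proj (Pi.single i (-s)) := by
    intro s
    rw [Pi.single_neg, proj_neg]
    abel
  simpa [pd, hline, Function.comp_def] using h.deriv

lemma pd_comm (hf : IsSmooth f) (i j : Fin 3) (x : T3) :
    pd i (pd j f) x = pd j (pd i f) x := by
  obtain ⟨y, rfl⟩ := proj_surjective x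
  have hd : DifferentiableAt ℝ (fderiv ℝ fun y => f (proj y)) y :=
    (ContDiff.fderiv_right (m := 1) hf (by norm_cast)).differentiable (by simp) y
  have hsymm : IsSymmSndFDerivAt ℝ (fun y => f (proj y)) y :=
    (ContDiff.contDiffAt hf).isSymmSndFDerivAt (by simp; norm_cast)
  rw [(hf.pd j).pd_proj, (hf.pd i).pd_proj]
  simp_rw [hf.pd_proj]
  rw [fderiv_clm_apply hd (by fun_prop), fderiv_clm_apply hd (by fun_prop)]
  simpa using hsymm.eq (Pi.single i 1) (Pi.single j 1)

end PartialDerivative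

/-! ### Integration and convolution on the torus -/

section CompactSpace

variable {X : Type*} [TopologicalSpace X] [CompactSpace X]

lemma exists_forall_norm_le {E : Type*} [SeminormedAddCommGroup E] {f : X → E}
    (hf : Continuous f) : ∃ C, 0 ≤ C ∧ ∀ x, ‖f x‖ ≤ C := by
  obtain ⟨C, hC⟩ := isCompact_univ.exists_bound_of_continuousOn hf.continuousOn
  exact ⟨max C 0, le_max_right _ _, fun x => (hC x (mem_univ x)).trans (le_max_left _ _)⟩

variable [MeasurableSpace X] [OpensMeasurableSpace X] {μ : Measure X} {f k : X → ℝ}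

lemma integrable_of_continuous [IsFiniteMeasureOnCompacts μ] (hf : Continuous f) :
    Integrable f μ :=
  hf.integrable_of_hasCompactSupport (HasCompactSupport.of_compactSpace f)

lemma integrable_continuous_mul (hk : Continuous k) (hf : Integrable f μ) :
    Integrable (fun x => k x * f x) μ := by
  obtain ⟨C, -, hC⟩ := exists_forall_norm_le hk
  exact hf.bdd_mul hk.aestronglyMeasurable (Eventually.of_forall hC)

end CompactSpace

instance : IsProbabilityMeasure (volume : Measure UnitAddCircle) := ⟨by simp⟩

instance : IsProbabilityMeasure (volume : Measure T3) :=
  inferInstanceAs (IsProbabilityMeasure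
    (Measure.pi fun _ : Fin 3 => (volume : Measure UnitAddCircle)))

instance : (volume : Measure UnitAddCircle).IsNegInvariant :=
  Measure.IsAddHaarMeasure.isNegInvariant_of_regular volume

instance : (volume : Measure T3).IsNegInvariant := inferInstance

section Convolution

variable {f g k : T3 → ℝ}

lemma integral_pd (hf : IsSmooth f) (i : Fin 3) : ∫ x, pd i f x = 0 := by
  obtain ⟨C, -, hC⟩ := exists_forall_norm_le (hf.pd i).continuous
  have htranslate : ∀ {g : T3 → ℝ}, Continuous g → ∀ s : ℝ,
      Continuous fun x => g (x + proj (Pi.single i s)) := fun hg s =>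
    hg.comp (continuous_id.add continuous_const)
  have h := (hasDerivAt_integral_of_dominated_loc_of_deriv_le (μ := (volume : Measure T3))
    (F := fun (s : ℝ) x => f (x + proj (Pi.single i s)))
    (F' := fun (s : ℝ) x => pd i f (x + proj (Pi.single i s))) (x₀ := (0 : ℝ)) (s := univ)
    (bound := fun _ => C) univ_mem
    (Eventually.of_forall fun s => (htranslate hf.continuous s).aestronglyMeasurable)
    (integrable_of_continuous (htranslate hf.continuous 0))
    (htranslate (hf.pd i).continuous 0).aestronglyMeasurable
    (Eventually.of_forall fun x s _ => hC _) (integrable_const _)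
    (Eventually.of_forall fun x s _ => hf.hasDerivAt i x s)).2
  simp only [integral_add_right_eq_self] at h
  exact h.unique (hasDerivAt_const _ _)

lemma integral_mul_pd (hf : IsSmooth f) (hg : IsSmooth g) (i : Fin 3) :
    ∫ x, f x * pd i g x = -∫ x, pd i f x * g x := by
  have h := integral_pd (hf.mul hg) i
  simp_rw [pd_mul hf hg] at h
  rw [integral_add (integrable_of_continuous ((hf.pd i).mul hg).continuous)
    (integrable_of_continuous (hf.mul (hg.pd i)).continuous)] at h
  linarith

lemma convolution_apply (k f : T3 → ℝ) (x : T3) : (k ⋆ f) x = ∫ y, k (x - y) * f y :=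
  convolution_lsmul_swap

lemma integrable_convolution_integrand (hk : Continuous k) (hf : Integrable f) (x : T3) :
    Integrable fun y => k (x - y) * f y :=
  integrable_continuous_mul (hk.comp (continuous_const.sub continuous_id)) hf

lemma integrable_smul_differential (hk : IsSmooth k) (hf : Integrable f) (x : T3) :
    Integrable fun y => f y • differential k (x - y) := by
  obtain ⟨C, -, hC⟩ := exists_forall_norm_le hk.continuous_differential
  exact hf.smul_bdd C (hk.continuous_differential.comp
    (continuous_const.sub continuous_id)).aestronglyMeasurable (Eventually.of_forall fun y => hC _)

lemma hasFDerivAt_convolution (hk : IsSmooth k) (hf : Integrable f) (y : Fin 3 → ℝ) :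
    HasFDerivAt (fun y => (k ⋆ f) (proj y)) (∫ x, f x • differential k (proj y - x)) y := by
  obtain ⟨C, -, hC⟩ := exists_forall_norm_le hk.continuous_differential
  have hderiv : ∀ (x : T3) (y : Fin 3 → ℝ), HasFDerivAt (fun y => k (proj y - x) * f x)
      (f x • differential k (proj y - x)) y := by
    intro x y
    obtain ⟨z, rfl⟩ := proj_surjective x
    simp only [← proj_sub]
    exact ((hk.hasFDerivAt (y - z)).comp y ((hasFDerivAt_id y).sub_const z)).mul_const (f (proj z))
  simp only [convolution_apply]
  refine hasFDerivAt_integral_of_dominated_of_fderiv_le (s := univ)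
    (bound := fun x => ‖f x‖ * C) univ_mem
    (Eventually.of_forall fun z =>
      (integrable_convolution_integrand hk.continuous hf _).aestronglyMeasurable)
    (integrable_convolution_integrand hk.continuous hf _)
    (integrable_smul_differential hk hf _).aestronglyMeasurable
    (Eventually.of_forall fun x y _ => ?_) (hf.norm.mul_const C)
    (Eventually.of_forall fun x y _ => hderiv x y)
  rw [norm_smul]
  exact mul_le_mul_of_nonneg_left (hC _) (norm_nonneg _)

lemma integral_smul_differential (hk : IsSmooth k) (hf : Integrable f) (x : T3) :
    ∫ y, f y • differential k (x - y)
      = ∑ i, (pd i k ⋆ f) x • (ContinuousLinearMap.proj i : (Fin 3 → ℝ) →L[ℝ] ℝ) := by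
  ext v
  rw [ContinuousLinearMap.integral_apply (integrable_smul_differential hk hf x)]
  simp only [smul_apply, differential_apply, smul_eq_mul,
    sum_apply, ContinuousLinearMap.proj_apply, convolution_apply,
    Finset.mul_sum, ← integral_mul_const]
  rw [integral_finsetSum _ fun i _ => ?_]
  · exact Finset.sum_congr rfl fun i _ => integral_congr_ae (.of_forall fun y => by ring)
  · refine ((integrable_convolution_integrand (hk.pd i).continuous hf x).mul_const (v i)).congr
      (.of_forall fun y => by ring)

protected lemma IsSmooth.convolution (hk : IsSmooth k) (hf : Integrable f) :
    IsSmooth (k ⋆ f) := by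
  refine contDiff_infty.2 fun n => ?_
  induction n generalizing k with
  | zero =>
    exact contDiff_zero.2 (continuous_iff_continuousAt.2 fun y =>
      (hasFDerivAt_convolution hk hf y).continuousAt)
  | succ n ih =>
    refine contDiff_succ_iff_hasFDerivAt.2 ⟨_, ?_, hasFDerivAt_convolution hk hf⟩
    simp only [integral_smul_differential hk hf]
    exact ContDiff.sum fun i _ => (ih (hk.pd i)).smul contDiff_const

lemma pd_convolution (hk : IsSmooth k) (hf : Integrable f) (i : Fin 3) :
    pd i (k ⋆ f) = pd i k ⋆ f := by
  ext x
  obtain ⟨y, rfl⟩ := proj_surjective x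
  rw [(hk.convolution hf).pd_proj, (hasFDerivAt_convolution hk hf y).fderiv,
    integral_smul_differential hk hf]
  simp [Pi.single_apply]

lemma convolution_fun_sub (hk : Continuous k) (hf : Integrable f) (hg : Integrable g) (x : T3) :
    (k ⋆ fun y => f y - g y) x = (k ⋆ f) x - (k ⋆ g) x := by
  simp_rw [convolution_apply, mul_sub]
  exact integral_sub (integrable_convolution_integrand hk hf x)
    (integrable_convolution_integrand hk hg x)

lemma pd_convolution_eq_convolution_pd (hk : IsSmooth k) (hf : IsSmooth f) (i : Fin 3) :
    pd i (k ⋆ f) = k ⋆ pd i f := by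
  ext x
  have h := integral_mul_pd (hk.comp_sub_left x) hf i
  simp_rw [pd_comp_sub_left hk, neg_mul, integral_neg, neg_neg] at h
  rw [pd_convolution hk (integrable_of_continuous hf.continuous), convolution_apply,
    convolution_apply, h]

lemma integral_convolution_mul (hk : Continuous k) (heven : ∀ x, k (-x) = k x)
    (hf : Integrable f) (hg : Integrable g) :
    ∫ x, (k ⋆ f) x * g x = ∫ x, f x * (k ⋆ g) x := by
  have hint : Integrable (fun q : T3 × T3 => k (q.1 - q.2) * (g q.1 * f q.2))
      ((volume : Measure T3).prod volume) :=
    integrable_continuous_mul (hk.comp (continuous_fst.sub continuous_snd)) (hg.mul_prod hf)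
  calc ∫ x, (k ⋆ f) x * g x = ∫ x, ∫ y, k (x - y) * (g x * f y) := by
        simp only [convolution_apply, ← integral_mul_const]
        refine integral_congr_ae (.of_forall fun x => integral_congr_ae (.of_forall fun y => ?_))
        ring
    _ = ∫ y, ∫ x, k (x - y) * (g x * f y) := integral_integral_swap hint
    _ = ∫ x, f x * (k ⋆ g) x := by
        simp only [convolution_apply, ← integral_const_mul]
        refine integral_congr_ae (.of_forall fun y => integral_congr_ae (.of_forall fun x => ?_))
        simp only [← heven (x - y), neg_sub]
        ring

end Convolution

/-! ### The distance to the origin -/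

lemma torusAbs_nonneg (z : T3) : 0 ≤ torusAbs z := Real.sqrt_nonneg _

lemma torusAbs_sq (z : T3) : torusAbs z ^ 2 = ∑ i, ‖z i‖ ^ 2 :=
  Real.sq_sqrt (Finset.sum_nonneg fun _ _ => sq_nonneg _)

lemma torusAbs_neg (z : T3) : torusAbs (-z) = torusAbs z := by simp [torusAbs]

lemma continuous_torusAbs : Continuous torusAbs := by
  unfold torusAbs
  fun_prop

lemma norm_le_torusAbs (z : T3) : ‖z‖ ≤ torusAbs z :=
  (pi_norm_le_iff_of_nonneg (torusAbs_nonneg z)).2 fun i =>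
    Real.le_sqrt_of_sq_le (Finset.single_le_sum (f := fun i => ‖z i‖ ^ 2)
      (fun _ _ => sq_nonneg _) (Finset.mem_univ i))

lemma torusAbs_sq_le (z : T3) : torusAbs z ^ 2 ≤ 3 * ‖z‖ ^ 2 := by
  rw [torusAbs_sq]
  calc ∑ i, ‖z i‖ ^ 2 ≤ ∑ _i : Fin 3, ‖z‖ ^ 2 := by
        gcongr
        exact norm_le_pi_norm z _
    _ = 3 * ‖z‖ ^ 2 := by simp

lemma exists_proj_eq_abs_eq (z : T3) : ∃ h : Fin 3 → ℝ, proj h = z ∧ ∀ i, |h i| = ‖z i‖ := by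
  have hcoord : ∀ i, ∃ s : ℝ, (s : UnitAddCircle) = z i ∧ |s| = ‖z i‖ := fun i => by
    obtain ⟨s, hs⟩ := QuotientAddGroup.mk_surjective (z i)
    have hround : ((round s : ℝ) : UnitAddCircle) = 0 :=
      (AddCircle.coe_eq_zero_iff 1).2 ⟨round s, by simp⟩
    refine ⟨s - round s, ?_, ?_⟩
    · rw [AddCircle.coe_sub, ← hs, hround, sub_zero]
    · rw [← hs]
      exact UnitAddCircle.norm_eq.symm
  choose s hs hn using hcoord
  exact ⟨s, funext hs, hn⟩

lemma exists_proj_eq_norm_eq (z : T3) : ∃ h : E3, proj h = z ∧ ‖h‖ = torusAbs z := by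
  obtain ⟨s, hs, hn⟩ := exists_proj_eq_abs_eq z
  refine ⟨WithLp.toLp 2 s, hs, ?_⟩
  simp [EuclideanSpace.norm_eq, torusAbs, hn]

lemma volume_real_closedBall_zero {r : ℝ} (hr : 0 ≤ r) :
    volume.real (Metric.closedBall (0 : T3) r) = min 1 (2 * r) ^ 3 := by
  rw [measureReal_def, volume_pi_closedBall _ hr]
  simp only [AddCircle.volume_closedBall, Finset.prod_const, Finset.card_univ,
    Fintype.card_fin, ENNReal.toReal_pow]
  rw [ENNReal.toReal_ofReal (le_min zero_le_one (by linarith))]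

lemma norm_integral_le_of_eq_zero {E : Type*} [NormedAddCommGroup E] [NormedSpace ℝ E]
    {h : T3 → E} {A ε : ℝ} (hε : 0 ≤ ε) (hA : ∀ z, ‖h z‖ ≤ A)
    (h0 : ∀ z, ε < torusAbs z → h z = 0) : ‖∫ z, h z‖ ≤ A * (2 * ε) ^ 3 := by
  have hA0 : 0 ≤ A := (norm_nonneg _).trans (hA 0)
  have hball : ∀ z, z ∉ Metric.closedBall (0 : T3) ε → h z = 0 := fun z hz =>
    h0 z ((by simpa using hz : ε < ‖z‖).trans_le (norm_le_torusAbs z))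
  rw [← setIntegral_eq_integral_of_forall_compl_eq_zero hball]
  refine (norm_setIntegral_le_of_norm_le_const (measure_lt_top _ _) fun z _ => hA z).trans
    ?_
  rw [volume_real_closedBall_zero hε]
  gcongr
  exact min_le_right _ _

/-! ### A smooth mollifier -/

lemma periodic_sin_sq : Function.Periodic (fun s : ℝ => Real.sin (Real.pi * s) ^ 2) 1 := by
  intro s
  simp only [mul_add, mul_one, Real.sin_add_pi, neg_sq]

/-- The function `z ↦ ∑ sin² (π zᵢ)`, a smooth substitute for the squared distance to the origin,
which is not smooth on the torus. -/
def sinSq (z : T3) : ℝ := ∑ i, periodic_sin_sq.lift (z i)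

lemma sinSq_proj (y : Fin 3 → ℝ) : sinSq (proj y) = ∑ i, Real.sin (Real.pi * y i) ^ 2 := by
  simp [sinSq, proj, Function.Periodic.lift_coe]

lemma isSmooth_sinSq : IsSmooth sinSq := by
  unfold IsSmooth
  simp_rw [sinSq_proj]
  fun_prop

lemma sinSq_nonneg (z : T3) : 0 ≤ sinSq z := by
  obtain ⟨y, rfl⟩ := proj_surjective z
  rw [sinSq_proj]
  positivity

lemma sinSq_neg (z : T3) : sinSq (-z) = sinSq z := by
  obtain ⟨y, rfl⟩ := proj_surjective z
  rw [← proj_neg, sinSq_proj, sinSq_proj]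
  simp

lemma four_mul_torusAbs_sq_le_sinSq (z : T3) : 4 * torusAbs z ^ 2 ≤ sinSq z := by
  obtain ⟨h, rfl, hn⟩ := exists_proj_eq_abs_eq z
  rw [sinSq_proj, torusAbs_sq, Finset.mul_sum]
  refine Finset.sum_le_sum fun i _ => ?_
  have hhalf : |h i| ≤ 1 / 2 := by
    rw [hn]
    simpa using AddCircle.norm_le_half_period 1 one_ne_zero (x := proj h i)
  have hpi : |Real.pi * h i| ≤ Real.pi / 2 := by
    rw [abs_mul, abs_of_pos Real.pi_pos]
    nlinarith [Real.pi_pos]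
  have hsin : 2 * |h i| ≤ |Real.sin (Real.pi * h i)| := by
    have hjordan := Real.mul_abs_le_abs_sin hpi
    rwa [abs_mul, abs_of_pos Real.pi_pos, ← mul_assoc,
      div_mul_cancel₀ _ Real.pi_ne_zero] at hjordan
  calc 4 * ‖proj h i‖ ^ 2 = (2 * |h i|) ^ 2 := by rw [hn]; ring
    _ ≤ |Real.sin (Real.pi * h i)| ^ 2 := by gcongr
    _ = Real.sin (Real.pi * h i) ^ 2 := sq_abs _

lemma sinSq_le_pi_sq_mul_torusAbs_sq (z : T3) : sinSq z ≤ Real.pi ^ 2 * torusAbs z ^ 2 := by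
  obtain ⟨h, rfl, hn⟩ := exists_proj_eq_norm_eq z
  rw [sinSq_proj, ← hn, EuclideanSpace.real_norm_sq_eq, Finset.mul_sum]
  refine Finset.sum_le_sum fun i _ => ?_
  rw [← mul_pow]
  exact sq_le_sq.2 Real.abs_sin_le_abs

lemma pd_sinSq_proj (i : Fin 3) (y : Fin 3 → ℝ) :
    pd i sinSq (proj y) =
      2 * Real.sin (Real.pi * y i) * (Real.cos (Real.pi * y i) * Real.pi) := by
  have hd : ∀ j, HasDerivAt
      (fun s : ℝ => Real.sin (Real.pi * (y + s • (Pi.single i 1 : Fin 3 → ℝ)) j) ^ 2)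
      (if j = i then
        2 * Real.sin (Real.pi * y i) * (Real.cos (Real.pi * y i) * Real.pi) else 0) 0 := by
    intro j
    split_ifs with h
    · subst h
      have hline : HasDerivAt (fun s : ℝ => Real.pi * (y j + s)) Real.pi 0 := by
        simpa using ((hasDerivAt_id (0 : ℝ)).const_add (y j)).const_mul Real.pi
      simpa using hline.sin.fun_pow 2
    · simpa [h] using hasDerivAt_const (0 : ℝ) (Real.sin (Real.pi * y j) ^ 2)
  unfold pd
  simp_rw [proj_add_proj_single, sinSq_proj]
  rw [(HasDerivAt.fun_sum fun j _ => hd j).deriv]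
  simp

lemma abs_pd_sinSq_le (i : Fin 3) (z : T3) : |pd i sinSq z| ≤ 2 * Real.pi * √(sinSq z) := by
  obtain ⟨y, rfl⟩ := proj_surjective z
  have hsin : |Real.sin (Real.pi * y i)| ≤ √(sinSq (proj y)) := by
    refine Real.abs_le_sqrt ?_
    rw [sinSq_proj]
    exact Finset.single_le_sum (f := fun i => Real.sin (Real.pi * y i) ^ 2)
      (fun _ _ => sq_nonneg _) (Finset.mem_univ i)
  rw [pd_sinSq_proj, abs_mul, abs_mul, abs_mul, abs_of_pos Real.pi_pos, abs_two]
  calc 2 * |Real.sin (Real.pi * y i)| * (|Real.cos (Real.pi * y i)| * Real.pi)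
      ≤ 2 * √(sinSq (proj y)) * (1 * Real.pi) := by
        gcongr
        exact Real.abs_cos_le_one _
    _ = 2 * Real.pi * √(sinSq (proj y)) := by ring

lemma exists_abs_pd_pd_sinSq_le : ∃ D, ∀ i j z, |pd j (pd i sinSq) z| ≤ D := by
  obtain ⟨D, -, hD⟩ := exists_forall_norm_le (f := fun z i j => pd j (pd i sinSq) z)
    (continuous_pi fun i => continuous_pi fun j => ((isSmooth_sinSq.pd i).pd j).continuous)
  exact ⟨D, fun i j z =>
    (norm_le_pi_norm _ j).trans ((norm_le_pi_norm (fun i j => pd j (pd i sinSq) z) i).trans (hD z))⟩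

/-- A smooth cutoff, equal to `1` on `(-∞, 1/2]` and to `0` on `[1, ∞)`. -/
def cutoff (t : ℝ) : ℝ := Real.smoothTransition (2 - 2 * t)

lemma contDiff_cutoff : ContDiff ℝ ∞ cutoff :=
  Real.smoothTransition.contDiff.comp (by fun_prop)

lemma contDiff_deriv_cutoff : ContDiff ℝ ∞ (deriv cutoff) :=
  (contDiff_infty_iff_deriv.1 contDiff_cutoff).2

lemma cutoff_of_one_le {t : ℝ} (ht : 1 ≤ t) : cutoff t = 0 :=
  Real.smoothTransition.zero_of_nonpos (by linarith)

lemma cutoff_of_le_half {t : ℝ} (ht : t ≤ 1 / 2) : cutoff t = 1 :=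
  Real.smoothTransition.one_of_one_le (by linarith)

lemma hasCompactSupport_deriv_cutoff : HasCompactSupport (deriv cutoff) := by
  refine HasCompactSupport.intro (isCompact_Icc (a := (1 / 2 : ℝ)) (b := 1)) fun t ht => ?_
  rcases not_and_or.1 ht with ht | ht
  · have h : cutoff =ᶠ[𝓝 t] fun _ => 1 :=
      (gt_mem_nhds (not_le.1 ht)).mono fun s hs => cutoff_of_le_half hs.le
    simp [h.deriv_eq]
  · have h : cutoff =ᶠ[𝓝 t] fun _ => 0 :=
      (lt_mem_nhds (not_le.1 ht)).mono fun s hs => cutoff_of_one_le hs.le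
    simp [h.deriv_eq]

/-- A smooth bump at scale `ε` around the origin of the torus. -/
def bump (ε : ℝ) (z : T3) : ℝ := cutoff ((ε ^ 2)⁻¹ * sinSq z)

section Bump

variable {ε : ℝ}

lemma isSmooth_inv_sq_mul_sinSq (ε : ℝ) : IsSmooth fun z => (ε ^ 2)⁻¹ * sinSq z :=
  (IsSmooth.const _).mul isSmooth_sinSq

lemma isSmooth_bump (ε : ℝ) : IsSmooth (bump ε) :=
  (isSmooth_inv_sq_mul_sinSq ε).comp contDiff_cutoff

lemma bump_neg (z : T3) : bump ε (-z) = bump ε z := by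
  simp only [bump, sinSq_neg]

lemma bump_nonneg (z : T3) : 0 ≤ bump ε z := Real.smoothTransition.nonneg _

lemma bump_le_one (z : T3) : bump ε z ≤ 1 := Real.smoothTransition.le_one _

lemma bump_eq_zero (hε : 0 < ε) {z : T3} (hz : ε < torusAbs z) : bump ε z = 0 := by
  refine cutoff_of_one_le ?_
  rw [← div_eq_inv_mul, one_le_div (by positivity)]
  nlinarith [four_mul_torusAbs_sq_le_sinSq z]

lemma bump_eq_one (hε : 0 < ε) {z : T3} (hz : ‖z‖ ≤ ε / 8) : bump ε z = 1 := by
  refine cutoff_of_le_half ?_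
  have hpi : Real.pi ^ 2 ≤ 10 := by nlinarith [Real.pi_lt_d2, Real.pi_pos]
  rw [← div_eq_inv_mul, div_le_iff₀ (by positivity)]
  calc sinSq z ≤ Real.pi ^ 2 * torusAbs z ^ 2 := sinSq_le_pi_sq_mul_torusAbs_sq z
    _ ≤ 10 * (3 * (ε / 8) ^ 2) := by
        gcongr
        exact (torusAbs_sq_le z).trans (by gcongr)
    _ ≤ 1 / 2 * ε ^ 2 := by nlinarith [sq_nonneg ε]

lemma pow_div_le_integral_bump (hε : 0 < ε) (hε1 : ε ≤ 1) : ε ^ 3 / 64 ≤ ∫ z, bump ε z := by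
  calc ε ^ 3 / 64 = ∫ _z in Metric.closedBall (0 : T3) (ε / 8), (1 : ℝ) := by
        rw [setIntegral_const, volume_real_closedBall_zero (by positivity),
          min_eq_right (by linarith)]
        simp only [smul_eq_mul]
        ring
    _ = ∫ z in Metric.closedBall (0 : T3) (ε / 8), bump ε z :=
        (setIntegral_congr_fun measurableSet_closedBall fun _ hz =>
          bump_eq_one hε (by simpa using hz)).symm
    _ ≤ ∫ z, bump ε z :=
        setIntegral_le_integral (integrable_of_continuous (isSmooth_bump ε).continuous)
          (Eventually.of_forall bump_nonneg)

lemma pd_bump (i : Fin 3) (z : T3) :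
    pd i (bump ε) z = deriv cutoff ((ε ^ 2)⁻¹ * sinSq z) * ((ε ^ 2)⁻¹ * pd i sinSq z) := by
  unfold bump
  rw [pd_comp (contDiff_cutoff.differentiable (by simp)) (isSmooth_inv_sq_mul_sinSq ε),
    pd_const_mul isSmooth_sinSq]

lemma pd_pd_bump (i j : Fin 3) (z : T3) :
    pd j (pd i (bump ε)) z =
      deriv (deriv cutoff) ((ε ^ 2)⁻¹ * sinSq z) * ((ε ^ 2)⁻¹ * pd j sinSq z)
          * ((ε ^ 2)⁻¹ * pd i sinSq z)
        + deriv cutoff ((ε ^ 2)⁻¹ * sinSq z) * ((ε ^ 2)⁻¹ * pd j (pd i sinSq) z) := by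
  rw [funext (pd_bump i), pd_mul ((isSmooth_inv_sq_mul_sinSq ε).comp contDiff_deriv_cutoff)
    ((IsSmooth.const _).mul (isSmooth_sinSq.pd i)),
    pd_comp (contDiff_deriv_cutoff.differentiable (by simp)) (isSmooth_inv_sq_mul_sinSq ε),
    pd_const_mul isSmooth_sinSq, pd_const_mul (isSmooth_sinSq.pd i)]

lemma abs_inv_sq_mul_pd_sinSq_le (hε : 0 < ε) (i : Fin 3) (z : T3) :
    |(ε ^ 2)⁻¹ * pd i sinSq z| ≤ 2 * Real.pi / ε * √((ε ^ 2)⁻¹ * sinSq z) := by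
  rw [Real.sqrt_mul (by positivity), Real.sqrt_inv, Real.sqrt_sq hε.le, abs_mul,
    abs_of_pos (by positivity : 0 < (ε ^ 2)⁻¹)]
  calc (ε ^ 2)⁻¹ * |pd i sinSq z| ≤ (ε ^ 2)⁻¹ * (2 * Real.pi * √(sinSq z)) := by
        gcongr
        exact abs_pd_sinSq_le i z
    _ = 2 * Real.pi / ε * (ε⁻¹ * √(sinSq z)) := by field_simp

lemma exists_abs_pd_bump_le :
    ∃ D, ∀ ε, 0 < ε → ∀ i z, |pd i (bump ε) z| ≤ D / ε := by
  obtain ⟨B, hB⟩ :=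
    (hasCompactSupport_deriv_cutoff.mul_right (f' := (√·))).exists_bound_of_continuous
      (contDiff_deriv_cutoff.continuous.mul Real.continuous_sqrt)
  refine ⟨B * (2 * Real.pi), fun ε hε i z => ?_⟩
  set t := (ε ^ 2)⁻¹ * sinSq z
  have hBt : |deriv cutoff t| * √t ≤ B := by
    simpa [abs_mul, abs_of_nonneg (Real.sqrt_nonneg t)] using hB t
  calc |pd i (bump ε) z| = |deriv cutoff t| * |(ε ^ 2)⁻¹ * pd i sinSq z| := by
        rw [pd_bump, abs_mul]
    _ ≤ |deriv cutoff t| * (2 * Real.pi / ε * √t) := by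
        gcongr
        exact abs_inv_sq_mul_pd_sinSq_le hε i z
    _ = |deriv cutoff t| * √t * (2 * Real.pi) / ε := by ring
    _ ≤ B * (2 * Real.pi) / ε := by gcongr

lemma exists_abs_pd_pd_bump_le :
    ∃ D, ∀ ε, 0 < ε → ∀ i j z, |pd j (pd i (bump ε)) z| ≤ D / ε ^ 2 := by
  obtain ⟨B₁, hB₁⟩ := hasCompactSupport_deriv_cutoff.exists_bound_of_continuous
    contDiff_deriv_cutoff.continuous
  obtain ⟨B₂, hB₂⟩ :=
    (hasCompactSupport_deriv_cutoff.deriv.mul_right (f' := id)).exists_bound_of_continuous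
      (((contDiff_infty_iff_deriv.1 contDiff_deriv_cutoff).2).continuous.mul continuous_id)
  obtain ⟨D, hD⟩ := exists_abs_pd_pd_sinSq_le
  have hB₁0 : 0 ≤ B₁ := (norm_nonneg _).trans (hB₁ 0)
  refine ⟨B₂ * (2 * Real.pi) ^ 2 + B₁ * D, fun ε hε i j z => ?_⟩
  set t := (ε ^ 2)⁻¹ * sinSq z with ht
  have ht0 : 0 ≤ t := mul_nonneg (by positivity) (sinSq_nonneg z)
  have hB₂t : |deriv (deriv cutoff) t| * t ≤ B₂ := by
    simpa [abs_mul, abs_of_nonneg ht0] using hB₂ t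
  have hinv : |(ε ^ 2)⁻¹| = (ε ^ 2)⁻¹ := abs_of_pos (by positivity)
  calc |pd j (pd i (bump ε)) z|
      ≤ |deriv (deriv cutoff) t| * |(ε ^ 2)⁻¹ * pd j sinSq z| * |(ε ^ 2)⁻¹ * pd i sinSq z|
          + |deriv cutoff t| * ((ε ^ 2)⁻¹ * |pd j (pd i sinSq) z|) := by
        rw [pd_pd_bump]
        refine (abs_add_le _ _).trans_eq ?_
        simp only [abs_mul, hinv, ht]
    _ ≤ |deriv (deriv cutoff) t| * (2 * Real.pi / ε * √t) * (2 * Real.pi / ε * √t)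
          + B₁ * ((ε ^ 2)⁻¹ * D) := by
        gcongr
        exacts [abs_inv_sq_mul_pd_sinSq_le hε j z, abs_inv_sq_mul_pd_sinSq_le hε i z, hB₁ t,
          hD i j z]
    _ = (|deriv (deriv cutoff) t| * (√t * √t) * (2 * Real.pi) ^ 2 + B₁ * D) / ε ^ 2 := by
        field_simp
    _ ≤ (B₂ * (2 * Real.pi) ^ 2 + B₁ * D) / ε ^ 2 := by
        rw [Real.mul_self_sqrt ht0]
        gcongr

end Bump

/-- `k` is a smooth even probability density on the torus, supported in the ball of radius `ε`,
which is bounded together with its first two derivatives as an `ε`-rescaled bump, with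
constant `C`. -/
structure IsMollifier (C ε : ℝ) (k : T3 → ℝ) : Prop where
  smooth : IsSmooth k
  even : ∀ z, k (-z) = k z
  nonneg : ∀ z, 0 ≤ k z
  integral_eq_one : ∫ z, k z = 1
  eq_zero : ∀ z, ε < torusAbs z → k z = 0
  le : ∀ z, k z ≤ C / ε ^ 3
  abs_pd_le : ∀ i z, |pd i k z| ≤ C / ε ^ 4
  abs_pd_pd_le : ∀ i j z, |pd j (pd i k) z| ≤ C / ε ^ 5

/-- The normalized bump at scale `ε`. -/
def mollifier (ε : ℝ) (z : T3) : ℝ := (∫ w, bump ε w)⁻¹ * bump ε z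

lemma exists_isMollifier_mollifier :
    ∃ C, 1 ≤ C ∧ ∀ ε, 0 < ε → ε ≤ 1 → IsMollifier C ε (mollifier ε) := by
  obtain ⟨D₁, hD₁⟩ := exists_abs_pd_bump_le
  obtain ⟨D₂, hD₂⟩ := exists_abs_pd_pd_bump_le
  refine ⟨64 * max 1 (max D₁ D₂), by linarith [le_max_left 1 (max D₁ D₂)], fun ε hε hε1 => ?_⟩
  have hmass := pow_div_le_integral_bump hε hε1
  have hpos : 0 < ∫ z, bump ε z := lt_of_lt_of_le (by positivity) hmass
  have hscale : ∀ (n : ℕ) {D x : ℝ}, D ≤ max 1 (max D₁ D₂) → |x| ≤ D / ε ^ n →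
      |(∫ z, bump ε z)⁻¹ * x| ≤ 64 * max 1 (max D₁ D₂) / ε ^ (n + 3) := by
    intro n D x hD hx
    rw [abs_mul, abs_of_pos (inv_pos.2 hpos)]
    calc (∫ z, bump ε z)⁻¹ * |x| ≤ (ε ^ 3 / 64)⁻¹ * (max 1 (max D₁ D₂) / ε ^ n) := by
          gcongr
          exact hx.trans (by gcongr)
      _ = 64 * max 1 (max D₁ D₂) / ε ^ (n + 3) := by rw [pow_add]; field_simp
  have hpd : ∀ i, pd i (mollifier ε) = fun z => (∫ w, bump ε w)⁻¹ * pd i (bump ε) z := fun i =>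
    funext fun z => pd_const_mul (isSmooth_bump ε) _ i z
  refine
    { smooth := (IsSmooth.const _).mul (isSmooth_bump ε)
      even := fun z => by simp only [mollifier, bump_neg]
      nonneg := fun z => mul_nonneg (inv_pos.2 hpos).le (bump_nonneg z)
      integral_eq_one := by
        simp only [mollifier]
        rw [integral_const_mul, inv_mul_cancel₀ hpos.ne']
      eq_zero := fun z hz => by rw [mollifier, bump_eq_zero hε hz, mul_zero]
      le := fun z => (le_abs_self _).trans (hscale 0 (le_max_left _ _) ?_)
      abs_pd_le := fun i z => ?_
      abs_pd_pd_le := fun i j z => ?_ }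
  · simpa [abs_of_nonneg (bump_nonneg z)] using bump_le_one z
  · rw [hpd]
    exact hscale 1 ((le_max_left _ _).trans (le_max_right _ _)) (by simpa using hD₁ ε hε i z)
  · rw [hpd, pd_const_mul ((isSmooth_bump ε).pd i)]
    exact hscale 2 ((le_max_right _ _).trans (le_max_right _ _)) (hD₂ ε hε i j z)

lemma pd_congr {f g : T3 → ℝ} {x : T3} (h : f =ᶠ[𝓝 x] g) (i : Fin 3) : pd i f x = pd i g x := by
  have hcont : Continuous fun s : ℝ => x + proj (Pi.single i s) :=
    continuous_const.add (isOpenQuotientMap_proj.continuous.comp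
      (continuous_single (A := fun _ => ℝ) i))
  have hlim : Tendsto (fun s : ℝ => x + proj (Pi.single i s)) (𝓝 0) (𝓝 x) := by
    simpa [proj_zero] using hcont.tendsto 0
  exact Filter.EventuallyEq.deriv_eq (hlim.eventually h)

lemma pd_eq_zero_of_lt_torusAbs {f : T3 → ℝ} {ε : ℝ} (hf : ∀ z, ε < torusAbs z → f z = 0)
    (i : Fin 3) {z : T3} (hz : ε < torusAbs z) : pd i f z = 0 := by
  have h : f =ᶠ[𝓝 z] fun _ => 0 :=
    (continuous_torusAbs.continuousAt.eventually (lt_mem_nhds hz)).mono hf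
  rw [pd_congr h, pd_const]

namespace IsMollifier

variable {C ε : ℝ} {k : T3 → ℝ}

lemma pd_eq_zero (hk : IsMollifier C ε k) (i : Fin 3) (z : T3) (hz : ε < torusAbs z) :
    pd i k z = 0 :=
  pd_eq_zero_of_lt_torusAbs hk.eq_zero i hz

lemma integral_sq_le (hk : IsMollifier C ε k) : ∫ z, k z ^ 2 ≤ C / ε ^ 3 := by
  calc ∫ z, k z ^ 2 ≤ ∫ z, C / ε ^ 3 * k z := by
        refine integral_mono (integrable_of_continuous (hk.smooth.continuous.pow 2))
          ((integrable_of_continuous hk.smooth.continuous).const_mul _) fun z => ?_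
        rw [sq]
        exact mul_le_mul_of_nonneg_right (hk.le z) (hk.nonneg z)
    _ = C / ε ^ 3 := by rw [integral_const_mul, hk.integral_eq_one, mul_one]

lemma integral_abs_pd_le (hk : IsMollifier C ε k) (hε : 0 < ε) (i : Fin 3) :
    ∫ z, |pd i k z| ≤ 8 * C / ε := by
  have h := norm_integral_le_of_eq_zero (h := fun z => |pd i k z|) hε.le
    (fun z => (by simpa using hk.abs_pd_le i z)) fun z hz => by simp [hk.pd_eq_zero i z hz]
  calc ∫ z, |pd i k z| ≤ C / ε ^ 4 * (2 * ε) ^ 3 := (Real.le_norm_self _).trans h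
    _ = 8 * C / ε := by field_simp; ring

lemma integral_sq_pd_le (hk : IsMollifier C ε k) (hε : 0 < ε) (i : Fin 3) :
    ∫ z, pd i k z ^ 2 ≤ 8 * C ^ 2 / ε ^ 5 := by
  have h := norm_integral_le_of_eq_zero (h := fun z => pd i k z ^ 2) hε.le
    (fun z => (by simpa using pow_le_pow_left₀ (abs_nonneg _) (hk.abs_pd_le i z) 2))
    fun z hz => by simp [hk.pd_eq_zero i z hz]
  calc ∫ z, pd i k z ^ 2 ≤ (C / ε ^ 4) ^ 2 * (2 * ε) ^ 3 := (Real.le_norm_self _).trans h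
    _ = 8 * C ^ 2 / ε ^ 5 := by field_simp; ring

lemma integral_abs_pd_pd_le (hk : IsMollifier C ε k) (hε : 0 < ε) (i j : Fin 3) :
    ∫ z, |pd j (pd i k) z| ≤ 8 * C / ε ^ 2 := by
  have h := norm_integral_le_of_eq_zero (h := fun z => |pd j (pd i k) z|) hε.le
    (fun z => (by simpa using hk.abs_pd_pd_le i j z)) fun z hz => by
      simp [pd_eq_zero_of_lt_torusAbs (hk.pd_eq_zero i) j hz]
  calc ∫ z, |pd j (pd i k) z| ≤ C / ε ^ 5 * (2 * ε) ^ 3 := (Real.le_norm_self _).trans h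
    _ = 8 * C / ε ^ 2 := by field_simp; ring

end IsMollifier

/-! ### Minkowski's integral inequality -/

section Minkowski

variable {X Z E : Type*} {mX : MeasurableSpace X} {mZ : MeasurableSpace Z} [NormedAddCommGroup E]
  {μ : Measure X} {ν : Measure Z} {q : ℝ}

lemma rpow_lintegral_mul_le (hq : 1 ≤ q) {w F : Z → ℝ≥0∞} (hw : AEMeasurable w ν)
    (hF : AEMeasurable F ν) :
    (∫⁻ z, w z * F z ∂ν) ^ q ≤ (∫⁻ z, w z ∂ν) ^ (q - 1) * ∫⁻ z, w z * F z ^ q ∂ν := by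
  have hq0 : 0 < q := zero_lt_one.trans_le hq
  have hac : ν.withDensity w ≪ ν := withDensity_absolutelyContinuous ν w
  have hnorm := eLpNorm_le_eLpNorm_mul_rpow_measure_univ (μ := ν.withDensity w) (p := 1)
    (q := ENNReal.ofReal q) (by simpa using ENNReal.ofReal_le_ofReal hq)
    (hF.mono_ac hac).aestronglyMeasurable
  rw [eLpNorm_one_eq_lintegral_enorm, eLpNorm_eq_lintegral_rpow_enorm_toReal (by simpa using hq0)
    ENNReal.ofReal_ne_top, ENNReal.toReal_ofReal hq0.le, ENNReal.toReal_one, div_one,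
    withDensity_apply _ MeasurableSet.univ, Measure.restrict_univ] at hnorm
  simp only [enorm_eq_self] at hnorm
  rw [lintegral_withDensity_eq_lintegral_mul₀ hw hF,
    lintegral_withDensity_eq_lintegral_mul₀ hw (hF.pow_const q)] at hnorm
  calc (∫⁻ z, w z * F z ∂ν) ^ q ≤ _ := ENNReal.rpow_le_rpow hnorm hq0.le
    _ = _ := by
      rw [ENNReal.mul_rpow_of_nonneg _ _ hq0.le, ← ENNReal.rpow_mul, ← ENNReal.rpow_mul,
        one_div, inv_mul_cancel₀ hq0.ne', ENNReal.rpow_one, mul_comm, sub_mul,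
        inv_mul_cancel₀ hq0.ne', one_mul]
      rfl

lemma rpow_sub_one_mul_mul_rpow {a A : ℝ≥0∞} (hq : 1 ≤ q) (ha : a ≠ ⊤) :
    a ^ (q - 1) * (a * A ^ q) = (a * A) ^ q := by
  rcases eq_or_ne a 0 with rfl | ha0
  · simp [zero_lt_one.trans_le hq]
  · rw [ENNReal.mul_rpow_of_nonneg _ _ (by linarith), ← mul_assoc]
    nth_rw 2 [← ENNReal.rpow_one a]
    rw [← ENNReal.rpow_add _ _ ha0 ha, sub_add_cancel]

lemma eLpNorm_ofReal_le_iff (hq : 0 < q) {f : X → E} {A : ℝ≥0∞} :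
    eLpNorm f (ENNReal.ofReal q) μ ≤ A ↔ ∫⁻ x, ‖f x‖ₑ ^ q ∂μ ≤ A ^ q := by
  rw [eLpNorm_eq_lintegral_rpow_enorm_toReal (by simpa using hq) ENNReal.ofReal_ne_top,
    ENNReal.toReal_ofReal hq.le, one_div, ENNReal.rpow_inv_le_iff hq]

lemma eLpNorm_integral_smul_le [NormedSpace ℝ E] [SFinite μ] [SFinite ν] (hq : 1 ≤ q)
    {g : Z → ℝ} (hg : Integrable g ν) {F : X × Z → E} (hF : AEStronglyMeasurable F (μ.prod ν))
    {A : ℝ≥0∞} (hA : ∀ z, g z ≠ 0 → eLpNorm (fun x => F (x, z)) (ENNReal.ofReal q) μ ≤ A) :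
    eLpNorm (fun x => ∫ z, g z • F (x, z) ∂ν) (ENNReal.ofReal q) μ ≤
      (∫⁻ z, ‖g z‖ₑ ∂ν) * A := by
  have hq0 : 0 < q := zero_lt_one.trans_le hq
  have hgm : AEMeasurable (fun z => ‖g z‖ₑ) ν := hg.aestronglyMeasurable.enorm
  have hprod : AEMeasurable (fun r : X × Z => ‖g r.2‖ₑ * ‖F (r.1, r.2)‖ₑ ^ q) (μ.prod ν) :=
    hgm.comp_snd.mul (hF.enorm.pow_const q)
  set a := ∫⁻ z, ‖g z‖ₑ ∂ν with ha
  rw [eLpNorm_ofReal_le_iff hq0]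
  calc ∫⁻ x, ‖∫ z, g z • F (x, z) ∂ν‖ₑ ^ q ∂μ
      ≤ ∫⁻ x, a ^ (q - 1) * ∫⁻ z, ‖g z‖ₑ * ‖F (x, z)‖ₑ ^ q ∂ν ∂μ := by
        refine lintegral_mono_ae ?_
        filter_upwards [hF.prodMk_left] with x hx
        refine le_trans ?_ (rpow_lintegral_mul_le hq hgm hx.enorm)
        refine ENNReal.rpow_le_rpow ?_ hq0.le
        simpa only [enorm_smul] using enorm_integral_le_lintegral_enorm fun z => g z • F (x, z)
    _ = a ^ (q - 1) * ∫⁻ z, ∫⁻ x, ‖g z‖ₑ * ‖F (x, z)‖ₑ ^ q ∂μ ∂ν := by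
        rw [lintegral_const_mul'' _ hprod.lintegral_prod_right', lintegral_lintegral_swap hprod]
    _ ≤ a ^ (q - 1) * ∫⁻ z, ‖g z‖ₑ * A ^ q ∂ν := by
        refine mul_le_mul_right (lintegral_mono_ae ?_) _
        filter_upwards [hF.prod_swap.prodMk_left] with z hz
        rw [lintegral_const_mul'' (f := fun x => ‖F (x, z)‖ₑ ^ q) _ (hz.enorm.pow_const q)]
        rcases eq_or_ne (g z) 0 with hgz | hgz
        · simp [hgz]
        · exact mul_le_mul_right ((eLpNorm_ofReal_le_iff hq0).1 (hA z hgz)) _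
    _ = (a * A) ^ q := by
        rw [lintegral_mul_const'' _ hgm, ← ha, rpow_sub_one_mul_mul_rpow hq hg.2.ne]

lemma ofReal_integral_abs {g : Z → ℝ} (hg : Integrable g ν) :
    ENNReal.ofReal (∫ z, |g z| ∂ν) = ∫⁻ z, ‖g z‖ₑ ∂ν := by
  simpa only [Real.norm_eq_abs] using ofReal_integral_norm_eq_lintegral_enorm hg

end Minkowski

section Translation

variable {E : Type*} [NormedAddCommGroup E] {w : T3 → E}

lemma aestronglyMeasurable_comp_sub (hw : AEStronglyMeasurable w) :
    AEStronglyMeasurable (fun r : T3 × T3 => w (r.1 - r.2)) (volume.prod volume) :=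
  hw.comp_quasiMeasurePreserving (quasiMeasurePreserving_sub volume volume)

lemma aestronglyMeasurable_increment (hw : AEStronglyMeasurable w) :
    AEStronglyMeasurable (fun r : T3 × T3 => w (r.1 - r.2) - w r.1) (volume.prod volume) :=
  (aestronglyMeasurable_comp_sub hw).sub hw.comp_fst

lemma aestronglyMeasurable_translate_sub (hw : AEStronglyMeasurable w) (z : T3) :
    AEStronglyMeasurable fun x => w (x - z) - w x :=
  (hw.comp_measurePreserving (measurePreserving_sub_right volume z)).sub hw

lemma eLpNorm_comp_sub_right (hw : AEStronglyMeasurable w) (p : ℝ≥0∞) (z : T3) :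
    eLpNorm (fun x => w (x - z)) p volume = eLpNorm w p volume :=
  eLpNorm_comp_measurePreserving hw (measurePreserving_sub_right volume z)

end Translation

section ConvolutionBounds

variable {f g : T3 → ℝ} {q : ℝ}

lemma convolution_sub_integral_mul (hg : Continuous g) (hf : Integrable f) (x : T3) :
    (g ⋆ f) x - (∫ z, g z) * f x = ∫ z, g z • (f (x - z) - f x) := by
  simp only [convolution_lsmul, smul_eq_mul, mul_sub]
  rw [← integral_mul_const, ← integral_sub (integrable_continuous_mul hg (hf.comp_sub_left x))
    ((integrable_of_continuous hg).mul_const _)]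

lemma eLpNorm_convolution_sub_le (hq : 1 ≤ q) (hg : Continuous g) (hf : Integrable f) {A : ℝ≥0∞}
    (hA : ∀ z, g z ≠ 0 → eLpNorm (fun x => f (x - z) - f x) (ENNReal.ofReal q) volume ≤ A) :
    eLpNorm (fun x => (g ⋆ f) x - (∫ z, g z) * f x) (ENNReal.ofReal q) volume ≤
      ENNReal.ofReal (∫ z, |g z|) * A := by
  simp_rw [convolution_sub_integral_mul hg hf, ofReal_integral_abs (integrable_of_continuous hg)]
  exact eLpNorm_integral_smul_le hq (integrable_of_continuous hg)
    (aestronglyMeasurable_increment hf.aestronglyMeasurable) hA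

lemma eLpNorm_convolution_le (hq : 1 ≤ q) (hg : Continuous g) (hf : Integrable f) :
    eLpNorm (g ⋆ f) (ENNReal.ofReal q) volume ≤
      ENNReal.ofReal (∫ z, |g z|) * eLpNorm f (ENNReal.ofReal q) volume := by
  rw [ofReal_integral_abs (integrable_of_continuous hg)]
  exact eLpNorm_integral_smul_le hq (integrable_of_continuous hg)
    (aestronglyMeasurable_comp_sub hf.aestronglyMeasurable)
    fun z _ => (eLpNorm_comp_sub_right hf.aestronglyMeasurable _ z).le

end ConvolutionBounds

/-! ### The Gagliardo seminorm -/

section Gagliardo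

/-- The squared Gagliardo seminorm of `H^{1/2}(𝕋³)`, with value `∞` outside the space. -/
def gagliardo {E : Type*} [NormedAddCommGroup E] (w : T3 → E) : ℝ≥0∞ :=
  ∫⁻ x : T3, ∫⁻ y : T3, ‖w x - w y‖ₑ ^ 2 / ENNReal.ofReal (torusAbs (x - y) ^ 4)

lemma sobolevHalfNorm_eq (v : T3 → E3) :
    sobolevHalfNorm v = eLpNorm v 2 volume + gagliardo v ^ (1 / 2 : ℝ) := rfl

variable {E : Type*} [NormedAddCommGroup E]

lemma gagliardo_eq_lintegral_increment (w : T3 → E) :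
    gagliardo w =
      ∫⁻ x : T3, ∫⁻ z : T3, ‖w (x - z) - w x‖ₑ ^ 2 / ENNReal.ofReal (torusAbs z ^ 4) := by
  refine lintegral_congr fun x => ?_
  rw [← lintegral_sub_left_eq_self _ x]
  refine lintegral_congr fun z => ?_
  rw [sub_sub_cancel, ← enorm_neg, neg_sub]

lemma eLpNorm_two_sq {X : Type*} {mX : MeasurableSpace X} (μ : Measure X) (w : X → E) :
    eLpNorm w 2 μ ^ 2 = ∫⁻ x, ‖w x‖ₑ ^ 2 ∂μ := by
  rw [eLpNorm_eq_lintegral_rpow_enorm_toReal (by simp) (by simp), ← ENNReal.rpow_natCast,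
    ← ENNReal.rpow_mul]
  simp

lemma measurable_ofReal_torusAbs_pow (n : ℕ) :
    Measurable fun z : T3 => ENNReal.ofReal (torusAbs z ^ n) :=
  (continuous_torusAbs.pow n).measurable.ennreal_ofReal

lemma aemeasurable_gagliardo_integrand {w : T3 → E} (hw : AEStronglyMeasurable w) :
    AEMeasurable (fun r : T3 × T3 =>
      ‖w (r.1 - r.2) - w r.1‖ₑ ^ 2 / ENNReal.ofReal (torusAbs r.2 ^ 4)) (volume.prod volume) :=
  ((aestronglyMeasurable_increment hw).enorm.pow_const 2).div
    ((measurable_ofReal_torusAbs_pow 4).comp measurable_snd).aemeasurable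

/-- The constant in the embedding of `B^s_{2,∞}` into `H^{1/2}`; it is finite for `s > 1/2`. -/
def gagliardoConst (s : ℝ) : ℝ≥0∞ :=
  ∫⁻ z : T3, ENNReal.ofReal (torusAbs z ^ s) ^ 2 / ENNReal.ofReal (torusAbs z ^ 4)

lemma gagliardo_le {w : T3 → E} (hw : AEStronglyMeasurable w) {s M : ℝ} (hM : 0 ≤ M)
    (h : ∀ z, eLpNorm (fun x => w (x - z) - w x) 2 volume ≤ ENNReal.ofReal (M * torusAbs z ^ s)) :
    gagliardo w ≤ ENNReal.ofReal M ^ 2 * gagliardoConst s := by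
  have hmeas : Measurable fun z : T3 =>
      ENNReal.ofReal (torusAbs z ^ s) ^ 2 / ENNReal.ofReal (torusAbs z ^ 4) :=
    ((continuous_torusAbs.measurable.pow_const s).ennreal_ofReal.pow_const 2).div
      (measurable_ofReal_torusAbs_pow 4)
  rw [gagliardo_eq_lintegral_increment,
    lintegral_lintegral_swap (aemeasurable_gagliardo_integrand hw), gagliardoConst,
    ← lintegral_const_mul _ hmeas]
  refine lintegral_mono fun z => ?_
  calc ∫⁻ x, ‖w (x - z) - w x‖ₑ ^ 2 / ENNReal.ofReal (torusAbs z ^ 4)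
      = eLpNorm (fun x => w (x - z) - w x) 2 volume ^ 2 / ENNReal.ofReal (torusAbs z ^ 4) := by
        simp_rw [eLpNorm_two_sq, div_eq_mul_inv]
        exact lintegral_mul_const'' _ ((aestronglyMeasurable_translate_sub hw z).enorm.pow_const 2)
    _ ≤ ENNReal.ofReal (M * torusAbs z ^ s) ^ 2 / ENNReal.ofReal (torusAbs z ^ 4) := by
        gcongr
        exact h z
    _ = _ := by rw [ENNReal.ofReal_mul hM, mul_pow, mul_div_assoc]

lemma enorm_integral_mul_sq_le {Z : Type*} {mZ : MeasurableSpace Z} {ν : Measure Z} {g F : Z → ℝ}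
    {r : Z → ℝ≥0∞} (hg : AEStronglyMeasurable g ν) (hF : AEStronglyMeasurable F ν)
    (hr : AEMeasurable r ν) (hr0 : ∀ z, r z = 0 → F z = 0) (hrtop : ∀ z, r z ≠ ⊤) :
    ‖∫ z, g z * F z ∂ν‖ₑ ^ 2 ≤ (∫⁻ z, (‖g z‖ₑ * r z) ^ 2 ∂ν) * ∫⁻ z, (‖F z‖ₑ / r z) ^ 2 ∂ν := by
  have hsplit : ∀ z, ‖g z * F z‖ₑ ≤ (‖g z‖ₑ * r z) * (‖F z‖ₑ / r z) := fun z => by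
    rcases eq_or_ne (r z) 0 with hz | hz
    · simp [hr0 z hz]
    · rw [enorm_mul, mul_assoc, ENNReal.mul_div_cancel hz (hrtop z)]
  have holder := ENNReal.lintegral_mul_le_Lp_mul_Lq ν Real.HolderConjugate.two_two
    (hg.enorm.mul hr) (hF.enorm.div hr)
  simp only [Pi.mul_apply, ENNReal.rpow_ofNat] at holder
  calc ‖∫ z, g z * F z ∂ν‖ₑ ^ 2 ≤ (∫⁻ z, (‖g z‖ₑ * r z) * (‖F z‖ₑ / r z) ∂ν) ^ 2 := by
        gcongr
        exact (enorm_integral_le_lintegral_enorm _).trans (lintegral_mono hsplit)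
    _ ≤ _ := pow_le_pow_left₀ zero_le holder 2
    _ = _ := by
        rw [mul_pow, ← ENNReal.rpow_natCast, ← ENNReal.rpow_natCast, ← ENNReal.rpow_mul,
          ← ENNReal.rpow_mul]
        norm_num

lemma lintegral_mul_torusAbs_sq_le {g : T3 → ℝ} {ε : ℝ} (hg : Continuous g)
    (hε : ∀ z, ε < torusAbs z → g z = 0) :
    ∫⁻ z, (‖g z‖ₑ * ENNReal.ofReal (torusAbs z ^ 2)) ^ 2 ≤
      ENNReal.ofReal ((∫ z, g z ^ 2) * ε ^ 4) := by
  rw [← integral_mul_const, ofReal_integral_eq_lintegral_ofReal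
    ((integrable_of_continuous (f := fun z => g z ^ 2) (hg.pow 2)).mul_const _)
    (Eventually.of_forall fun z => by positivity)]
  refine lintegral_mono fun z => ?_
  rcases lt_or_ge ε (torusAbs z) with hz | hz
  · simp [hε z hz]
  · rw [Real.enorm_eq_ofReal_abs, ← ENNReal.ofReal_mul (abs_nonneg _),
      ← ENNReal.ofReal_pow (by positivity), mul_pow, sq_abs, ← pow_mul]
    gcongr
    exact torusAbs_nonneg z

lemma eLpNorm_convolution_sub_sq_le {f g : T3 → ℝ} {ε : ℝ} (hg : Continuous g)
    (hε : ∀ z, ε < torusAbs z → g z = 0) (hf : Integrable f) :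
    eLpNorm (fun x => (g ⋆ f) x - (∫ z, g z) * f x) 2 volume ^ 2 ≤
      ENNReal.ofReal ((∫ z, g z ^ 2) * ε ^ 4) * gagliardo f := by
  have hzero : ∀ x z : T3, ENNReal.ofReal (torusAbs z ^ 2) = 0 → f (x - z) - f x = 0 := by
    intro x z hz
    have hnorm : ‖z‖ ≤ 0 := (norm_le_torusAbs z).trans (by
      nlinarith [ENNReal.ofReal_eq_zero.1 hz])
    simp [norm_le_zero_iff.1 hnorm]
  have hweight : ∀ x z : T3, (‖f (x - z) - f x‖ₑ / ENNReal.ofReal (torusAbs z ^ 2)) ^ 2 =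
      ‖f (x - z) - f x‖ₑ ^ 2 / ENNReal.ofReal (torusAbs z ^ 4) := fun x z => by
    rw [div_eq_mul_inv, div_eq_mul_inv, mul_pow, ← ENNReal.inv_pow,
      ← ENNReal.ofReal_pow (sq_nonneg _), ← pow_mul]
  simp_rw [convolution_sub_integral_mul hg hf, smul_eq_mul]
  rw [eLpNorm_two_sq, gagliardo_eq_lintegral_increment, ← lintegral_const_mul'' _
    (aemeasurable_gagliardo_integrand hf.aestronglyMeasurable).lintegral_prod_right']
  refine lintegral_mono_ae ?_
  filter_upwards [(aestronglyMeasurable_increment hf.aestronglyMeasurable).prodMk_left] with x hx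
  refine (enorm_integral_mul_sq_le hg.aestronglyMeasurable hx
    (measurable_ofReal_torusAbs_pow 2).aemeasurable (hzero x)
    fun _ => ENNReal.ofReal_ne_top).trans ?_
  simp_rw [hweight]
  gcongr
  exact lintegral_mul_torusAbs_sq_le hg hε

lemma integrable_norm_rpow_neg_unitAddCircle {b : ℝ} (hb : b < 1) :
    Integrable fun t : UnitAddCircle => ‖t‖ ^ (-b) := by
  have hpos : IntervalIntegrable (fun s : ℝ => |s| ^ (-b)) volume 0 (1 / 2) := by
    refine (intervalIntegral.intervalIntegrable_rpow' (r := -b) (by linarith)).congr fun s hs => ?_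
    rw [uIoc_of_le (by norm_num)] at hs
    simp [abs_of_pos hs.1]
  have hneg : IntervalIntegrable (fun s : ℝ => |s| ^ (-b)) volume (-(1 / 2)) 0 := by
    simpa using ((IntervalIntegrable.iff_comp_neg (by simp)).1 hpos).symm
  have hfin := (hneg.trans hpos).1.2
  refine ⟨(measurable_norm.pow_const _).aestronglyMeasurable, ?_⟩
  rw [HasFiniteIntegral, ← UnitAddCircle.lintegral_preimage (-(1 / 2))]
  rw [HasFiniteIntegral] at hfin
  norm_num at hfin ⊢
  refine lt_of_le_of_lt (setLIntegral_mono' measurableSet_Ioc fun s hs => ?_) hfin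
  rw [(AddCircle.norm_coe_eq_abs_iff 1 one_ne_zero).2
    (by rw [abs_le, abs_one]; constructor <;> linarith [hs.1, hs.2])]

lemma ae_apply_ne_zero (i : Fin 3) : ∀ᵐ z : T3, z i ≠ 0 := by
  have hnull : (volume : Measure UnitAddCircle) {0} = 0 := by
    rw [← Metric.closedBall_zero, AddCircle.volume_closedBall]
    simp
  exact compl_mem_ae_iff.2 (Measure.pi_eval_preimage_null
    (μ := fun _ : Fin 3 => (volume : Measure UnitAddCircle)) (i := i) hnull)

/-- The kernel is at most `∏ᵢ |zᵢ|^{-b}` with `3b = 4 - 2s`, which is integrable as `b < 1`. -/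
lemma gagliardoConst_lt_top {s : ℝ} (hs : 1 / 2 < s) (hs1 : s ≤ 1) : gagliardoConst s < ⊤ := by
  set b := (4 - 2 * s) / 3 with hb
  have hb1 : b < 1 := by rw [hb]; linarith
  have hb0 : 0 ≤ b := by rw [hb]; linarith
  have hint : Integrable (fun z : T3 => ∏ i, ‖z i‖ ^ (-b)) :=
    Integrable.fintype_prod fun _ => integrable_norm_rpow_neg_unitAddCircle hb1
  have hle : ∀ (z : T3) i, ‖z i‖ ≤ torusAbs z := fun z i =>
    (norm_le_pi_norm z i).trans (norm_le_torusAbs z)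
  refine lt_of_le_of_lt (lintegral_mono_ae ?_) hint.2
  filter_upwards [ae_all_iff.2 ae_apply_ne_zero] with z hz
  have hz : ∀ i, 0 < ‖z i‖ := fun i => norm_pos_iff.2 (hz i)
  have hr : 0 < torusAbs z := (hz 0).trans_le (hle z 0)
  rw [Real.enorm_eq_ofReal (Finset.prod_nonneg fun i _ => by positivity),
    ← ENNReal.ofReal_pow (by positivity), ← ENNReal.ofReal_div_of_pos (by positivity)]
  refine ENNReal.ofReal_le_ofReal ?_
  calc (torusAbs z ^ s) ^ 2 / torusAbs z ^ 4 = ∏ _i : Fin 3, torusAbs z ^ (-b) := by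
        rw [Finset.prod_const, Finset.card_univ, Fintype.card_fin, ← Real.rpow_natCast,
          ← Real.rpow_natCast (torusAbs z), ← Real.rpow_natCast (torusAbs z ^ (-b)),
          ← Real.rpow_mul hr.le, ← Real.rpow_mul hr.le, ← Real.rpow_sub hr]
        congr 1
        rw [hb]
        push_cast
        ring
    _ ≤ ∏ i, ‖z i‖ ^ (-b) := Finset.prod_le_prod (fun i _ => by positivity) fun i _ =>
        Real.rpow_le_rpow_of_nonpos (hz i) (hle z i) (neg_nonpos.2 hb0)

end Gagliardo

/-! ### Besov functions and their mollifications -/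

lemma IsMollifier.integral_abs {C ε : ℝ} {k : T3 → ℝ} (hk : IsMollifier C ε k) :
    ∫ z, |k z| = 1 := by
  simp_rw [abs_of_nonneg (hk.nonneg _)]
  exact hk.integral_eq_one

/-- The constant in the pointwise bounds of `mollifier`. -/
def mollifierBound : ℝ := exists_isMollifier_mollifier.choose

/-- The constant in the integral bounds of `mollifier`. -/
def mollifierConst : ℝ := 8 * mollifierBound ^ 2

lemma one_le_mollifierBound : 1 ≤ mollifierBound := exists_isMollifier_mollifier.choose_spec.1

lemma mollifierConst_nonneg : 0 ≤ mollifierConst := by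
  rw [mollifierConst]
  positivity

lemma eight_mul_mollifierBound_le : 8 * mollifierBound ≤ mollifierConst := by
  rw [mollifierConst]
  nlinarith [one_le_mollifierBound]

section MollifierBounds

variable {ε : ℝ} (h0 : 0 < ε) (h1 : ε ≤ 1) (i j : Fin 3)

include h0 h1

lemma isMollifier_mollifier : IsMollifier mollifierBound ε (mollifier ε) :=
  exists_isMollifier_mollifier.choose_spec.2 ε h0 h1

lemma integral_sq_mollifier_le : ∫ z, mollifier ε z ^ 2 ≤ mollifierConst / ε ^ 3 := by
  refine (isMollifier_mollifier h0 h1).integral_sq_le.trans ?_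
  gcongr
  linarith [eight_mul_mollifierBound_le, one_le_mollifierBound]

lemma integral_abs_pd_mollifier_le : ∫ z, |pd i (mollifier ε) z| ≤ mollifierConst / ε := by
  refine ((isMollifier_mollifier h0 h1).integral_abs_pd_le h0 i).trans ?_
  gcongr
  exact eight_mul_mollifierBound_le

lemma integral_sq_pd_mollifier_le : ∫ z, pd i (mollifier ε) z ^ 2 ≤ mollifierConst / ε ^ 5 :=
  (isMollifier_mollifier h0 h1).integral_sq_pd_le h0 i

lemma integral_abs_pd_pd_mollifier_le :
    ∫ z, |pd j (pd i (mollifier ε)) z| ≤ mollifierConst / ε ^ 2 := by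
  refine ((isMollifier_mollifier h0 h1).integral_abs_pd_pd_le h0 i j).trans ?_
  gcongr
  exact eight_mul_mollifierBound_le

end MollifierBounds

/-- `f` lies in the ball of radius `M` of `B^θ_{3,∞}(𝕋³)`. -/
structure IsBesov (θ M : ℝ) (f : T3 → ℝ) : Prop where
  aesm : AEStronglyMeasurable f
  norm_le : eLpNorm f 3 volume ≤ ENNReal.ofReal M
  increment_le : ∀ z, eLpNorm (fun x => f (x - z) - f x) 3 volume ≤
    ENNReal.ofReal (M * torusAbs z ^ θ)

namespace IsBesov

variable {θ M ε : ℝ} {f g : T3 → ℝ}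

lemma memLp (h : IsBesov θ M f) : MemLp f 3 :=
  ⟨h.aesm, h.norm_le.trans_lt ENNReal.ofReal_lt_top⟩

lemma memLp_two (h : IsBesov θ M f) : MemLp f 2 :=
  h.memLp.mono_exponent (by norm_num)

lemma integrable (h : IsBesov θ M f) : Integrable f :=
  h.memLp.integrable (by norm_num)

lemma increment_le_of_le (hf : IsBesov θ M f) (hθ : 0 ≤ θ) (hM : 0 ≤ M) {z : T3}
    (hz : torusAbs z ≤ ε) :
    eLpNorm (fun x => f (x - z) - f x) 3 volume ≤ ENNReal.ofReal (M * ε ^ θ) :=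
  (hf.increment_le z).trans (ENNReal.ofReal_le_ofReal (mul_le_mul_of_nonneg_left
    (Real.rpow_le_rpow (torusAbs_nonneg z) hz hθ) hM))

lemma eLpNorm_convolution_sub_integral_mul_le (hf : IsBesov θ M f) (hθ : 0 ≤ θ) (hM : 0 ≤ M)
    (hg : Continuous g) (hε : ∀ z, ε < torusAbs z → g z = 0) :
    eLpNorm (fun x => (g ⋆ f) x - (∫ z, g z) * f x) 3 volume ≤
      ENNReal.ofReal ((∫ z, |g z|) * (M * ε ^ θ)) := by
  rw [← ENNReal.ofReal_ofNat 3, ENNReal.ofReal_mul (integral_nonneg fun _ => abs_nonneg _)]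
  refine eLpNorm_convolution_sub_le (by norm_num) hg hf.integrable fun z hz => ?_
  rw [ENNReal.ofReal_ofNat]
  exact hf.increment_le_of_le hθ hM (not_lt.1 fun h => hz (hε z h))

lemma eLpNorm_mollifier_convolution_sub_le (hf : IsBesov θ M f) (hθ : 0 ≤ θ) (hM : 0 ≤ M)
    (h0 : 0 < ε) (h1 : ε ≤ 1) :
    eLpNorm (fun x => (mollifier ε ⋆ f) x - f x) 3 volume ≤ ENNReal.ofReal (M * ε ^ θ) := by
  have hk := isMollifier_mollifier h0 h1
  simpa only [hk.integral_eq_one, hk.integral_abs, one_mul] using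
    hf.eLpNorm_convolution_sub_integral_mul_le hθ hM hk.smooth.continuous hk.eq_zero

lemma eLpNorm_pd_mollifier_convolution_le (hf : IsBesov θ M f) (hθ : 0 ≤ θ) (hM : 0 ≤ M)
    (h0 : 0 < ε) (h1 : ε ≤ 1) (i : Fin 3) :
    eLpNorm (pd i (mollifier ε ⋆ f)) 3 volume ≤
      ENNReal.ofReal (mollifierConst / ε * (M * ε ^ θ)) := by
  have hk := isMollifier_mollifier h0 h1
  have h := hf.eLpNorm_convolution_sub_integral_mul_le hθ hM (hk.smooth.pd i).continuous
    (hk.pd_eq_zero i)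
  simp only [integral_pd hk.smooth, zero_mul, sub_zero] at h
  rw [pd_convolution hk.smooth hf.integrable]
  refine h.trans (ENNReal.ofReal_le_ofReal ?_)
  gcongr
  exact integral_abs_pd_mollifier_le h0 h1 i

lemma eLpNorm_pd_pd_mollifier_convolution_le (hf : IsBesov θ M f) (hθ : 0 ≤ θ) (hM : 0 ≤ M)
    (h0 : 0 < ε) (h1 : ε ≤ 1) (i j : Fin 3) :
    eLpNorm (pd j (pd i (mollifier ε ⋆ f))) 3 volume ≤
      ENNReal.ofReal (mollifierConst / ε ^ 2 * (M * ε ^ θ)) := by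
  have hk := isMollifier_mollifier h0 h1
  have h := hf.eLpNorm_convolution_sub_integral_mul_le hθ hM
    ((hk.smooth.pd i).pd j).continuous fun _ => pd_eq_zero_of_lt_torusAbs (hk.pd_eq_zero i) j
  simp only [integral_pd (hk.smooth.pd i), zero_mul, sub_zero] at h
  rw [pd_convolution hk.smooth hf.integrable, pd_convolution (hk.smooth.pd i) hf.integrable]
  refine h.trans (ENNReal.ofReal_le_ofReal ?_)
  gcongr
  exact integral_abs_pd_pd_mollifier_le h0 h1 i j

end IsBesov

/-- The mollifications of `f` converge to `f` in `L²` at the rate `a ε^α`, and their gradients grow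
at most like `a ε^(α-1)`. This holds for `f ∈ B^α_{3,∞}` and, with `α = 1/2`, for
`f ∈ H^{1/2}`. -/
structure HasMollificationRate (a α : ℝ) (f : T3 → ℝ) : Prop where
  integrable : Integrable f
  sub_le : ∀ ε, 0 < ε → ε ≤ 1 →
    eLpNorm (fun x => (mollifier ε ⋆ f) x - f x) 2 volume ≤ ENNReal.ofReal (a * ε ^ α)
  pd_le : ∀ ε, 0 < ε → ε ≤ 1 → ∀ i,
    eLpNorm (pd i (mollifier ε ⋆ f)) 2 volume ≤ ENNReal.ofReal (a * ε ^ (α - 1))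

lemma IsBesov.hasMollificationRate {θ M : ℝ} {f : T3 → ℝ} (hf : IsBesov θ M f) (hθ : 0 ≤ θ)
    (hM : 0 ≤ M) : HasMollificationRate ((1 + mollifierConst) * M) θ f := by
  have hC := mollifierConst_nonneg
  have hsmooth : ∀ ε, 0 < ε → ε ≤ 1 → IsSmooth (mollifier ε ⋆ f) := fun ε h0 h1 =>
    (isMollifier_mollifier h0 h1).smooth.convolution hf.integrable
  refine ⟨hf.integrable, fun ε h0 h1 => ?_, fun ε h0 h1 i => ?_⟩
  · refine ((eLpNorm_le_eLpNorm_of_exponent_le (by norm_num)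
      ((hsmooth ε h0 h1).continuous.aestronglyMeasurable.sub hf.aesm)).trans
      (hf.eLpNorm_mollifier_convolution_sub_le hθ hM h0 h1)).trans (ENNReal.ofReal_le_ofReal ?_)
    gcongr
    nlinarith
  · refine ((eLpNorm_le_eLpNorm_of_exponent_le (by norm_num)
      ((hsmooth ε h0 h1).pd i).continuous.aestronglyMeasurable).trans
      (hf.eLpNorm_pd_mollifier_convolution_le hθ hM h0 h1 i)).trans (ENNReal.ofReal_le_ofReal ?_)
    rw [Real.rpow_sub h0, Real.rpow_one]
    calc mollifierConst / ε * (M * ε ^ θ) = mollifierConst * M * (ε ^ θ / ε) := by ring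
      _ ≤ (1 + mollifierConst) * M * (ε ^ θ / ε) := by gcongr; linarith

lemma eLpNorm_convolution_sub_le_of_gagliardo {f g : T3 → ℝ} {ε A : ℝ} (hf : Integrable f)
    (hG : gagliardo f ≠ ⊤) (hA : 0 ≤ A) (hg : Continuous g) (hε : ∀ z, ε < torusAbs z → g z = 0)
    (hle : (∫ z, g z ^ 2) * ε ^ 4 * (gagliardo f).toReal ≤ A ^ 2) :
    eLpNorm (fun x => (g ⋆ f) x - (∫ z, g z) * f x) 2 volume ≤ ENNReal.ofReal A := by
  refine (ENNReal.pow_right_strictMono two_ne_zero).le_iff_le.1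
    ((eLpNorm_convolution_sub_sq_le hg hε hf).trans ?_)
  rw [← ENNReal.ofReal_toReal hG, ← ENNReal.ofReal_mul
    (mul_nonneg (integral_nonneg fun _ => sq_nonneg _) (by positivity)), ← ENNReal.ofReal_pow hA]
  exact ENNReal.ofReal_le_ofReal hle

lemma hasMollificationRate_of_gagliardo {f : T3 → ℝ} (hf : Integrable f) (hG : gagliardo f ≠ ⊤) :
    HasMollificationRate √(mollifierConst * (gagliardo f).toReal) (1 / 2) f := by
  have hC := mollifierConst_nonneg
  set G := (gagliardo f).toReal
  have hCG : 0 ≤ mollifierConst * G := mul_nonneg hC ENNReal.toReal_nonneg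
  have hsq : ∀ (ε β : ℝ), 0 < ε → (√(mollifierConst * G) * ε ^ β) ^ 2 =
      mollifierConst * G * ε ^ (2 * β) := fun ε β h0 => by
    rw [mul_pow, Real.sq_sqrt hCG, ← Real.rpow_natCast (ε ^ β), ← Real.rpow_mul h0.le,
      Nat.cast_ofNat, mul_comm β]
  refine ⟨hf, fun ε h0 h1 => ?_, fun ε h0 h1 i => ?_⟩
  all_goals have hk := isMollifier_mollifier h0 h1
  · have hle : (∫ z, mollifier ε z ^ 2) * ε ^ 4 * G ≤
        (√(mollifierConst * G) * ε ^ (1 / 2 : ℝ)) ^ 2 := by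
      calc _ ≤ mollifierConst / ε ^ 3 * ε ^ 4 * G := by
            gcongr
            exact integral_sq_mollifier_le h0 h1
        _ = _ := by
            rw [hsq _ _ h0]
            norm_num
            field_simp
    simpa only [hk.integral_eq_one, one_mul] using eLpNorm_convolution_sub_le_of_gagliardo hf hG
      (by positivity) hk.smooth.continuous hk.eq_zero hle
  · have hle : (∫ z, pd i (mollifier ε) z ^ 2) * ε ^ 4 * G ≤
        (√(mollifierConst * G) * ε ^ (1 / 2 - 1 : ℝ)) ^ 2 := by
      calc _ ≤ mollifierConst / ε ^ 5 * ε ^ 4 * G := by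
            gcongr
            exact integral_sq_pd_mollifier_le h0 h1 i
        _ = _ := by
            rw [hsq _ _ h0]
            norm_num
            rw [Real.rpow_neg_one]
            field_simp
    simpa only [integral_pd hk.smooth, zero_mul, sub_zero, ← pd_convolution hk.smooth hf i] using
      eLpNorm_convolution_sub_le_of_gagliardo hf hG (by positivity) (hk.smooth.pd i).continuous
        (hk.pd_eq_zero i) hle

/-! ### Telescoping in the mollification scale -/

lemma eLpNorm_mul_le_ofReal {X : Type*} {mX : MeasurableSpace X} {μ : Measure X} {p q r : ℝ≥0∞}
    [p.HolderTriple q r] {f g : X → ℝ} {A B : ℝ} (hA : 0 ≤ A) (hfm : AEStronglyMeasurable f μ)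
    (hgm : AEStronglyMeasurable g μ) (hf : eLpNorm f p μ ≤ ENNReal.ofReal A)
    (hg : eLpNorm g q μ ≤ ENNReal.ofReal B) :
    eLpNorm (fun x => f x * g x) r μ ≤ ENNReal.ofReal (A * B) := by
  rw [ENNReal.ofReal_mul hA]
  exact (eLpNorm_smul_le_mul_eLpNorm (p := p) (q := q) hgm hfm).trans (mul_le_mul' hf hg)

lemma abs_integral_mul_le {X : Type*} {mX : MeasurableSpace X} {μ : Measure X} {f g : X → ℝ}
    {p q : ℝ≥0∞} [p.HolderTriple q 1] {A B : ℝ} (hA : 0 ≤ A) (hB : 0 ≤ B)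
    (hfm : AEStronglyMeasurable f μ) (hgm : AEStronglyMeasurable g μ)
    (hf : eLpNorm f p μ ≤ ENNReal.ofReal A) (hg : eLpNorm g q μ ≤ ENNReal.ofReal B) :
    |∫ x, f x * g x ∂μ| ≤ A * B := by
  have holder : eLpNorm (fun x => f x * g x) 1 μ ≤ ENNReal.ofReal (A * B) :=
    eLpNorm_mul_le_ofReal (p := p) (q := q) hA hfm hgm hf hg
  rw [eLpNorm_one_eq_lintegral_enorm] at holder
  have h := (enorm_integral_le_lintegral_enorm fun x => f x * g x).trans holder
  rw [Real.enorm_eq_ofReal_abs] at h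
  exact (ENNReal.ofReal_le_ofReal_iff (mul_nonneg hA hB)).1 h

lemma distPartial_sub_distPartial {f f' g g' : T3 → ℝ} (hf : IsSmooth f) (hf' : IsSmooth f')
    (hg : IsSmooth g) (hg' : IsSmooth g') (i : Fin 3) :
    distPartial i f' g' - distPartial i f g =
      (∫ x, (g' x - g x) * pd i f x) - ∫ x, (f' x - f x) * pd i g' x := by
  have hparts : ∫ x, (g' x - g x) * pd i f x = -∫ x, f x * (pd i g' x - pd i g x) := by
    have h := integral_mul_pd hf (hg'.sub hg) i
    simp_rw [pd_sub hg' hg] at h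
    rw [h, neg_neg]
    exact integral_congr_ae (.of_forall fun x => mul_comm _ _)
  have hint : ∀ {a b : T3 → ℝ}, IsSmooth a → IsSmooth b → Integrable fun x => a x * pd i b x :=
    fun ha hb => integrable_of_continuous (ha.mul (hb.pd i)).continuous
  rw [hparts, distPartial, distPartial]
  simp_rw [sub_mul, mul_sub]
  rw [integral_sub (hint hf' hg') (hint hf hg'), integral_sub (hint hf hg') (hint hf hg)]
  ring

namespace HasMollificationRate

variable {a b α β ε : ℝ} {f g : T3 → ℝ}

lemma isSmooth (hf : HasMollificationRate a α f) (h0 : 0 < ε) (h1 : ε ≤ 1) :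
    IsSmooth (mollifier ε ⋆ f) :=
  (isMollifier_mollifier h0 h1).smooth.convolution hf.integrable

lemma mono (h : HasMollificationRate a α f) (hab : a ≤ b) : HasMollificationRate b α f :=
  ⟨h.integrable, fun ε h0 h1 => (h.sub_le ε h0 h1).trans (ENNReal.ofReal_le_ofReal (by gcongr)),
    fun ε h0 h1 i => (h.pd_le ε h0 h1 i).trans (ENNReal.ofReal_le_ofReal (by gcongr))⟩

lemma half_sub_le (hf : HasMollificationRate a α f) (ha : 0 ≤ a) (hα : 0 ≤ α) (h0 : 0 < ε)
    (h1 : ε ≤ 1) :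
    eLpNorm (fun x => (mollifier (ε / 2) ⋆ f) x - (mollifier ε ⋆ f) x) 2 volume ≤
      ENNReal.ofReal (2 * a * ε ^ α) := by
  have h0' : 0 < ε / 2 := by positivity
  have h1' : ε / 2 ≤ 1 := by linarith
  have hm : ∀ {δ}, 0 < δ → δ ≤ 1 → AEStronglyMeasurable fun x => (mollifier δ ⋆ f) x - f x :=
    fun d0 d1 => (hf.isSmooth d0 d1).continuous.aestronglyMeasurable.sub
      hf.integrable.aestronglyMeasurable
  have hsplit : (fun x => (mollifier (ε / 2) ⋆ f) x - (mollifier ε ⋆ f) x) =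
      (fun x => (mollifier (ε / 2) ⋆ f) x - f x) - fun x => (mollifier ε ⋆ f) x - f x := by
    ext x
    simp
  rw [hsplit]
  refine (eLpNorm_sub_le (hm h0' h1') (hm h0 h1) (by norm_num)).trans
    ((add_le_add (hf.sub_le _ h0' h1') (hf.sub_le _ h0 h1)).trans ?_)
  rw [← ENNReal.ofReal_add (by positivity) (by positivity)]
  refine ENNReal.ofReal_le_ofReal ?_
  have hpow : (ε / 2) ^ α ≤ ε ^ α := Real.rpow_le_rpow h0'.le (by linarith) hα
  nlinarith

lemma abs_distPartial_half_sub_le (hf : HasMollificationRate a α f)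
    (hg : HasMollificationRate b β g) (ha : 0 ≤ a) (hb : 0 ≤ b) (hα : 0 ≤ α) (hβ : 0 ≤ β)
    (i : Fin 3) (h0 : 0 < ε) (h1 : ε ≤ 1) :
    |distPartial i (mollifier (ε / 2) ⋆ f) (mollifier (ε / 2) ⋆ g)
      - distPartial i (mollifier ε ⋆ f) (mollifier ε ⋆ g)| ≤ 6 * a * b * ε ^ (α + β - 1) := by
  have h0' : 0 < ε / 2 := by positivity
  have h1' : ε / 2 ≤ 1 := by linarith
  have hfε := hf.isSmooth h0 h1
  have hfε' := hf.isSmooth h0' h1'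
  have hgε := hg.isSmooth h0 h1
  have hgε' := hg.isSmooth h0' h1'
  rw [distPartial_sub_distPartial hfε hfε' hgε hgε']
  have hleft := abs_integral_mul_le (by positivity) (by positivity)
    (hgε'.sub hgε).continuous.aestronglyMeasurable (hfε.pd i).continuous.aestronglyMeasurable
    (hg.half_sub_le hb hβ h0 h1) (hf.pd_le _ h0 h1 i)
  have hright := abs_integral_mul_le (by positivity) (by positivity)
    (hfε'.sub hfε).continuous.aestronglyMeasurable (hgε'.pd i).continuous.aestronglyMeasurable
    (hf.half_sub_le ha hα h0 h1) (hg.pd_le _ h0' h1' i)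
  refine (abs_sub _ _).trans ((add_le_add hleft hright).trans ?_)
  have hhalf : (ε / 2) ^ (β - 1) ≤ 2 * ε ^ (β - 1) := by
    have htwo : (2 : ℝ)⁻¹ ≤ 2 ^ (β - 1) := by
      rw [← Real.rpow_neg_one]
      exact Real.rpow_le_rpow_of_exponent_le (by norm_num) (by linarith)
    rw [Real.div_rpow h0.le (by norm_num), div_le_iff₀ (by positivity)]
    nlinarith [show 0 ≤ ε ^ (β - 1) by positivity]
  have hpow₁ : ε ^ α * ε ^ (β - 1) = ε ^ (α + β - 1) := by
    rw [← Real.rpow_add h0, add_sub_assoc]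
  have hpow₂ : ε ^ β * ε ^ (α - 1) = ε ^ (α + β - 1) := by
    rw [← Real.rpow_add h0, ← add_sub_assoc, add_comm]
  calc 2 * b * ε ^ β * (a * ε ^ (α - 1)) + 2 * a * ε ^ α * (b * (ε / 2) ^ (β - 1))
      ≤ 2 * b * ε ^ β * (a * ε ^ (α - 1)) + 2 * a * ε ^ α * (b * (2 * ε ^ (β - 1))) := by gcongr
    _ = 2 * a * b * (ε ^ β * ε ^ (α - 1)) + 4 * a * b * (ε ^ α * ε ^ (β - 1)) := by ring
    _ = 6 * a * b * ε ^ (α + β - 1) := by rw [hpow₁, hpow₂]; ring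

end HasMollificationRate

/-- The factor `6 ∑ₙ 2^{-γn}` that controls the telescoping sums over dyadic scales. -/
def geomConst (γ : ℝ) : ℝ := 6 / (1 - (1 / 2 : ℝ) ^ γ)

namespace HasMollificationRate

variable {a b α β ε : ℝ} {f g : T3 → ℝ}

lemma exists_tendsto_distPartial (hf : HasMollificationRate a α f)
    (hg : HasMollificationRate b β g) (ha : 0 ≤ a) (hb : 0 ≤ b) (hα : 0 ≤ α) (hβ : 0 ≤ β)
    (hαβ : 1 < α + β) (i : Fin 3) (h0 : 0 < ε) (h1 : ε ≤ 1) :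
    ∃ L, Tendsto (fun n : ℕ =>
        distPartial i (mollifier (ε / 2 ^ n) ⋆ f) (mollifier (ε / 2 ^ n) ⋆ g)) atTop (𝓝 L) ∧
      |L - distPartial i (mollifier ε ⋆ f) (mollifier ε ⋆ g)| ≤
        geomConst (α + β - 1) * (a * b * ε ^ (α + β - 1)) := by
  set γ := α + β - 1 with hγ
  set r := (1 / 2 : ℝ) ^ γ with hr
  have hr1 : r < 1 := Real.rpow_lt_one (by norm_num) (by norm_num) (by rw [hγ]; linarith)
  set F : ℕ → ℝ := fun n =>
    distPartial i (mollifier (ε / 2 ^ n) ⋆ f) (mollifier (ε / 2 ^ n) ⋆ g) with hF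
  have hdist : ∀ n, dist (F n) (F (n + 1)) ≤ 6 * a * b * ε ^ γ * r ^ n := fun n => by
    have h := hf.abs_distPartial_half_sub_le hg ha hb hα hβ i (ε := ε / 2 ^ n) (by positivity)
      ((div_le_self h0.le (one_le_pow₀ (by norm_num))).trans h1)
    rw [div_div, ← pow_succ] at h
    rw [dist_comm, Real.dist_eq]
    refine h.trans_eq ?_
    rw [← hγ, Real.div_rpow h0.le (by positivity), hr, ← Real.rpow_natCast, ← Real.rpow_mul
      (by norm_num), ← Real.rpow_natCast, ← Real.rpow_mul (by norm_num), one_div,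
      Real.inv_rpow (by norm_num), mul_comm γ]
    ring
  obtain ⟨L, hL⟩ := cauchySeq_tendsto_of_complete (cauchySeq_of_le_geometric r _ hr1 hdist)
  refine ⟨L, hL, ?_⟩
  have h := dist_le_of_le_geometric_of_tendsto₀ r _ hr1 hdist hL
  rw [dist_comm, Real.dist_eq] at h
  simp only [hF, pow_zero, div_one] at h
  refine h.trans_eq ?_
  rw [geomConst]
  ring

end HasMollificationRate

lemma eLpNorm_mollifier_convolution_le {ε q : ℝ} {f : T3 → ℝ} (hq : 1 ≤ q) (h0 : 0 < ε)
    (h1 : ε ≤ 1) (hf : Integrable f) :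
    eLpNorm (mollifier ε ⋆ f) (ENNReal.ofReal q) volume ≤ eLpNorm f (ENNReal.ofReal q) volume := by
  have hk := isMollifier_mollifier h0 h1
  simpa only [hk.integral_abs, ENNReal.ofReal_one, one_mul] using
    eLpNorm_convolution_le hq hk.smooth.continuous hf

lemma HasMollificationRate.abs_distPartial_sub_le {a α ε B : ℝ} {f g : T3 → ℝ}
    (hf : HasMollificationRate a α f) (ha : 0 ≤ a) (hg : IsSmooth g) (i : Fin 3) (hB : 0 ≤ B)
    (hgB : eLpNorm (pd i g) 2 volume ≤ ENNReal.ofReal B) (h0 : 0 < ε) (h1 : ε ≤ 1) :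
    |distPartial i (mollifier ε ⋆ f) (mollifier ε ⋆ g) - distPartial i f g| ≤
      2 * (a * ε ^ α * B) := by
  have hk := isMollifier_mollifier h0 h1
  have hgi := integrable_of_continuous (μ := volume) (hg.pd i).continuous
  have hgε := hk.smooth.convolution hgi
  have hfε := hf.isSmooth h0 h1
  have hm : AEStronglyMeasurable fun x => (mollifier ε ⋆ f) x - f x :=
    hfε.continuous.aestronglyMeasurable.sub hf.integrable.aestronglyMeasurable
  have hgεB : eLpNorm (mollifier ε ⋆ pd i g) 2 volume ≤ ENNReal.ofReal B := by
    simpa only [ENNReal.ofReal_ofNat] using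
      (eLpNorm_mollifier_convolution_le (q := 2) (by norm_num) h0 h1 hgi).trans (by simpa using hgB)
  have hmul : ∀ {ψ : T3 → ℝ}, IsSmooth ψ → Integrable fun x => f x * ψ x := fun hψ => by
    simpa only [mul_comm] using integrable_continuous_mul hψ.continuous hf.integrable
  have hsplit : distPartial i (mollifier ε ⋆ f) (mollifier ε ⋆ g) - distPartial i f g =
      -((∫ x, ((mollifier ε ⋆ f) x - f x) * (mollifier ε ⋆ pd i g) x)
        + ∫ x, ((mollifier ε ⋆ f) x - f x) * pd i g x) := by
    have heven := integral_convolution_mul hk.smooth.continuous hk.even hf.integrable hgi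
    simp_rw [distPartial, pd_convolution_eq_convolution_pd hk.smooth hg, sub_mul]
    rw [integral_sub (integrable_of_continuous (hfε.mul hgε).continuous) (hmul hgε),
      integral_sub (integrable_of_continuous (hfε.mul (hg.pd i)).continuous) (hmul (hg.pd i)),
      heven]
    ring
  have hleft := abs_integral_mul_le (by positivity) hB hm hgε.continuous.aestronglyMeasurable
    (hf.sub_le ε h0 h1) hgεB
  have hright := abs_integral_mul_le (by positivity) hB hm
    (hg.pd i).continuous.aestronglyMeasurable (hf.sub_le ε h0 h1) hgB
  rw [hsplit, abs_neg]
  linarith [abs_add_le (∫ x, ((mollifier ε ⋆ f) x - f x) * (mollifier ε ⋆ pd i g) x)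
    (∫ x, ((mollifier ε ⋆ f) x - f x) * pd i g x)]

lemma tendsto_div_two_pow (ε : ℝ) : Tendsto (fun n : ℕ => ε / 2 ^ n) atTop (𝓝 0) :=
  tendsto_const_nhds.div_atTop (tendsto_pow_atTop_atTop_of_one_lt (by norm_num))

lemma HasMollificationRate.tendsto_distPartial {a α ε : ℝ} {f g : T3 → ℝ}
    (hf : HasMollificationRate a α f) (ha : 0 ≤ a) (hα : 0 < α) (hg : IsSmooth g) (i : Fin 3)
    (h0 : 0 < ε) (h1 : ε ≤ 1) :
    Tendsto (fun n : ℕ => distPartial i (mollifier (ε / 2 ^ n) ⋆ f) (mollifier (ε / 2 ^ n) ⋆ g))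
      atTop (𝓝 (distPartial i f g)) := by
  have hgm := (hg.pd i).continuous.memLp_of_hasCompactSupport (μ := volume) (p := 2)
    (HasCompactSupport.of_compactSpace _)
  have hgB := (ENNReal.ofReal_toReal hgm.2.ne).ge
  refine tendsto_iff_dist_tendsto_zero.2 (squeeze_zero (fun _ => dist_nonneg) (fun n =>
    hf.abs_distPartial_sub_le ha hg i ENNReal.toReal_nonneg hgB (ε := ε / 2 ^ n) (by positivity)
      ((div_le_self h0.le (one_le_pow₀ (by norm_num))).trans h1)) ?_)
  have hlim := ((((tendsto_div_two_pow ε).rpow_const (Or.inr hα.le)).const_mul a).mul_const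
    (eLpNorm (pd i g) 2 volume).toReal).const_mul 2
  simpa [Real.zero_rpow hα.ne'] using hlim

/-! ### The helicity pairing -/

/-- The components of a vector field. -/
abbrev components (v : T3 → E3) (i : Fin 3) : T3 → ℝ := fun x => v x i

/-- The pairing `∫ a · curl b`, for fields given by their components. -/
def curlPairing (a b : Fin 3 → T3 → ℝ) : ℝ :=
  (distPartial 1 (a 2) (b 0) - distPartial 2 (a 1) (b 0))
    + (distPartial 2 (a 0) (b 1) - distPartial 0 (a 2) (b 1))
    + (distPartial 0 (a 1) (b 2) - distPartial 1 (a 0) (b 2))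

/-- Componentwise mollification at scale `ε`. -/
def mollify (ε : ℝ) (a : Fin 3 → T3 → ℝ) (i : Fin 3) : T3 → ℝ := mollifier ε ⋆ a i

lemma isSmooth_mollify {ε : ℝ} {a : Fin 3 → T3 → ℝ} {i : Fin 3} (h0 : 0 < ε) (h1 : ε ≤ 1)
    (ha : Integrable (a i)) : IsSmooth (mollify ε a i) :=
  (isMollifier_mollifier h0 h1).smooth.convolution ha

lemma abs_curl_combination_le {d : Fin 3 → Fin 3 → Fin 3 → ℝ} {A : ℝ} (h : ∀ i l j, |d i l j| ≤ A) :
    |(d 1 2 0 - d 2 1 0) + (d 2 0 1 - d 0 2 1) + (d 0 1 2 - d 1 0 2)| ≤ 6 * A := by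
  have h₁ := abs_le.1 (h 1 2 0)
  have h₂ := abs_le.1 (h 2 1 0)
  have h₃ := abs_le.1 (h 2 0 1)
  have h₄ := abs_le.1 (h 0 2 1)
  have h₅ := abs_le.1 (h 0 1 2)
  have h₆ := abs_le.1 (h 1 0 2)
  rw [abs_le]
  constructor <;> linarith

lemma tendsto_curlPairing {ι : Type*} {l : Filter ι} {a b : ι → Fin 3 → T3 → ℝ}
    {d : Fin 3 → Fin 3 → Fin 3 → ℝ}
    (h : ∀ i m j, Tendsto (fun n => distPartial i (a n m) (b n j)) l (𝓝 (d i m j))) :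
    Tendsto (fun n => curlPairing (a n) (b n)) l
      (𝓝 ((d 1 2 0 - d 2 1 0) + (d 2 0 1 - d 0 2 1) + (d 0 1 2 - d 1 0 2))) :=
  (((h 1 2 0).sub (h 2 1 0)).add ((h 2 0 1).sub (h 0 2 1))).add ((h 0 1 2).sub (h 1 0 2))

lemma exists_tendsto_curlPairing_mollify {a b : Fin 3 → T3 → ℝ} {A B α β : ℝ}
    (ha : ∀ i, HasMollificationRate A α (a i)) (hb : ∀ i, HasMollificationRate B β (b i))
    (hA : 0 ≤ A) (hB : 0 ≤ B) (hα : 0 ≤ α) (hβ : 0 ≤ β) (hαβ : 1 < α + β) {ε : ℝ} (h0 : 0 < ε)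
    (h1 : ε ≤ 1) :
    ∃ L, Tendsto (fun n : ℕ => curlPairing (mollify (ε / 2 ^ n) a) (mollify (ε / 2 ^ n) b)) atTop
        (𝓝 L) ∧
      |L - curlPairing (mollify ε a) (mollify ε b)| ≤
        6 * (geomConst (α + β - 1) * (A * B * ε ^ (α + β - 1))) := by
  choose d hd hdle using fun i m j =>
    (ha m).exists_tendsto_distPartial (hb j) hA hB hα hβ hαβ i h0 h1
  refine ⟨_, tendsto_curlPairing hd, ?_⟩
  convert abs_curl_combination_le hdle using 2
  simp only [curlPairing, mollify]
  ring

lemma abs_curlPairing_le {a b : Fin 3 → T3 → ℝ} {A : ℝ}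
    (h : ∀ l j i, |∫ x, a l x * pd i (b j) x| ≤ A) : |curlPairing a b| ≤ 6 * A :=
  abs_curl_combination_le (d := fun i l j => distPartial i (a l) (b j)) fun i l j => by
    rw [distPartial, abs_neg]
    exact h l j i

lemma curlPairing_sub_right {a b c : Fin 3 → T3 → ℝ} (ha : ∀ i, IsSmooth (a i))
    (hb : ∀ i, IsSmooth (b i)) (hc : ∀ i, IsSmooth (c i)) :
    curlPairing a (fun i x => b i x - c i x) = curlPairing a b - curlPairing a c := by
  have distPartial_sub : ∀ l j i, distPartial i (a l) (fun x => b j x - c j x) =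
      distPartial i (a l) (b j) - distPartial i (a l) (c j) := fun l j i => by
    simp_rw [distPartial, pd_sub (hb j) (hc j), mul_sub]
    rw [integral_sub (integrable_of_continuous ((ha l).mul ((hb j).pd i)).continuous)
      (integrable_of_continuous ((ha l).mul ((hc j).pd i)).continuous)]
    ring
  simp only [curlPairing, distPartial_sub]
  ring

lemma abs_curlPairing_mollify_le {a b : Fin 3 → T3 → ℝ} {M B β ε : ℝ} (hM : 0 ≤ M) (hB : 0 ≤ B)
    (ha : ∀ i, Integrable (a i)) (haM : ∀ i, eLpNorm (a i) 2 volume ≤ ENNReal.ofReal M)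
    (hb : ∀ i, HasMollificationRate B β (b i)) (h0 : 0 < ε) (h1 : ε ≤ 1) :
    |curlPairing (mollify ε a) (mollify ε b)| ≤ 6 * (M * (B * ε ^ (β - 1))) := by
  refine abs_curlPairing_le fun l j i => abs_integral_mul_le (p := 2) hM (by positivity)
    (isSmooth_mollify h0 h1 (ha l)).continuous.aestronglyMeasurable
    (((hb j).isSmooth h0 h1).pd i).continuous.aestronglyMeasurable ?_ ((hb j).pd_le ε h0 h1 i)
  have h := eLpNorm_mollifier_convolution_le one_le_two h0 h1 (ha l)
  rw [ENNReal.ofReal_ofNat] at h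
  exact h.trans (haM l)

/-! ### Helicity as a duality pairing -/

lemma IsSmooth.apply {φ : T3 → E3} (hφ : IsSmooth φ) (i : Fin 3) : IsSmooth fun x => φ x i :=
  contDiff_euclidean.1 hφ i

lemma isSmooth_toLp {a : Fin 3 → T3 → ℝ} (ha : ∀ i, IsSmooth (a i)) :
    IsSmooth (fun x => (WithLp.toLp 2 fun i => a i x : E3)) :=
  contDiff_euclidean.2 ha

lemma gagliardo_apply_le (w : T3 → E3) (i : Fin 3) :
    gagliardo (components w i) ≤ gagliardo w := by
  refine lintegral_mono fun x => lintegral_mono fun y => ?_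
  gcongr
  exact enorm_le_iff_norm_le.2 (by simpa using PiLp.norm_apply_le (w x - w y) i)

lemma hasMollificationRate_of_sobolevHalfNorm {w : T3 → E3} (hw : sobolevHalfNorm w ≠ ⊤)
    {i : Fin 3} (hwi : Integrable (components w i)) :
    HasMollificationRate (√mollifierConst * (sobolevHalfNorm w).toReal) (1 / 2)
      (components w i) := by
  have hle : gagliardo w ^ (1 / 2 : ℝ) ≤ sobolevHalfNorm w := by
    rw [sobolevHalfNorm_eq]
    exact le_add_self
  have hfin : gagliardo w ≠ ⊤ := fun h => hw <| by
    rwa [h, ENNReal.top_rpow_of_pos (by norm_num), top_le_iff] at hle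
  have happ := gagliardo_apply_le w i
  refine (hasMollificationRate_of_gagliardo hwi (ne_top_of_le_ne_top hfin happ)).mono ?_
  rw [Real.sqrt_mul mollifierConst_nonneg]
  gcongr
  calc √(gagliardo (components w i)).toReal ≤ √(gagliardo w).toReal :=
        Real.sqrt_le_sqrt (ENNReal.toReal_mono hfin happ)
    _ = (gagliardo w ^ (1 / 2 : ℝ)).toReal := by rw [Real.sqrt_eq_rpow, ENNReal.toReal_rpow]
    _ ≤ (sobolevHalfNorm w).toReal := ENNReal.toReal_mono hw hle

section DistCurl

variable {v : T3 → E3} {A α ε : ℝ}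

lemma tendsto_curlPairing_mollify_smooth (hv : ∀ i, HasMollificationRate A α (components v i))
    (hA : 0 ≤ A) (hα : 0 < α) (φ : SmoothField) (h0 : 0 < ε) (h1 : ε ≤ 1) :
    Tendsto (fun n : ℕ => curlPairing (mollify (ε / 2 ^ n) (components v))
      (mollify (ε / 2 ^ n) (components φ.1))) atTop (𝓝 (distCurl v φ)) :=
  tendsto_curlPairing (d := fun i l j => distPartial i (components v l) (components φ.1 j))
    fun i l j => (hv l).tendsto_distPartial hA hα (φ.2.apply j) i h0 h1

lemma tendsto_curlPairing_mollify_sub (hv : ∀ i, HasMollificationRate A α (components v i))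
    (hA : 0 ≤ A) (hα : 0 < α) (φ : SmoothField) (h0 : 0 < ε) (h1 : ε ≤ 1) {L : ℝ}
    (hL : Tendsto (fun n : ℕ => curlPairing (mollify (ε / 2 ^ n) (components v))
      (mollify (ε / 2 ^ n) (components v))) atTop (𝓝 L)) :
    Tendsto (fun n : ℕ => curlPairing (mollify (ε / 2 ^ n) (components v))
      (mollify (ε / 2 ^ n) (components (φ.1 - v)))) atTop (𝓝 (distCurl v φ - L)) := by
  refine ((tendsto_curlPairing_mollify_smooth hv hA hα φ h0 h1).sub hL).congr fun n => ?_
  have d0 : 0 < ε / 2 ^ n := by positivity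
  have d1 : ε / 2 ^ n ≤ 1 := (div_le_self h0.le (one_le_pow₀ (by norm_num))).trans h1
  have hφ : ∀ i, Integrable (components φ.1 i) := fun i =>
    integrable_of_continuous (φ.2.apply i).continuous
  have hvs := fun i => isSmooth_mollify d0 d1 (hv i).integrable
  rw [← curlPairing_sub_right hvs (fun i => isSmooth_mollify d0 d1 (hφ i)) hvs]
  congr 1
  ext i x
  exact (convolution_fun_sub (isMollifier_mollifier d0 d1).smooth.continuous (hφ i)
    (hv i).integrable x).symm

lemma exists_abs_distCurl_sub_le (hv : ∀ i, HasMollificationRate A α (components v i))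
    (hv2 : ∀ i, MemLp (components v i) 2) (hA : 0 ≤ A) (hα : 1 / 2 < α) (h0 : 0 < ε) (h1 : ε ≤ 1)
    {L : ℝ} (hL : Tendsto (fun n : ℕ => curlPairing (mollify (ε / 2 ^ n) (components v))
      (mollify (ε / 2 ^ n) (components v))) atTop (𝓝 L)) :
    ∃ K, ∀ φ : SmoothField, sobolevHalfNorm (φ.1 - v) ≠ ⊤ →
      |distCurl v φ - L| ≤ K * (sobolevHalfNorm (φ.1 - v)).toReal := by
  set M := ∑ i, (eLpNorm (components v i) 2 volume).toReal
  have hM : ∀ i, eLpNorm (components v i) 2 volume ≤ ENNReal.ofReal M := fun i =>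
    (ENNReal.le_ofReal_iff_toReal_le (hv2 i).2.ne (Finset.sum_nonneg fun _ _ =>
      ENNReal.toReal_nonneg)).2 (Finset.single_le_sum (f := fun j =>
        (eLpNorm (components v j) 2 volume).toReal) (fun _ _ => ENNReal.toReal_nonneg)
        (Finset.mem_univ i))
  have hM0 : 0 ≤ M := Finset.sum_nonneg fun _ _ => ENNReal.toReal_nonneg
  refine ⟨(6 * (M * ε ^ (1 / 2 - 1 : ℝ)) + 6 * (geomConst (α + 1 / 2 - 1) *
    (A * ε ^ (α + 1 / 2 - 1)))) * √mollifierConst, fun φ hφ => ?_⟩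
  set w : T3 → E3 := φ.1 - v
  set B := √mollifierConst * (sobolevHalfNorm w).toReal with hB
  have hB0 : 0 ≤ B := by positivity
  have hwr : ∀ i, HasMollificationRate B (1 / 2) (components w i) := fun i =>
    hasMollificationRate_of_sobolevHalfNorm hφ
      ((integrable_of_continuous (φ.2.apply i).continuous).sub (hv i).integrable)
  obtain ⟨D, hD, hDε⟩ := exists_tendsto_curlPairing_mollify hv hwr hA hB0 (by linarith)
    (by norm_num) (by linarith) h0 h1
  obtain rfl : D = distCurl v φ - L := tendsto_nhds_unique hD
    (tendsto_curlPairing_mollify_sub hv hA (by linarith) φ h0 h1 hL)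
  have hbase := abs_curlPairing_mollify_le hM0 hB0 (fun i => (hv i).integrable) hM hwr h0 h1
  calc |distCurl v φ - L| ≤ |distCurl v φ - L -
          curlPairing (mollify ε (components v)) (mollify ε (components w))| +
          |curlPairing (mollify ε (components v)) (mollify ε (components w))| :=
        sub_le_iff_le_add.1 (abs_sub_abs_le_abs_sub _ _)
    _ ≤ _ := add_le_add hDε hbase
    _ = _ := by rw [hB]; ring

end DistCurl

section MollificationError

variable {f : T3 → ℝ} {θ s M ε : ℝ}

lemma IsBesov.increment_convolution_sub_le (hf : IsBesov θ M f) (hM : 0 ≤ M) (h0 : 0 < ε)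
    (h1 : ε ≤ 1) (z : T3) :
    eLpNorm (fun x => ((mollifier ε ⋆ f) (x - z) - f (x - z)) - ((mollifier ε ⋆ f) x - f x)) 3
      volume ≤ ENNReal.ofReal (2 * (M * torusAbs z ^ θ)) := by
  have hk := isMollifier_mollifier h0 h1
  have hpow := Real.rpow_nonneg (torusAbs_nonneg z) θ
  have hi : Integrable fun x => f (x - z) - f x :=
    (hf.integrable.comp_sub_right z).sub hf.integrable
  have hcomm : (fun x => ((mollifier ε ⋆ f) (x - z) - f (x - z)) - ((mollifier ε ⋆ f) x - f x)) =
      (mollifier ε ⋆ fun x => f (x - z) - f x) - fun x => f (x - z) - f x := by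
    ext x
    have htrans : (mollifier ε ⋆ fun x => f (x - z)) x = (mollifier ε ⋆ f) (x - z) := by
      simp_rw [convolution_lsmul, sub_right_comm]
    rw [Pi.sub_apply, convolution_fun_sub hk.smooth.continuous (hf.integrable.comp_sub_right z)
      hf.integrable, htrans]
    ring
  have hconv := eLpNorm_mollifier_convolution_le (q := 3) (by norm_num) h0 h1 hi
  rw [ENNReal.ofReal_ofNat] at hconv
  rw [hcomm, two_mul, ENNReal.ofReal_add (by positivity) (by positivity)]
  exact (eLpNorm_sub_le (hk.smooth.convolution hi).continuous.aestronglyMeasurable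
    hi.aestronglyMeasurable (by norm_num)).trans
    (add_le_add (hconv.trans (hf.increment_le z)) (hf.increment_le z))

lemma IsBesov.aestronglyMeasurable_convolution_sub (hf : IsBesov θ M f) (h0 : 0 < ε) (h1 : ε ≤ 1) :
    AEStronglyMeasurable fun x => (mollifier ε ⋆ f) x - f x :=
  ((isMollifier_mollifier h0 h1).smooth.convolution
    hf.integrable).continuous.aestronglyMeasurable.sub hf.aesm

lemma IsBesov.increment_convolution_sub_le_of_scale (hf : IsBesov θ M f) (hθ : 0 ≤ θ) (hM : 0 ≤ M)
    (h0 : 0 < ε) (h1 : ε ≤ 1) (z : T3) :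
    eLpNorm (fun x => ((mollifier ε ⋆ f) (x - z) - f (x - z)) - ((mollifier ε ⋆ f) x - f x)) 3
      volume ≤ ENNReal.ofReal (2 * (M * ε ^ θ)) := by
  have hm := hf.aestronglyMeasurable_convolution_sub h0 h1
  have hle := hf.eLpNorm_mollifier_convolution_sub_le hθ hM h0 h1
  rw [two_mul, ENNReal.ofReal_add (by positivity) (by positivity)]
  exact (eLpNorm_sub_le (hm.comp_measurePreserving (measurePreserving_sub_right volume z)) hm
    (by norm_num)).trans (add_le_add ((eLpNorm_comp_sub_right hm 3 z).le.trans hle) hle)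

lemma min_rpow_le {r : ℝ} (hs : 0 < s) (hsθ : s ≤ θ) (h0 : 0 < ε) (hr : 0 ≤ r) :
    min (ε ^ θ) (r ^ θ) ≤ ε ^ (θ - s) * r ^ s := by
  have hsplit : ∀ {a : ℝ}, 0 < a → a ^ θ = a ^ (θ - s) * a ^ s := fun ha => by
    rw [← Real.rpow_add ha, sub_add_cancel]
  rcases hr.eq_or_lt with rfl | hr
  · simp [Real.zero_rpow hs.ne', Real.zero_rpow (hs.trans_le hsθ).ne']
  rcases le_total r ε with h | h
  · refine (min_le_right _ _).trans ?_
    rw [hsplit hr]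
    gcongr
  · refine (min_le_left _ _).trans ?_
    rw [hsplit h0]
    gcongr

lemma IsBesov.increment_convolution_sub_le_mul (hf : IsBesov θ M f) (hs : 0 < s) (hsθ : s ≤ θ)
    (hM : 0 ≤ M) (h0 : 0 < ε) (h1 : ε ≤ 1) (z : T3) :
    eLpNorm (fun x => ((mollifier ε ⋆ f) (x - z) - f (x - z)) - ((mollifier ε ⋆ f) x - f x)) 3
      volume ≤ ENNReal.ofReal (2 * (M * ε ^ (θ - s)) * torusAbs z ^ s) := by
  refine (le_min (hf.increment_convolution_sub_le_of_scale (hs.le.trans hsθ) hM h0 h1 z)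
    (hf.increment_convolution_sub_le hM h0 h1 z)).trans ?_
  rw [← ENNReal.ofReal_min, ← mul_min_of_nonneg _ _ zero_le_two, ← mul_min_of_nonneg _ _ hM,
    mul_assoc, mul_assoc M]
  gcongr
  exact min_rpow_le hs hsθ h0 (torusAbs_nonneg z)

end MollificationError

lemma eLpNorm_le_sum_apply {p : ℝ≥0∞} (hp : 1 ≤ p) {w : T3 → E3}
    (hw : ∀ i, AEStronglyMeasurable (components w i)) :
    eLpNorm w p volume ≤ ∑ i, eLpNorm (components w i) p volume := by
  have hle : eLpNorm w p volume ≤ eLpNorm (∑ i, fun x => ‖w x i‖) p volume := by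
    refine eLpNorm_mono_real fun x => ?_
    rw [Finset.sum_apply, EuclideanSpace.norm_eq]
    exact Real.sqrt_le_iff.2 ⟨Finset.sum_nonneg fun _ _ => norm_nonneg _,
      Finset.sum_sq_le_sq_sum_of_nonneg fun _ _ => norm_nonneg _⟩
  refine hle.trans ((eLpNorm_sum_le (fun i _ => (hw i).norm) hp).trans_eq ?_)
  simp_rw [eLpNorm_norm]

lemma eLpNorm_le_three_mul {p : ℝ≥0∞} (hp : 1 ≤ p) {w : T3 → E3} {A : ℝ}
    (hw : ∀ i, AEStronglyMeasurable (components w i))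
    (hA : ∀ i, eLpNorm (components w i) p volume ≤ ENNReal.ofReal A) :
    eLpNorm w p volume ≤ ENNReal.ofReal (3 * A) := by
  refine (eLpNorm_le_sum_apply hp hw).trans ((Finset.sum_le_card_nsmul _ _ _ fun i _ =>
    hA i).trans_eq ?_)
  rw [Finset.card_univ, Fintype.card_fin, nsmul_eq_mul, ENNReal.ofReal_mul (by norm_num)]
  norm_num

lemma aestronglyMeasurable_of_components {w : T3 → E3}
    (hw : ∀ i, AEStronglyMeasurable (components w i)) : AEStronglyMeasurable w :=
  ((MeasurableEquiv.toLp 2 (Fin 3 → ℝ)).measurable.comp_aemeasurable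
    (aemeasurable_pi_iff.2 fun i => (hw i).aemeasurable)).aestronglyMeasurable

lemma sobolevHalfNorm_le {w : T3 → E3} {s A B : ℝ} (hB : 0 ≤ B)
    (hw : ∀ i, AEStronglyMeasurable (components w i))
    (hA : ∀ i, eLpNorm (components w i) 2 volume ≤ ENNReal.ofReal A)
    (h : ∀ i z, eLpNorm (fun x => w (x - z) i - w x i) 2 volume ≤
      ENNReal.ofReal (B * torusAbs z ^ s)) :
    sobolevHalfNorm w ≤ ENNReal.ofReal (3 * A) +
      (ENNReal.ofReal (3 * B) ^ 2 * gagliardoConst s) ^ (1 / 2 : ℝ) := by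
  rw [sobolevHalfNorm_eq]
  gcongr
  · exact eLpNorm_le_three_mul one_le_two hw hA
  · refine gagliardo_le (aestronglyMeasurable_of_components hw) (by positivity) fun z => ?_
    rw [mul_assoc]
    exact eLpNorm_le_three_mul one_le_two
      (fun i => aestronglyMeasurable_translate_sub (hw i) z) fun i => h i z

lemma exists_smoothField_sobolevHalfNorm_sub_le {v : T3 → E3} {θ s M ε : ℝ}
    (hv : ∀ i, IsBesov θ M (components v i)) (hM : 0 ≤ M) (hs : 0 < s) (hsθ : s ≤ θ) (h0 : 0 < ε)
    (h1 : ε ≤ 1) :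
    ∃ φ : SmoothField, sobolevHalfNorm (φ.1 - v) ≤ ENNReal.ofReal (3 * (M * ε ^ θ)) +
      (ENNReal.ofReal (3 * (2 * (M * ε ^ (θ - s)))) ^ 2 * gagliardoConst s) ^ (1 / 2 : ℝ) := by
  refine ⟨⟨fun x => WithLp.toLp 2 fun i => mollify ε (components v) i x,
    isSmooth_toLp fun i => isSmooth_mollify h0 h1 (hv i).integrable⟩, ?_⟩
  have hm : ∀ i, AEStronglyMeasurable fun x => (mollifier ε ⋆ components v i) x - v x i :=
    fun i => (hv i).aestronglyMeasurable_convolution_sub h0 h1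
  refine sobolevHalfNorm_le (by positivity) hm (fun i => ?_) fun i z => ?_
  · exact (eLpNorm_le_eLpNorm_of_exponent_le (by norm_num) (hm i)).trans
      ((hv i).eLpNorm_mollifier_convolution_sub_le (hs.le.trans hsθ) hM h0 h1)
  · exact (eLpNorm_le_eLpNorm_of_exponent_le (by norm_num)
      (aestronglyMeasurable_translate_sub (hm i) z)).trans
      ((hv i).increment_convolution_sub_le_mul hs hsθ hM h0 h1 z)

lemma tendsto_ofReal_mul_rpow_nhdsGT (c : ℝ) {γ : ℝ} (hγ : 0 < γ) :
    Tendsto (fun ε : ℝ => ENNReal.ofReal (c * ε ^ γ)) (𝓝[>] 0) (𝓝 0) := by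
  have h := ((Real.continuousAt_rpow_const 0 γ (Or.inr hγ.le)).const_mul c).tendsto
  rw [Real.zero_rpow hγ.ne', mul_zero] at h
  simpa using ENNReal.tendsto_ofReal (h.mono_left nhdsWithin_le_nhds)

lemma smoothApprox_neBot {v : T3 → E3} {θ M : ℝ} (hθ : 1 / 2 < θ) (hθ1 : θ ≤ 1) (hM : 0 ≤ M)
    (hv : ∀ i, IsBesov θ M (components v i)) : (smoothApprox v).NeBot := by
  obtain ⟨s, hs, hsθ⟩ := exists_between hθ
  have hconst := (gagliardoConst_lt_top hs (hsθ.le.trans hθ1)).ne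
  have hlim : Tendsto (fun ε : ℝ => ENNReal.ofReal (3 * (M * ε ^ θ)) +
      (ENNReal.ofReal (3 * (2 * (M * ε ^ (θ - s)))) ^ 2 * gagliardoConst s) ^ (1 / 2 : ℝ))
      (𝓝[>] 0) (𝓝 0) := by
    have hleft := tendsto_ofReal_mul_rpow_nhdsGT (3 * M) (γ := θ) (by linarith)
    have hright := (ENNReal.Tendsto.mul_const (b := gagliardoConst s)
      (ENNReal.Tendsto.pow (n := 2) (tendsto_ofReal_mul_rpow_nhdsGT (3 * (2 * M)) (sub_pos.2 hsθ)))
      (Or.inr hconst)).ennrpow_const (1 / 2)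
    simpa [mul_assoc] using hleft.add hright
  refine comap_neBot fun S hS => ?_
  obtain ⟨δ, hδ0, hδ⟩ := ENNReal.nhds_zero_basis_Iic.mem_iff.1 hS
  obtain ⟨ε, hε, h0, h1⟩ := ((hlim.eventually (Iic_mem_nhds hδ0)).and
    (Ioc_mem_nhdsGT one_pos)).exists
  obtain ⟨φ, hφ⟩ := exists_smoothField_sobolevHalfNorm_sub_le hv hM (by linarith) hsθ.le h0 h1
  exact ⟨φ, hδ (hφ.trans hε)⟩

lemma exists_hasHelicity {v : T3 → E3} {θ M ε : ℝ} (hθ : 1 / 2 < θ) (hθ1 : θ ≤ 1) (hM : 0 ≤ M)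
    (hv : ∀ i, IsBesov θ M (components v i)) (h0 : 0 < ε) (h1 : ε ≤ 1) :
    ∃ L, HasHelicity v L ∧
      |L - curlPairing (mollify ε (components v)) (mollify ε (components v))| ≤
        6 * (geomConst (2 * θ - 1) * (((1 + mollifierConst) * M) ^ 2 * ε ^ (2 * θ - 1))) := by
  have hC := mollifierConst_nonneg
  have hr : ∀ i, HasMollificationRate ((1 + mollifierConst) * M) θ (components v i) := fun i =>
    (hv i).hasMollificationRate (by linarith) hM
  obtain ⟨L, hL, hLε⟩ := exists_tendsto_curlPairing_mollify hr hr (by positivity) (by positivity)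
    (by linarith) (by linarith) (by linarith) h0 h1
  refine ⟨L, ⟨smoothApprox_neBot hθ hθ1 hM hv, ?_⟩, by rwa [two_mul, sq]⟩
  obtain ⟨K, hK⟩ := exists_abs_distCurl_sub_le hr (fun i => (hv i).memLp_two) (by positivity)
    hθ h0 h1 hL
  have hnorm : Tendsto (fun φ : SmoothField => sobolevHalfNorm (φ.1 - v)) (smoothApprox v) (𝓝 0) :=
    tendsto_comap
  have hbound : Tendsto (fun φ : SmoothField => K * (sobolevHalfNorm (φ.1 - v)).toReal)
      (smoothApprox v) (𝓝 0) := by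
    simpa using ((ENNReal.tendsto_toReal ENNReal.zero_ne_top).comp hnorm).const_mul K
  refine tendsto_iff_dist_tendsto_zero.2
    (squeeze_zero' (.of_forall fun _ => dist_nonneg) ?_ hbound)
  filter_upwards [hnorm.eventually_lt_const ENNReal.zero_lt_top] with φ hφ
  exact hK φ hφ.ne

lemma HasHelicity.helicity_eq {v : T3 → E3} {L : ℝ} (h : HasHelicity v L) : helicity v = L :=
  have := h.1
  h.2.limUnder_eq

lemma hasHelicity_helicity {v : T3 → E3} {θ M : ℝ} (hθ : 1 / 2 < θ) (hθ1 : θ ≤ 1) (hM : 0 ≤ M)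
    (hv : ∀ i, IsBesov θ M (components v i)) : HasHelicity v (helicity v) := by
  obtain ⟨L, hL, -⟩ := exists_hasHelicity hθ hθ1 hM hv one_pos le_rfl
  rwa [hL.helicity_eq]

lemma abs_helicity_sub_curlPairing_le {v : T3 → E3} {θ M ε : ℝ} (hθ : 1 / 2 < θ) (hθ1 : θ ≤ 1)
    (hM : 0 ≤ M) (hv : ∀ i, IsBesov θ M (components v i)) (h0 : 0 < ε) (h1 : ε ≤ 1) :
    |helicity v - curlPairing (mollify ε (components v)) (mollify ε (components v))| ≤
      6 * (geomConst (2 * θ - 1) * (((1 + mollifierConst) * M) ^ 2 * ε ^ (2 * θ - 1))) := by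
  obtain ⟨L, hL, hLε⟩ := exists_hasHelicity hθ hθ1 hM hv h0 h1
  rwa [hL.helicity_eq]

/-! ### Vector calculus -/

section Curl

variable {a b : Fin 3 → T3 → ℝ}

/-- The curl of a field given by its components. With indices taken modulo `3`, as addition in
`Fin 3` does, the three components have the same formula. -/
def curl (a : Fin 3 → T3 → ℝ) (i : Fin 3) : T3 → ℝ :=
  fun x => pd (i + 1) (a (i + 2)) x - pd (i + 2) (a (i + 1)) x

lemma isSmooth_curl (ha : ∀ i, IsSmooth (a i)) (i : Fin 3) : IsSmooth (curl a i) :=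
  ((ha _).pd _).sub ((ha _).pd _)

lemma pd_curl (ha : ∀ i, IsSmooth (a i)) (i j : Fin 3) (x : T3) :
    pd j (curl a i) x = pd j (pd (i + 1) (a (i + 2))) x - pd j (pd (i + 2) (a (i + 1))) x :=
  pd_sub ((ha _).pd _) ((ha _).pd _) j x

lemma sum_pd_curl_eq_zero (ha : ∀ i, IsSmooth (a i)) (x : T3) : ∑ i, pd i (curl a i) x = 0 := by
  simp only [pd_curl ha, Fin.sum_univ_three, zero_add, Fin.reduceAdd]
  rw [pd_comm (ha 2) 0 1, pd_comm (ha 1) 0 2, pd_comm (ha 0) 1 2]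
  ring

lemma curlPairing_eq_integral (ha : ∀ i, Integrable (a i)) (hb : ∀ i, IsSmooth (b i)) :
    curlPairing a b = ∫ x, ∑ i, a i x * curl b i x := by
  have h (l j i) : Integrable fun x => a l x * pd i (b j) x := by
    simpa only [mul_comm (a l _)] using
      integrable_continuous_mul ((hb j).pd i).continuous (ha l)
  simp only [curl, mul_sub]
  rw [integral_finsetSum _ fun i _ => by exact (h _ _ _).sub (h _ _ _)]
  simp only [integral_sub (h _ _ _) (h _ _ _), Fin.sum_univ_three, zero_add, Fin.reduceAdd,
    curlPairing, distPartial]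
  ring

lemma curlPairing_comm (ha : ∀ i, IsSmooth (a i)) (hb : ∀ i, IsSmooth (b i)) :
    curlPairing a b = curlPairing b a := by
  have h (l j i) : distPartial i (a l) (b j) = -distPartial i (b j) (a l) := by
    simp only [distPartial, integral_mul_pd (ha l) (hb j), mul_comm]
  simp only [curlPairing, h]
  ring

lemma isSmooth_dot (ha : ∀ i, IsSmooth (a i)) (hb : ∀ i, IsSmooth (b i)) :
    IsSmooth fun x => ∑ i, a i x * b i x :=
  ContDiff.sum fun i _ => (ha i).mul (hb i)

lemma pd_dot (ha : ∀ i, IsSmooth (a i)) (hb : ∀ i, IsSmooth (b i)) (j : Fin 3) (x : T3) :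
    pd j (fun x => ∑ i, a i x * b i x) x =
      ∑ i, (pd j (a i) x * b i x + a i x * pd j (b i) x) := by
  have h (i) : IsSmooth fun x => a i x * b i x := (ha i).mul (hb i)
  simp only [Fin.sum_univ_three]
  rw [pd_add ((h 0).add (h 1)) (h 2), pd_add (h 0) (h 1), pd_mul (ha 0) (hb 0),
    pd_mul (ha 1) (hb 1), pd_mul (ha 2) (hb 2)]

lemma integral_sum_mul_pd_eq_zero (ha : ∀ i, IsSmooth (a i)) (hdiv : ∀ x, ∑ i, pd i (a i) x = 0)
    {s : T3 → ℝ} (hs : IsSmooth s) : ∫ x, ∑ i, a i x * pd i s x = 0 := by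
  have h (i) : Integrable fun x => pd i (a i) x * s x :=
    integrable_of_continuous (((ha i).pd i).mul hs).continuous
  rw [integral_finsetSum _ fun i _ => integrable_of_continuous ((ha i).mul (hs.pd i)).continuous]
  simp only [integral_mul_pd (ha _) hs, Finset.sum_neg_distrib]
  rw [← integral_finsetSum _ fun i _ => h i]
  simp only [← Finset.sum_mul, hdiv, zero_mul, integral_zero, neg_zero]

/- The terms `(aⱼ wᵢ - wⱼ aᵢ) ∂ⱼ aᵢ` cancel because the antisymmetric part of `∇a` is given by
`w = curl a`. -/
lemma convection_curl_eq (ha : ∀ i, IsSmooth (a i)) (x : T3) :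
    ∑ i, ∑ j, a i x * a j x * pd j (curl a i) x =
      ∑ j, a j x * pd j (fun y => ∑ i, a i y * curl a i y) x
        - 2⁻¹ * ∑ j, curl a j x * pd j (fun y => ∑ i, a i y * a i y) x := by
  have hw (i) : curl a i x = pd (i + 1) (a (i + 2)) x - pd (i + 2) (a (i + 1)) x := rfl
  simp only [pd_dot ha (isSmooth_curl ha), pd_dot ha ha]
  simp only [Fin.sum_univ_three, hw, zero_add, Fin.reduceAdd]
  ring

lemma integral_convection_curl_eq_zero (ha : ∀ i, IsSmooth (a i))
    (hdiv : ∀ x, ∑ i, pd i (a i) x = 0) :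
    ∫ x, ∑ i, ∑ j, a i x * a j x * pd j (curl a i) x = 0 := by
  have hw := isSmooth_curl ha
  have integrable {c : Fin 3 → T3 → ℝ} (hc : ∀ i, IsSmooth (c i)) {s : T3 → ℝ}
      (hs : IsSmooth s) : Integrable fun x => ∑ j, c j x * pd j s x :=
    integrable_of_continuous (isSmooth_dot hc hs.pd).continuous
  simp only [convection_curl_eq ha]
  rw [integral_sub (integrable ha (isSmooth_dot ha hw))
    ((integrable hw (isSmooth_dot ha ha)).const_mul _), integral_const_mul,
    integral_sum_mul_pd_eq_zero ha hdiv (isSmooth_dot ha hw),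
    integral_sum_mul_pd_eq_zero hw (sum_pd_curl_eq_zero ha) (isSmooth_dot ha ha), mul_zero,
    sub_zero]

end Curl

/-! ### The commutator estimate -/

section Commutator

variable {f g k : T3 → ℝ} {θ M ε : ℝ}

/-- The commutator of mollification with multiplication. -/
def commutator (k f g : T3 → ℝ) (x : T3) : ℝ :=
  (k ⋆ fun y => f y * g y) x - (k ⋆ f) x * (k ⋆ g) x

/- The identity of Constantin, E and Titi. -/
lemma commutator_eq (hk : Continuous k) (h1 : ∫ z, k z = 1) (hf : MemLp f 2) (hg : MemLp g 2)
    (x : T3) :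
    commutator k f g x = (∫ z, k z • ((f (x - z) - f x) * (g (x - z) - g x)))
      - ((k ⋆ f) x - f x) * ((k ⋆ g) x - g x) := by
  have hfx := (hf.integrable one_le_two).comp_sub_left (μ := volume) x
  have hgx := (hg.integrable one_le_two).comp_sub_left (μ := volume) x
  have hfgx : Integrable fun z => f (x - z) * g (x - z) := (hf.integrable_mul hg).comp_sub_left x
  have i1 := integrable_continuous_mul hk hfgx
  have i2 := (integrable_continuous_mul hk hfx).mul_const (g x)
  have i3 := (integrable_continuous_mul hk hgx).mul_const (f x)
  have i4 := (integrable_of_continuous (μ := volume) hk).mul_const (f x * g x)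
  have expand (z) : k z • ((f (x - z) - f x) * (g (x - z) - g x)) =
      k z * (f (x - z) * g (x - z)) + k z * (f x * g x)
        - (k z * f (x - z) * g x + k z * g (x - z) * f x) := by
    rw [smul_eq_mul]
    ring
  simp_rw [expand]
  rw [integral_sub (i1.fun_add i4) (i2.fun_add i3), integral_add i1 i4, integral_add i2 i3,
    integral_mul_const, integral_mul_const, integral_mul_const, h1]
  simp only [commutator, convolution_lsmul, smul_eq_mul]
  ring

instance : ENNReal.HolderTriple 3 3 (ENNReal.ofReal (3 / 2)) := by
  constructor
  rw [← ENNReal.ofReal_inv_of_pos (by norm_num), ← ENNReal.ofReal_ofNat,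
    ← ENNReal.ofReal_inv_of_pos (by norm_num), ← ENNReal.ofReal_add (by norm_num) (by norm_num)]
  norm_num

instance : ENNReal.HolderTriple (ENNReal.ofReal (3 / 2)) 3 1 := by
  constructor
  rw [← ENNReal.ofReal_inv_of_pos (by norm_num), ← ENNReal.ofReal_ofNat,
    ← ENNReal.ofReal_inv_of_pos (by norm_num), ← ENNReal.ofReal_add (by norm_num) (by norm_num)]
  norm_num

lemma isSmooth_commutator (hk : IsSmooth k) (hf : MemLp f 2) (hg : MemLp g 2) :
    IsSmooth (commutator k f g) :=
  (hk.convolution (hf.integrable_mul hg)).sub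
    ((hk.convolution (hf.integrable one_le_two)).mul (hk.convolution (hg.integrable one_le_two)))

lemma IsBesov.eLpNorm_commutator_le (hf : IsBesov θ M f) (hg : IsBesov θ M g) (hθ : 0 ≤ θ)
    (hM : 0 ≤ M) (h0 : 0 < ε) (h1 : ε ≤ 1) :
    eLpNorm (commutator (mollifier ε) f g) (ENNReal.ofReal (3 / 2)) volume ≤
      ENNReal.ofReal (2 * (M * ε ^ θ * (M * ε ^ θ))) := by
  have hk := isMollifier_mollifier h0 h1
  have hA : 0 ≤ M * ε ^ θ := by positivity
  have increments : eLpNorm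
      (fun x => ∫ z, mollifier ε z • ((f (x - z) - f x) * (g (x - z) - g x)))
      (ENNReal.ofReal (3 / 2)) volume ≤ ENNReal.ofReal (M * ε ^ θ * (M * ε ^ θ)) := by
    refine (eLpNorm_integral_smul_le (by norm_num) (integrable_of_continuous hk.smooth.continuous)
      ((aestronglyMeasurable_increment hf.aesm).mul (aestronglyMeasurable_increment hg.aesm))
      fun z hz => eLpNorm_mul_le_ofReal (p := 3) (q := 3) hA
        (aestronglyMeasurable_translate_sub hf.aesm z)
        (aestronglyMeasurable_translate_sub hg.aesm z)
        (hf.increment_le_of_le hθ hM (not_lt.1 fun h => hz (hk.eq_zero z h)))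
        (hg.increment_le_of_le hθ hM (not_lt.1 fun h => hz (hk.eq_zero z h)))).trans_eq ?_
    rw [← ofReal_integral_abs (integrable_of_continuous hk.smooth.continuous), hk.integral_abs,
      ENNReal.ofReal_one, one_mul]
  have remainders : eLpNorm
      (fun x => ((mollifier ε ⋆ f) x - f x) * ((mollifier ε ⋆ g) x - g x))
      (ENNReal.ofReal (3 / 2)) volume ≤ ENNReal.ofReal (M * ε ^ θ * (M * ε ^ θ)) :=
    eLpNorm_mul_le_ofReal (p := 3) (q := 3) hA (hf.aestronglyMeasurable_convolution_sub h0 h1)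
      (hg.aestronglyMeasurable_convolution_sub h0 h1)
      (hf.eLpNorm_mollifier_convolution_sub_le hθ hM h0 h1)
      (hg.eLpNorm_mollifier_convolution_sub_le hθ hM h0 h1)
  have split := commutator_eq hk.smooth.continuous hk.integral_eq_one hf.memLp_two hg.memLp_two
  have hm := (isSmooth_commutator hk.smooth hf.memLp_two
    hg.memLp_two).continuous.aestronglyMeasurable (μ := volume)
  have hrm := (hf.aestronglyMeasurable_convolution_sub h0 h1).mul
    (hg.aestronglyMeasurable_convolution_sub h0 h1)
  rw [funext split, two_mul, ENNReal.ofReal_add (by positivity) (by positivity)]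
  refine (eLpNorm_sub_le ((hm.add hrm).congr (.of_forall fun x => ?_)) hrm
    (by norm_num)).trans (add_le_add increments remainders)
  simp only [Pi.add_apply, Pi.mul_apply, split, sub_add_cancel]

lemma IsBesov.abs_integral_commutator_mul_le (hf : IsBesov θ M f) (hg : IsBesov θ M g)
    (hθ : 0 ≤ θ) (hM : 0 ≤ M) (h0 : 0 < ε) (h1 : ε ≤ 1) {h : T3 → ℝ} {B : ℝ} (hB : 0 ≤ B)
    (hh : Continuous h) (hhB : eLpNorm h 3 volume ≤ ENNReal.ofReal B) :
    |∫ x, commutator (mollifier ε) f g x * h x| ≤ 2 * (M * ε ^ θ * (M * ε ^ θ)) * B :=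
  abs_integral_mul_le (p := ENNReal.ofReal (3 / 2)) (q := 3) (by positivity) hB
    (isSmooth_commutator (isMollifier_mollifier h0 h1).smooth hf.memLp_two
      hg.memLp_two).continuous.aestronglyMeasurable hh.aestronglyMeasurable
    (hf.eLpNorm_commutator_le hg hθ hM h0 h1) hhB

end Commutator

section Flux

variable {v : Fin 3 → T3 → ℝ} {θ M ε : ℝ}

/-- A field with components in `B^θ_{3,∞}` which is weakly divergence free. -/
structure IsBesovSolenoidal (θ M : ℝ) (v : Fin 3 → T3 → ℝ) : Prop where
  besov : ∀ i, IsBesov θ M (v i)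
  div_free : ∀ ψ : T3 → ℝ, IsSmooth ψ → ∫ x, ∑ i, v i x * pd i ψ x = 0

lemma IsBesovSolenoidal.sum_pd_convolution_eq_zero (hv : IsBesovSolenoidal θ M v) {k : T3 → ℝ}
    (hk : IsSmooth k) (x : T3) : ∑ i, pd i (k ⋆ v i) x = 0 := by
  have h := hv.div_free _ (hk.comp_sub_left x)
  simp_rw [pd_comp_sub_left hk, mul_neg, Finset.sum_neg_distrib, integral_neg, neg_eq_zero,
    mul_comm (v _ _)] at h
  rw [integral_finsetSum _ fun i _ =>
    integrable_convolution_integrand (hk.pd i).continuous (hv.besov i).integrable x] at h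
  simpa only [pd_convolution hk (hv.besov _).integrable, convolution_apply] using h

/-- The flux `∫ v ⊗ v : ∇Φ`. -/
def flux (v Φ : Fin 3 → T3 → ℝ) : ℝ := ∫ x, ∑ i, ∑ j, v i x * v j x * pd j (Φ i) x

/-- The test field of the helicity balance at scale `ε`: the mollified vorticity, mollified once
more. -/
def mollifiedCurl (ε : ℝ) (v : Fin 3 → T3 → ℝ) : Fin 3 → T3 → ℝ := mollify ε (curl (mollify ε v))

lemma isSmooth_mollifiedCurl (h0 : 0 < ε) (h1 : ε ≤ 1) (hv : ∀ i, Integrable (v i)) (i : Fin 3) :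
    IsSmooth (mollifiedCurl ε v i) :=
  isSmooth_mollify h0 h1 (integrable_of_continuous
    (isSmooth_curl (fun _ => isSmooth_mollify h0 h1 (hv _)) i).continuous)

lemma eLpNorm_pd_curl_mollify_le (hv : ∀ i, IsBesov θ M (v i)) (hθ : 0 ≤ θ) (hM : 0 ≤ M)
    (h0 : 0 < ε) (h1 : ε ≤ 1) (i j : Fin 3) : eLpNorm (pd j (curl (mollify ε v) i)) 3 volume ≤
      ENNReal.ofReal (2 * (mollifierConst / ε ^ 2 * (M * ε ^ θ))) := by
  have ha (l) : IsSmooth (mollify ε v l) := isSmooth_mollify h0 h1 (hv l).integrable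
  have hC := mollifierConst_nonneg
  rw [funext (pd_curl ha i j), two_mul, ENNReal.ofReal_add (by positivity) (by positivity)]
  exact (eLpNorm_sub_le (((ha _).pd _).pd j).continuous.aestronglyMeasurable
    (((ha _).pd _).pd j).continuous.aestronglyMeasurable (by norm_num)).trans
      (add_le_add ((hv _).eLpNorm_pd_pd_mollifier_convolution_le hθ hM h0 h1 _ j)
        ((hv _).eLpNorm_pd_pd_mollifier_convolution_le hθ hM h0 h1 _ j))

lemma flux_eq_sum {Φ : Fin 3 → T3 → ℝ} (hv : ∀ i, MemLp (v i) 2) (hΦ : ∀ i, IsSmooth (Φ i)) :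
    flux v Φ = ∑ i, ∑ j, ∫ x, v i x * v j x * pd j (Φ i) x := by
  have hi (i j) : Integrable fun x => v i x * v j x * pd j (Φ i) x := by
    simpa only [Pi.mul_apply, mul_comm (pd j (Φ i) _)] using!
      integrable_continuous_mul ((hΦ i).pd j).continuous ((hv i).integrable_mul (hv j))
  rw [flux, integral_finsetSum _ fun i _ => integrable_finsetSum _ fun j _ => hi i j]
  exact Finset.sum_congr rfl fun i _ => integral_finsetSum _ fun j _ => hi i j

lemma integral_mul_pd_mollify {w : Fin 3 → T3 → ℝ} (hv : ∀ i, MemLp (v i) 2)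
    (hw : ∀ i, IsSmooth (w i)) (h0 : 0 < ε) (h1 : ε ≤ 1) (i j : Fin 3) :
    ∫ x, v i x * v j x * pd j (mollify ε w i) x =
      (∫ x, commutator (mollifier ε) (v i) (v j) x * pd j (w i) x)
        + ∫ x, mollify ε v i x * mollify ε v j x * pd j (w i) x := by
  have hk := isMollifier_mollifier h0 h1
  have hm (l) : IsSmooth (mollify ε v l) := isSmooth_mollify h0 h1 ((hv l).integrable one_le_two)
  have hpd : pd j (mollify ε w i) = mollifier ε ⋆ pd j (w i) :=
    pd_convolution_eq_convolution_pd hk.smooth (hw i) j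
  have hvv : Integrable fun x => v i x * v j x := (hv i).integrable_mul (hv j)
  rw [hpd, ← integral_convolution_mul hk.smooth.continuous hk.even hvv
      (integrable_of_continuous ((hw i).pd j).continuous),
    ← integral_add
      (integrable_of_continuous
        ((isSmooth_commutator hk.smooth (hv i) (hv j)).mul ((hw i).pd j)).continuous)
      (integrable_of_continuous (((hm i).mul (hm j)).mul ((hw i).pd j)).continuous)]
  refine integral_congr_ae (.of_forall fun x => ?_)
  simp only [commutator, mollify]
  ring

lemma IsBesovSolenoidal.flux_mollifiedCurl (hv : IsBesovSolenoidal θ M v) (h0 : 0 < ε)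
    (h1 : ε ≤ 1) : flux v (mollifiedCurl ε v) = ∑ i, ∑ j,
      ∫ x, commutator (mollifier ε) (v i) (v j) x * pd j (curl (mollify ε v) i) x := by
  have hv2 (i) := (hv.besov i).memLp_two
  have hm (l) : IsSmooth (mollify ε v l) := isSmooth_mollify h0 h1 (hv.besov l).integrable
  have resolved : ∑ i, ∑ j, ∫ x, mollify ε v i x * mollify ε v j x *
      pd j (curl (mollify ε v) i) x = 0 := by
    rw [← flux_eq_sum (fun i => (hm i).continuous.memLp_of_hasCompactSupport
      (HasCompactSupport.of_compactSpace _)) (isSmooth_curl hm)]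
    exact integral_convection_curl_eq_zero hm
      (hv.sum_pd_convolution_eq_zero (isMollifier_mollifier h0 h1).smooth)
  rw [flux_eq_sum hv2 (isSmooth_mollifiedCurl h0 h1 fun i => (hv.besov i).integrable)]
  simp only [mollifiedCurl, integral_mul_pd_mollify hv2 (isSmooth_curl hm) h0 h1,
    Finset.sum_add_distrib, resolved, add_zero]

lemma IsBesovSolenoidal.abs_flux_mollifiedCurl_le (hv : IsBesovSolenoidal θ M v) (hθ : 0 ≤ θ)
    (hM : 0 ≤ M) (h0 : 0 < ε) (h1 : ε ≤ 1) :
    |flux v (mollifiedCurl ε v)| ≤ 36 * (mollifierConst * M ^ 3 * ε ^ (3 * θ - 2)) := by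
  have hC := mollifierConst_nonneg
  have hm (l) : IsSmooth (mollify ε v l) := isSmooth_mollify h0 h1 (hv.besov l).integrable
  have hpow : ε ^ (3 * θ - 2) = ε ^ θ * ε ^ θ * ε ^ θ / ε ^ 2 := by
    rw [Real.rpow_sub h0, Real.rpow_ofNat, ← Real.rpow_add h0, ← Real.rpow_add h0]
    ring_nf
  have bound (i j) : |∫ x, commutator (mollifier ε) (v i) (v j) x *
      pd j (curl (mollify ε v) i) x| ≤ 4 * (mollifierConst * M ^ 3 * ε ^ (3 * θ - 2)) := by
    refine ((hv.besov i).abs_integral_commutator_mul_le (hv.besov j) hθ hM h0 h1 (by positivity)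
      ((isSmooth_curl hm i).pd j).continuous
      (eLpNorm_pd_curl_mollify_le hv.besov hθ hM h0 h1 i j)).trans_eq ?_
    rw [hpow]
    ring
  rw [hv.flux_mollifiedCurl h0 h1]
  calc _ ≤ ∑ _i : Fin 3, ∑ _j : Fin 3, 4 * (mollifierConst * M ^ 3 * ε ^ (3 * θ - 2)) :=
        (Finset.abs_sum_le_sum_abs _ _).trans (Finset.sum_le_sum fun i _ =>
          (Finset.abs_sum_le_sum_abs _ _).trans (Finset.sum_le_sum fun j _ => bound i j))
    _ = _ := by
        simp only [Finset.sum_const, Finset.card_univ, Fintype.card_fin, nsmul_eq_mul,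
          Nat.cast_ofNat]
        ring

end Flux

/-! ### Weak derivatives on an interval -/

section WeakDerivative

variable {c g h η : ℝ → ℝ} {a b : ℝ}

lemma exists_subset_Icc_of_isCompact {K : Set ℝ} (hK : IsCompact K) (hKab : K ⊆ Ioo a b) :
    ∃ a' b', a < a' ∧ b' < b ∧ K ⊆ Icc a' b' := by
  rcases K.eq_empty_or_nonempty with rfl | hne
  · exact ⟨a + 1, b - 1, by linarith, by linarith, empty_subset _⟩
  obtain ⟨a', ha', hl⟩ := hK.exists_isLeast hne
  obtain ⟨b', hb', hg⟩ := hK.exists_isGreatest hne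
  exact ⟨a', b', (hKab ha').1, (hKab hb').2, fun x hx => ⟨hl hx, hg hx⟩⟩

lemma support_integral_subset_Icc {a' b' : ℝ} (ha : a < a') (hs : Function.support h ⊆ Icc a' b')
    (h0 : ∫ x, h x = 0) : (Function.support fun x => ∫ y in a..x, h y) ⊆ Icc a' b' := by
  intro x hx
  by_contra hx'
  apply hx
  rcases lt_or_ge x a' with hxa | hxa
  · refine intervalIntegral.integral_zero_ae (.of_forall fun y hy => ?_)
    by_contra hhy
    exact (hy.2.trans_lt (max_lt ha hxa)).not_ge (hs hhy).1
  · have hxb : b' < x := not_le.1 fun hxb => hx' ⟨hxa, hxb⟩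
    change ∫ y in a..x, h y = 0
    rw [intervalIntegral.integral_eq_integral_of_support_subset, h0]
    exact hs.trans fun y hy => ⟨ha.trans_le hy.1, hy.2.trans hxb.le⟩

lemma exists_contDiff_primitive (hh : ContDiff ℝ ∞ h) (hc : HasCompactSupport h)
    (hs : tsupport h ⊆ Ioo a b) (h0 : ∫ x, h x = 0) :
    ∃ η : ℝ → ℝ, ContDiff ℝ ∞ η ∧ HasCompactSupport η ∧ tsupport η ⊆ Ioo a b ∧ deriv η = h := by
  obtain ⟨a', b', ha, hb, hK⟩ := exists_subset_Icc_of_isCompact hc.isCompact hs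
  set η : ℝ → ℝ := fun x => ∫ y in a..x, h y
  have hd (x) : HasDerivAt η (h x) x :=
    intervalIntegral.integral_hasDerivAt_right (hh.continuous.intervalIntegrable _ _)
      (hh.continuous.stronglyMeasurableAtFilter _ _) hh.continuous.continuousAt
  have hde : deriv η = h := funext fun x => (hd x).deriv
  have ht : tsupport η ⊆ Icc a' b' := closure_minimal
    (support_integral_subset_Icc ha ((subset_tsupport h).trans hK) h0) isClosed_Icc
  refine ⟨η, ?_, isCompact_Icc.of_isClosed_subset (isClosed_tsupport _) ht,
    ht.trans fun x hx => ⟨ha.trans_le hx.1, hx.2.trans_lt hb⟩, hde⟩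
  rw [contDiff_infty_iff_deriv, hde]
  exact ⟨fun x => (hd x).differentiableAt, hh⟩

lemma exists_contDiff_integral_eq_one (hab : a < b) :
    ∃ ρ : ℝ → ℝ, ContDiff ℝ ∞ ρ ∧ HasCompactSupport ρ ∧ tsupport ρ ⊆ Ioo a b ∧ ∫ x, ρ x = 1 := by
  let f : ContDiffBump ((a + b) / 2) := ⟨(b - a) / 8, (b - a) / 4, by linarith, by linarith⟩
  refine ⟨f.normed volume, f.contDiff_normed, f.hasCompactSupport_normed, ?_, f.integral_normed⟩
  rw [f.tsupport_normed_eq, Real.closedBall_eq_Icc]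
  refine fun x hx => ⟨?_, ?_⟩ <;> linarith [hx.1, hx.2, show f.rOut = (b - a) / 4 from rfl]

lemma integrable_mul_of_tsupport_subset {U : Set ℝ} (hg : Continuous g)
    (hgc : HasCompactSupport g) (hgU : tsupport g ⊆ U) (hc : LocallyIntegrableOn c U) :
    Integrable fun x => g x * c x := by
  refine (integrableOn_iff_integrable_of_support_subset
    ((Function.support_mul_subset_left g c).trans (subset_tsupport g))).1 ?_
  exact IntegrableOn.continuousOn_mul hg.continuousOn (hc.integrableOn_compact_subset hgU hgc) hgc

/- The lemma of du Bois-Reymond: `g - (∫ g) ρ` is an admissible derivative, for any fixed `ρ` of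
integral one. -/
lemma exists_ae_eq_const (hab : a < b) (hc : LocallyIntegrableOn c (Ioo a b))
    (h : ∀ η : ℝ → ℝ, ContDiff ℝ ∞ η → HasCompactSupport η → tsupport η ⊆ Ioo a b →
      ∫ x, deriv η x * c x = 0) :
    ∃ m, ∀ᵐ x, x ∈ Ioo a b → c x = m := by
  obtain ⟨ρ, hρ, hρc, hρs, hρ1⟩ := exists_contDiff_integral_eq_one hab
  have hρi := hρ.continuous.integrable_of_hasCompactSupport (μ := volume) hρc
  have hρci := integrable_mul_of_tsupport_subset hρ.continuous hρc hρs hc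
  set m := ∫ x, ρ x * c x
  suffices orthogonal : ∀ g : ℝ → ℝ, ContDiff ℝ ∞ g → HasCompactSupport g →
      tsupport g ⊆ Ioo a b → ∫ x, g x • (c x - m) = 0 by
    refine ⟨m, ?_⟩
    filter_upwards [isOpen_Ioo.ae_eq_zero_of_integral_contDiff_smul_eq_zero
      (hc.sub (locallyIntegrableOn_const _)) orthogonal] with x hx hxI
    exact sub_eq_zero.1 (hx hxI)
  intro g hg hgc hgs
  have hgi := hg.continuous.integrable_of_hasCompactSupport (μ := volume) hgc
  have hgci := integrable_mul_of_tsupport_subset hg.continuous hgc hgs hc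
  set G := ∫ x, g x with hG
  have mean_zero : ∫ x, (g x - G * ρ x) = 0 := by
    rw [integral_sub hgi (hρi.const_mul G), integral_const_mul, hρ1, mul_one, sub_self]
  obtain ⟨η, hη, hηc, hηs, hηd⟩ := exists_contDiff_primitive (hg.sub (contDiff_const.mul hρ))
    (hgc.sub hρc.mul_left) ((tsupport_sub _ _).trans (union_subset hgs
      ((tsupport_mul_subset_right).trans hρs))) mean_zero
  have h0 := h η hη hηc hηs
  simp_rw [hηd, sub_mul, mul_assoc] at h0
  rw [integral_sub hgci (hρci.const_mul G), integral_const_mul] at h0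
  simp_rw [smul_eq_mul, mul_sub]
  rw [integral_sub hgci (hgi.mul_const m), integral_mul_const, ← hG]
  exact h0

lemma eq_zero_of_tsupport_subset {U : Set ℝ} (hηs : tsupport η ⊆ U) {t : ℝ} (ht : t ∉ U) :
    η t = 0 :=
  image_eq_zero_of_notMem_tsupport fun h => ht (hηs h)

lemma integral_deriv_mul_integral (hab : a ≤ b) (hc : IntegrableOn c (Ioo a b))
    (hη : ContDiff ℝ ∞ η) (hηs : tsupport η ⊆ Ioo a b) :
    ∫ t in Ioo a b, deriv η t * ∫ r in a..t, c r = -∫ t in Ioo a b, η t * c t := by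
  have hci : IntervalIntegrable c volume a b :=
    (intervalIntegrable_iff_integrableOn_Ioo_of_le hab).2 hc
  have hηac : AbsolutelyContinuousOnInterval η a b :=
    (hη.of_le (by simp)).contDiffOn.absolutelyContinuousOnInterval
  have parts := hηac.integral_mul_deriv_eq_deriv_mul
    (hci.absolutelyContinuousOnInterval_intervalIntegral left_mem_uIcc)
  rw [eq_zero_of_tsupport_subset hηs left_notMem_Ioo,
    eq_zero_of_tsupport_subset hηs right_notMem_Ioo, zero_mul, zero_mul, sub_self,
    zero_sub] at parts
  simp_rw [intervalIntegral.integral_of_le hab, integral_Ioc_eq_integral_Ioo] at parts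
  have deriv_eq : ∫ t in Ioo a b, η t * deriv (fun t => ∫ r in a..t, c r) t =
      ∫ t in Ioo a b, η t * c t := by
    refine setIntegral_congr_ae measurableSet_Ioo ?_
    filter_upwards [hci.ae_hasDerivAt_integral] with t ht htI
    rw [(ht (Icc_subset_uIcc (Ioo_subset_Icc_self htI)) a left_mem_uIcc).deriv]
  linarith

lemma exists_ae_eq_const_add_integral (hab : a < b) (hg : IntegrableOn g (Ioo a b))
    (hc : IntegrableOn c (Ioo a b))
    (h : ∀ η : ℝ → ℝ, ContDiff ℝ ∞ η → HasCompactSupport η → tsupport η ⊆ Ioo a b →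
      ∫ t in Ioo a b, (deriv η t * g t + η t * c t) = 0) :
    ∃ m, ∀ᵐ t, t ∈ Ioo a b → g t = m + ∫ r in a..t, c r := by
  have hci : IntervalIntegrable c volume a b :=
    (intervalIntegrable_iff_integrableOn_Ioo_of_le hab.le).2 hc
  have hCc := (hci.absolutelyContinuousOnInterval_intervalIntegral left_mem_uIcc).continuousOn
  have hCi : IntegrableOn (fun t => ∫ r in a..t, c r) (Ioo a b) :=
    (hCc.integrableOn_compact isCompact_uIcc).mono_set (Ioo_subset_Icc_self.trans Icc_subset_uIcc)
  have hdiff : IntegrableOn (fun t => g t - ∫ r in a..t, c r) (Ioo a b) := hg.sub hCi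
  suffices orthogonal : ∀ η : ℝ → ℝ, ContDiff ℝ ∞ η → HasCompactSupport η → tsupport η ⊆ Ioo a b →
      ∫ t, deriv η t * (g t - ∫ r in a..t, c r) = 0 by
    obtain ⟨m, hm⟩ := exists_ae_eq_const hab hdiff.locallyIntegrableOn orthogonal
    exact ⟨m, hm.mono fun t ht htI => sub_eq_iff_eq_add.1 (ht htI)⟩
  intro η hη hηc hηs
  have hη' : Continuous (deriv η) := hη.continuous_deriv (by simp)
  have hs' : tsupport (deriv η) ⊆ Ioo a b := tsupport_deriv_subset.trans hηs
  have hηg := integrable_mul_of_tsupport_subset hη' hηc.deriv hs' hg.locallyIntegrableOn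
  have hηC := integrable_mul_of_tsupport_subset hη' hηc.deriv hs' hCi.locallyIntegrableOn
  have hηc' := integrable_mul_of_tsupport_subset hη.continuous hηc hηs hc.locallyIntegrableOn
  have h0 := h η hη hηc hηs
  rw [integral_add hηg.integrableOn hηc'.integrableOn] at h0
  rw [← setIntegral_eq_integral_of_forall_compl_eq_zero (s := Ioo a b) fun t ht => by
    rw [eq_zero_of_tsupport_subset hs' ht, zero_mul]]
  simp_rw [mul_sub]
  rw [integral_sub hηg.integrableOn hηC.integrableOn, integral_deriv_mul_integral hab.le hc hη hηs]
  linarith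

end WeakDerivative

/-! ### Hölder functions -/

section Holder

open scoped NNReal

lemma dist_le_of_dist_le_quadratic_half {E F : Type*} [NormedAddCommGroup E] [NormedSpace ℝ E]
    [PseudoMetricSpace F] {f : E → F} {G I : Set E} {A L : ℝ} (hI : Convex ℝ I) (hGI : G ⊆ I)
    (hG : I ⊆ closure G)
    (h : ∀ s ∈ G, ∀ t ∈ G, dist (f s) (f t) ≤ A * dist s t + L * dist s t ^ 2) :
    ∀ s ∈ G, ∀ t ∈ G, dist (f s) (f t) ≤ A * dist s t + L / 2 * dist s t ^ 2 := by
  intro s hs t ht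
  have hclosed : IsClosed {m : E | dist (f s) (f t) ≤
      A * (dist s m + dist m t) + L * (dist s m ^ 2 + dist m t ^ 2)} :=
    isClosed_le continuous_const (by fun_prop)
  have hmid : midpoint ℝ s t ∈ closure G := hG (hI.midpoint_mem (hGI hs) (hGI ht))
  have hle := closure_minimal (fun m hm => by
    rw [mem_ofPred_eq]
    linarith [h s hs m hm, h m hm t ht, dist_triangle (f s) (f m) (f t)]) hclosed hmid
  rw [mem_ofPred_eq, dist_left_midpoint, dist_midpoint_right, Real.norm_ofNat] at hle
  linarith

/- Bisecting an interval halves the quadratic error. -/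
lemma dist_le_of_dist_le_quadratic {E F : Type*} [NormedAddCommGroup E] [NormedSpace ℝ E]
    [PseudoMetricSpace F] {f : E → F} {G I : Set E} {A L : ℝ} (hI : Convex ℝ I) (hGI : G ⊆ I)
    (hG : I ⊆ closure G)
    (h : ∀ s ∈ G, ∀ t ∈ G, dist (f s) (f t) ≤ A * dist s t + L * dist s t ^ 2) :
    ∀ s ∈ G, ∀ t ∈ G, dist (f s) (f t) ≤ A * dist s t := by
  have bisected (n : ℕ) : ∀ s ∈ G, ∀ t ∈ G,
      dist (f s) (f t) ≤ A * dist s t + L / 2 ^ n * dist s t ^ 2 := by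
    induction n with
    | zero => simpa only [pow_zero, div_one] using h
    | succ n ih =>
      rw [pow_succ, ← div_div]
      exact dist_le_of_dist_le_quadratic_half hI hGI hG ih
  intro s hs t ht
  have hlim : Tendsto (fun n : ℕ => A * dist s t + L / 2 ^ n * dist s t ^ 2) atTop
      (𝓝 (A * dist s t + 0 * dist s t ^ 2)) :=
    ((tendsto_const_nhds.div_atTop (tendsto_pow_atTop_atTop_of_one_lt one_lt_two)).mul_const
      _).const_add _
  simpa only [zero_mul, add_zero] using ge_of_tendsto' hlim fun n => bisected n s hs t ht

lemma holderOnWith_of_dist_le {X Y : Type*} [PseudoMetricSpace X] [PseudoMetricSpace Y]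
    {f : X → Y} {s : Set X} {C r : ℝ≥0}
    (h : ∀ x ∈ s, ∀ y ∈ s, dist (f x) (f y) ≤ C * dist x y ^ (r : ℝ)) : HolderOnWith C r f s := by
  intro x hx y hy
  rw [edist_nndist, edist_nndist, ← ENNReal.coe_rpow_of_nonneg _ r.coe_nonneg]
  exact_mod_cast h x hx y hy

lemma exists_holderOnWith_closure {X Y : Type*} [PseudoMetricSpace X] [MetricSpace Y]
    [CompleteSpace Y] {f : X → Y} {s : Set X} {C r : ℝ≥0} (hf : HolderOnWith C r f s)
    (hr : 0 < r) : ∃ g, HolderOnWith C r g (closure s) ∧ EqOn g f s := by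
  have huc := hf.uniformContinuousOn hr
  have hlim : ∀ x ∈ closure s, Tendsto f (𝓝[s] x) (𝓝 (extendFrom s f x)) := by
    intro x hx
    have : (𝓝[s] x).NeBot := mem_closure_iff_nhdsWithin_neBot.1 hx
    exact tendsto_extendFrom (CompleteSpace.complete
      ((cauchy_nhds.mono nhdsWithin_le_nhds).map_of_le huc inf_le_right))
  refine ⟨extendFrom s f, holderOnWith_of_dist_le fun x hx y hy => ?_,
    extendFrom_extends huc.continuousOn⟩
  have : (𝓝[s] x).NeBot := mem_closure_iff_nhdsWithin_neBot.1 hx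
  have : (𝓝[s] y).NeBot := mem_closure_iff_nhdsWithin_neBot.1 hy
  refine le_of_tendsto_of_tendsto (b := 𝓝[s] x ×ˢ 𝓝[s] y)
    (((hlim x hx).comp tendsto_fst).dist ((hlim y hy).comp tendsto_snd))
    ((((tendsto_fst.mono_right nhdsWithin_le_nhds).dist
      (tendsto_snd.mono_right nhdsWithin_le_nhds)).rpow_const (.inr r.coe_nonneg)).const_mul _) ?_
  filter_upwards [prod_mem_prod self_mem_nhdsWithin self_mem_nhdsWithin] with q hq
  exact hf.dist_le hq.1 hq.2

lemma dimH_image_le_of_locally_const {X Y : Type*} [EMetricSpace X] [SecondCountableTopology X]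
    [EMetricSpace Y] {f : X → Y} {C r : ℝ≥0} {I S : Set X} (hf : HolderOnWith C r f I)
    (hr : 0 < r) (hconst : ∀ x ∈ I \ S, ∀ᶠ y in 𝓝 x, f y = f x) :
    dimH (f '' I) ≤ dimH S / r := by
  have hcount : (f '' (I \ S)).Countable := by
    obtain ⟨c, -, hcc, hcov⟩ := TopologicalSpace.countable_cover_nhdsWithin
      (s := I \ S) (f := fun x => {y | f y = f x}) fun x hx =>
        mem_nhdsWithin_of_mem_nhds (hconst x hx)
    refine (hcc.image f).mono ?_
    rintro _ ⟨x, hx, rfl⟩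
    obtain ⟨y, hy, hxy⟩ := mem_iUnion₂.1 (hcov hx)
    exact ⟨y, hy, hxy.symm⟩
  calc dimH (f '' I) = dimH (f '' (I ∩ S) ∪ f '' (I \ S)) := by
        rw [← image_union, inter_union_sdiff]
    _ = dimH (f '' (I ∩ S)) := by rw [dimH_union, dimH_countable hcount, max_eq_left zero_le]
    _ ≤ dimH (I ∩ S) / r := (hf.mono inter_subset_left).dimH_image_le hr
    _ ≤ dimH S / r := ENNReal.div_le_div_right (dimH_mono inter_subset_right) _

lemma eq_of_dimH_lt {X : Type*} [EMetricSpace X] [SecondCountableTopology X] {f : X → ℝ}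
    {C r : ℝ≥0} {I S : Set X} (hI : IsPreconnected I) (hf : HolderOnWith C r f I) (hr : 0 < r)
    (hconst : ∀ x ∈ I \ S, ∀ᶠ y in 𝓝 x, f y = f x) (hS : dimH S < r) {x y : X}
    (hx : x ∈ I) (hy : y ∈ I) : f x = f y := by
  by_contra hne
  have hlt : dimH (f '' I) < 1 := (dimH_image_le_of_locally_const hf hr hconst).trans_lt <| by
    rwa [ENNReal.div_lt_iff (.inl (by simpa using hr.ne')) (.inl ENNReal.coe_ne_top), one_mul]
  have hsub : segment ℝ (f x) (f y) ⊆ f '' I := by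
    rw [segment_eq_uIcc]
    exact (hI.image f (hf.continuousOn hr)).ordConnected.uIcc_subset (mem_image_of_mem f hx)
      (mem_image_of_mem f hy)
  exact (((Real.dimH_segment hne).ge.trans (dimH_mono hsub)).trans_lt hlt).false

end Holder

/-! ### Pairings with smooth solenoidal fields -/

section Pairing

/-- Smooth divergence-free fields on the torus, given by their components: the test fields from
which the pressure disappears. -/
structure IsSolenoidalTest (Φ : Fin 3 → T3 → ℝ) : Prop where
  smooth : ∀ i, IsSmooth (Φ i)
  div_eq_zero : ∀ x, ∑ i, pd i (Φ i) x = 0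

/-- The `L²` pairing `∫ v · Φ` of two fields given by their components. -/
def pairing (v Φ : Fin 3 → T3 → ℝ) : ℝ := ∫ x, ∑ i, v i x * Φ i x

variable {v w Φ Ψ a : Fin 3 → T3 → ℝ} {θ M δ ε : ℝ}

lemma IsSolenoidalTest.sub (hΦ : IsSolenoidalTest Φ) (hΨ : IsSolenoidalTest Ψ) :
    IsSolenoidalTest (Φ - Ψ) where
  smooth i := (hΦ.smooth i).sub (hΨ.smooth i)
  div_eq_zero x := by
    have h (i) : pd i ((Φ - Ψ) i) x = pd i (Φ i) x - pd i (Ψ i) x :=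
      pd_sub (hΦ.smooth i) (hΨ.smooth i) i x
    simp only [h, Finset.sum_sub_distrib, hΦ.div_eq_zero, hΨ.div_eq_zero, sub_zero]

lemma isSolenoidalTest_zero : IsSolenoidalTest 0 :=
  ⟨fun _ => IsSmooth.const 0, fun x => Finset.sum_eq_zero fun i _ => congrFun (pd_const 0 i) x⟩

lemma isSolenoidalTest_curl (ha : ∀ i, IsSmooth (a i)) : IsSolenoidalTest (curl a) :=
  ⟨isSmooth_curl ha, sum_pd_curl_eq_zero ha⟩

lemma IsSolenoidalTest.convolution {k : T3 → ℝ} (hk : IsSmooth k) (hΦ : IsSolenoidalTest Φ) :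
    IsSolenoidalTest fun i => k ⋆ Φ i where
  smooth i := hk.convolution (integrable_of_continuous (hΦ.smooth i).continuous)
  div_eq_zero x := by
    simp_rw [pd_convolution_eq_convolution_pd hk (hΦ.smooth _), convolution_apply]
    rw [← integral_finsetSum _ fun i _ => integrable_convolution_integrand hk.continuous
      (integrable_of_continuous ((hΦ.smooth i).pd i).continuous) x]
    simp_rw [← Finset.mul_sum, hΦ.div_eq_zero, mul_zero, integral_zero]

lemma isSolenoidalTest_mollifiedCurl (h0 : 0 < ε) (h1 : ε ≤ 1) (hv : ∀ i, Integrable (v i)) :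
    IsSolenoidalTest (mollifiedCurl ε v) :=
  (isSolenoidalTest_curl fun _ => isSmooth_mollify h0 h1 (hv _)).convolution
    (isMollifier_mollifier h0 h1).smooth

lemma integrable_mul_continuous {f φ : T3 → ℝ} (hf : Integrable f) (hφ : Continuous φ) :
    Integrable fun x => f x * φ x := by
  simpa only [mul_comm (f _)] using integrable_continuous_mul hφ hf

lemma pairing_eq_sum (hv : ∀ i, Integrable (v i)) (hΦ : ∀ i, Continuous (Φ i)) :
    pairing v Φ = ∑ i, ∫ x, v i x * Φ i x :=
  integral_finsetSum _ fun i _ => integrable_mul_continuous (hv i) (hΦ i)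

lemma integrable_pairing (hv : ∀ i, Integrable (v i)) (hΦ : ∀ i, Continuous (Φ i)) :
    Integrable fun x => ∑ i, v i x * Φ i x :=
  integrable_finsetSum _ fun i _ => integrable_mul_continuous (hv i) (hΦ i)

lemma integrable_flux (hv : ∀ i, MemLp (v i) 2) (hΦ : ∀ i, IsSmooth (Φ i)) :
    Integrable fun x => ∑ i, ∑ j, v i x * v j x * pd j (Φ i) x :=
  integrable_finsetSum _ fun i _ => integrable_finsetSum _ fun j _ =>
    integrable_mul_continuous ((hv i).integrable_mul (hv j)) ((hΦ i).pd j).continuous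

lemma pairing_sub (hv : ∀ i, Integrable (v i)) (hΦ : ∀ i, Continuous (Φ i))
    (hΨ : ∀ i, Continuous (Ψ i)) : pairing v (Φ - Ψ) = pairing v Φ - pairing v Ψ := by
  simp only [pairing, ← integral_sub (integrable_pairing hv hΦ) (integrable_pairing hv hΨ),
    ← Finset.sum_sub_distrib, ← mul_sub, Pi.sub_apply]

lemma flux_sub (hv : ∀ i, MemLp (v i) 2) (hΦ : ∀ i, IsSmooth (Φ i)) (hΨ : ∀ i, IsSmooth (Ψ i)) :
    flux v (Φ - Ψ) = flux v Φ - flux v Ψ := by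
  have hpd (i j x) : pd j ((Φ - Ψ) i) x = pd j (Φ i) x - pd j (Ψ i) x :=
    pd_sub (hΦ i) (hΨ i) j x
  simp only [flux, ← integral_sub (integrable_flux hv hΦ) (integrable_flux hv hΨ),
    ← Finset.sum_sub_distrib, ← mul_sub, hpd]

lemma curlPairing_mollify_eq_pairing (h0 : 0 < ε) (h1 : ε ≤ 1) (hv : ∀ i, Integrable (v i))
    (hw : ∀ i, Integrable (w i)) :
    curlPairing (mollify ε v) (mollify ε w) = pairing v (mollifiedCurl ε w) := by
  have hk := isMollifier_mollifier h0 h1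
  have hvε (i) : IsSmooth (mollify ε v i) := isSmooth_mollify h0 h1 (hv i)
  have hcurl := isSmooth_curl fun i => isSmooth_mollify h0 h1 (hw i)
  rw [curlPairing_eq_integral (fun i => integrable_of_continuous (hvε i).continuous)
      fun i => isSmooth_mollify h0 h1 (hw i),
    pairing_eq_sum hv fun i => (isSmooth_mollifiedCurl h0 h1 hw i).continuous,
    integral_finsetSum _ fun i _ => integrable_of_continuous ((hvε i).mul (hcurl i)).continuous]
  exact Finset.sum_congr rfl fun i _ => integral_convolution_mul hk.smooth.continuous hk.even (hv i)
    (integrable_of_continuous (hcurl i).continuous)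

lemma pairing_mollifiedCurl_comm (h0 : 0 < ε) (h1 : ε ≤ 1) (hv : ∀ i, Integrable (v i))
    (hw : ∀ i, Integrable (w i)) :
    pairing v (mollifiedCurl ε w) = pairing w (mollifiedCurl ε v) := by
  rw [← curlPairing_mollify_eq_pairing h0 h1 hv hw, ← curlPairing_mollify_eq_pairing h0 h1 hw hv,
    curlPairing_comm (fun i => isSmooth_mollify h0 h1 (hv i))
      fun i => isSmooth_mollify h0 h1 (hw i)]

lemma abs_integral_mul_le_of_abs_le {X : Type*} {_ : MeasurableSpace X} {μ : Measure X}
    {f φ : X → ℝ} {A : ℝ} (hA : 0 ≤ A) (hδ : 0 ≤ δ) (hfm : AEStronglyMeasurable f μ)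
    (hφm : AEStronglyMeasurable φ μ) (hf : eLpNorm f 1 μ ≤ ENNReal.ofReal A)
    (hφ : ∀ x, |φ x| ≤ δ) : |∫ x, f x * φ x ∂μ| ≤ A * δ :=
  abs_integral_mul_le (p := 1) (q := ∞) hA hδ hfm hφm hf
    (eLpNorm_exponent_top.trans_le (eLpNormEssSup_le_of_ae_bound (.of_forall hφ)))

lemma IsBesov.eLpNorm_le {f : T3 → ℝ} (hf : IsBesov θ M f) {p : ℝ≥0∞} (hp : p ≤ 3) :
    eLpNorm f p volume ≤ ENNReal.ofReal M :=
  (eLpNorm_le_eLpNorm_of_exponent_le hp hf.aesm).trans hf.norm_le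

lemma abs_pairing_le (hv : ∀ i, IsBesov θ M (v i)) (hM : 0 ≤ M) (hδ : 0 ≤ δ)
    (hΦ : ∀ i, Continuous (Φ i)) (hΦδ : ∀ i x, |Φ i x| ≤ δ) : |pairing v Φ| ≤ 3 * (M * δ) := by
  rw [pairing_eq_sum (fun i => (hv i).integrable) hΦ]
  refine (Finset.abs_sum_le_sum_abs _ _).trans ((Finset.sum_le_sum fun i _ =>
    abs_integral_mul_le_of_abs_le hM hδ (hv i).aesm (hΦ i).aestronglyMeasurable
      ((hv i).eLpNorm_le (by norm_num)) (hΦδ i)).trans_eq ?_)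
  rw [Fin.sum_const, nsmul_eq_mul, Nat.cast_ofNat]

lemma abs_flux_le (hv : ∀ i, IsBesov θ M (v i)) (hM : 0 ≤ M) (hδ : 0 ≤ δ)
    (hΦ : ∀ i, IsSmooth (Φ i)) (hΦδ : ∀ i j x, |pd j (Φ i) x| ≤ δ) :
    |flux v Φ| ≤ 9 * (M * M * δ) := by
  have product_le (i j) : eLpNorm (fun x => v i x * v j x) 1 volume ≤ ENNReal.ofReal (M * M) :=
    eLpNorm_mul_le_ofReal (p := 2) (q := 2) hM (hv i).aesm (hv j).aesm
      ((hv i).eLpNorm_le (by norm_num)) ((hv j).eLpNorm_le (by norm_num))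
  rw [flux_eq_sum (fun i => (hv i).memLp_two) hΦ]
  refine (Finset.abs_sum_le_sum_abs _ _).trans ((Finset.sum_le_sum fun i _ =>
    (Finset.abs_sum_le_sum_abs _ _).trans (Finset.sum_le_sum fun j _ =>
      abs_integral_mul_le_of_abs_le (mul_nonneg hM hM) hδ ((hv i).aesm.mul (hv j).aesm)
        ((hΦ i).pd j).continuous.aestronglyMeasurable (product_le i j) (hΦδ i j))).trans_eq ?_)
  simp only [Fin.sum_const, nsmul_eq_mul, Nat.cast_ofNat]
  ring

lemma exists_forall_abs_le (hΦ : ∀ i, Continuous (Φ i)) : ∃ C, 0 ≤ C ∧ ∀ i x, |Φ i x| ≤ C := by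
  obtain ⟨C, h0, hC⟩ := exists_forall_norm_le (continuous_pi hΦ)
  exact ⟨C, h0, fun i x => (norm_le_pi_norm (fun i => Φ i x) i).trans (hC x)⟩

lemma exists_forall_abs_pd_le (hΦ : ∀ i, IsSmooth (Φ i)) :
    ∃ C, 0 ≤ C ∧ ∀ i j x, |pd j (Φ i) x| ≤ C := by
  obtain ⟨C, h0, hC⟩ := exists_forall_norm_le
    (continuous_pi fun i => continuous_pi fun j => ((hΦ i).pd j).continuous)
  exact ⟨C, h0, fun i j x => ((norm_le_pi_norm (fun j => pd j (Φ i) x) j).trans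
    (norm_le_pi_norm (fun i j => pd j (Φ i) x) i)).trans (hC x)⟩

/-- The values and first derivatives of a solenoidal test field, as one continuous function. -/
def solenoidalJet (Φ : {Φ // IsSolenoidalTest Φ}) :
    C(T3, (Fin 3 → ℝ) × (Fin 3 → Fin 3 → ℝ)) where
  toFun x := (fun i => Φ.1 i x, fun i j => pd j (Φ.1 i) x)
  continuous_toFun := (continuous_pi fun i => (Φ.2.smooth i).continuous).prodMk
    (continuous_pi fun i => continuous_pi fun j => ((Φ.2.smooth i).pd j).continuous)

lemma abs_sub_le_dist_solenoidalJet (Φ Ψ : {Φ // IsSolenoidalTest Φ}) (i : Fin 3) (x : T3) :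
    |(Φ.1 - Ψ.1) i x| ≤ dist (solenoidalJet Φ) (solenoidalJet Ψ) :=
  (dist_le_pi_dist (solenoidalJet Φ x).1 (solenoidalJet Ψ x).1 i).trans
    ((le_max_left _ _).trans
      (ContinuousMap.dist_apply_le_dist (f := solenoidalJet Φ) (g := solenoidalJet Ψ) x))

lemma abs_pd_sub_le_dist_solenoidalJet (Φ Ψ : {Φ // IsSolenoidalTest Φ}) (i j : Fin 3) (x : T3) :
    |pd j ((Φ.1 - Ψ.1) i) x| ≤ dist (solenoidalJet Φ) (solenoidalJet Ψ) := by
  have hpd : pd j ((Φ.1 - Ψ.1) i) x = pd j (Φ.1 i) x - pd j (Ψ.1 i) x :=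
    pd_sub (Φ.2.smooth i) (Ψ.2.smooth i) j x
  rw [hpd]
  exact (dist_le_pi_dist ((solenoidalJet Φ x).2 i) ((solenoidalJet Ψ x).2 i) j).trans
    ((dist_le_pi_dist (solenoidalJet Φ x).2 (solenoidalJet Ψ x).2 i).trans
      ((le_max_right _ _).trans
        (ContinuousMap.dist_apply_le_dist (f := solenoidalJet Φ) (g := solenoidalJet Ψ) x)))

lemma exists_seq_dense_isSolenoidalTest :
    ∃ Ψ : ℕ → Fin 3 → T3 → ℝ, (∀ n, IsSolenoidalTest (Ψ n)) ∧
      ∀ Φ, IsSolenoidalTest Φ → ∀ δ > 0, ∃ n, (∀ i x, |(Φ - Ψ n) i x| ≤ δ) ∧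
        ∀ i j x, |pd j ((Φ - Ψ n) i) x| ≤ δ := by
  let S := {Φ // IsSolenoidalTest Φ}
  let _ : TopologicalSpace S := TopologicalSpace.induced solenoidalJet inferInstance
  have : SecondCountableTopology S :=
    TopologicalSpace.secondCountableTopology_induced _ _ solenoidalJet
  have : Nonempty S := ⟨⟨0, isSolenoidalTest_zero⟩⟩
  refine ⟨fun n => (TopologicalSpace.denseSeq S n).1, fun n => (TopologicalSpace.denseSeq S n).2,
    fun Φ hΦ δ hδ => ?_⟩
  obtain ⟨n, hn⟩ := (TopologicalSpace.denseRange_denseSeq S).exists_mem_open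
    (Metric.isOpen_ball.preimage continuous_induced_dom)
    (s := solenoidalJet ⁻¹' Metric.ball (solenoidalJet ⟨Φ, hΦ⟩) δ)
    ⟨⟨Φ, hΦ⟩, Metric.mem_ball_self hδ⟩
  have hdist := (Metric.mem_ball'.1 hn).le
  exact ⟨n, fun i x => (abs_sub_le_dist_solenoidalJet ⟨Φ, hΦ⟩ _ i x).trans hdist,
    fun i j x => (abs_pd_sub_le_dist_solenoidalJet ⟨Φ, hΦ⟩ _ i j x).trans hdist⟩

end Pairing

/-! ### Pointwise values of the mollified vorticity -/

section Reflection

variable {a w : Fin 3 → T3 → ℝ} {k : T3 → ℝ}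

lemma curl_comp_sub_left (ha : ∀ i, IsSmooth (a i)) (x : T3) (i : Fin 3) :
    curl (fun l y => a l (x - y)) i = fun y => -curl a i (x - y) := by
  ext y
  simp only [curl, pd_comp_sub_left (ha _)]
  ring

lemma pd_curl_comp_sub_left (ha : ∀ i, IsSmooth (a i)) (x : T3) (i j : Fin 3) (y : T3) :
    pd j (curl (fun l y => a l (x - y)) i) y = pd j (curl a i) (x - y) := by
  have h := isSmooth_curl ha i
  rw [curl_comp_sub_left ha, pd_neg (h.comp_sub_left x), pd_comp_sub_left h, neg_neg]

lemma isSmooth_single (hk : IsSmooth k) (i j : Fin 3) :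
    IsSmooth ((Pi.single i k : Fin 3 → T3 → ℝ) j) := by
  rcases eq_or_ne j i with rfl | h
  · rwa [Pi.single_eq_same]
  · rw [Pi.single_eq_of_ne h]
    exact IsSmooth.const 0

lemma curl_convolution_eq_pairing (hw : ∀ i, Integrable (w i)) (hk : IsSmooth k) (i : Fin 3)
    (x : T3) : curl (fun l => k ⋆ w l) i x =
      pairing w (curl fun l y => (Pi.single i k : Fin 3 → T3 → ℝ) l (x - y)) := by
  have hs (j) := (isSmooth_single hk i j).comp_sub_left x
  have h0 (l j) : distPartial j (w l) (fun _ => 0) = 0 := by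
    simp only [distPartial, pd_const, mul_zero, integral_zero, neg_zero]
  have h1 (l j) : distPartial j (w l) (fun y => k (x - y)) = pd j (k ⋆ w l) x := by
    simp only [distPartial, pd_convolution hk (hw l), convolution_apply, pd_comp_sub_left hk,
      mul_neg, integral_neg, neg_neg, mul_comm]
  rw [pairing, ← curlPairing_eq_integral hw hs]
  fin_cases i <;> simp [curlPairing, curl, h0, h1]

lemma pd_curl_convolution (hw : ∀ i, Integrable (w i)) (hk : IsSmooth k) (i j : Fin 3) :
    pd j (curl (fun l => k ⋆ w l) i) = curl (fun l => pd j k ⋆ w l) i := by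
  have ha (l) : IsSmooth (k ⋆ w l) := hk.convolution (hw l)
  ext x
  rw [pd_curl ha, pd_comm (ha _) _ (i + 1), pd_comm (ha _) _ (i + 2)]
  simp only [pd_convolution hk (hw _), curl]

lemma abs_convolution_le (hk : Continuous k) (hk0 : ∀ z, 0 ≤ k z) (hk1 : ∫ z, k z = 1)
    {f : T3 → ℝ} {δ : ℝ} (hf : ∀ x, |f x| ≤ δ) (x : T3) : |(k ⋆ f) x| ≤ δ := by
  change |∫ z, k z * f (x - z)| ≤ δ
  refine (norm_integral_le_of_norm_le (G := ℝ) ((integrable_of_continuous hk).mul_const δ)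
    (.of_forall fun z => ?_)).trans_eq (by rw [integral_mul_const, hk1, one_mul])
  rw [norm_mul, Real.norm_of_nonneg (hk0 z)]
  exact mul_le_mul_of_nonneg_left (hf _) (hk0 z)

end Reflection

/-! ### The Euler equations in integrated form -/

section EulerFamily

/-- A bounded family of Besov fields solving the Euler equations weakly, tested with products of
functions of time and solenoidal fields. -/
structure IsEulerFamily (T θ M : ℝ) (v : ℝ → Fin 3 → T3 → ℝ) : Prop where
  aesm : ∀ i, AEStronglyMeasurable (fun q : ℝ × T3 => v q.1 i q.2)
    ((volume.restrict (Ioo 0 T)).prod volume)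
  solenoidal : ∀ᵐ t ∂(volume.restrict (Ioo 0 T)), IsBesovSolenoidal θ M (v t)
  weak : ∀ Φ, IsSolenoidalTest Φ → ∀ η : ℝ → ℝ, ContDiff ℝ ∞ η → HasCompactSupport η →
    tsupport η ⊆ Ioo 0 T →
      ∫ t in Ioo 0 T, (deriv η t * pairing (v t) Φ + η t * flux (v t) Φ) = 0

/-- The defect of the momentum balance of `v` between the times `s` and `t`, tested with `Φ`. -/
def momentumDefect (v : ℝ → Fin 3 → T3 → ℝ) (s t : ℝ) (Φ : Fin 3 → T3 → ℝ) : ℝ :=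
  pairing (v t) Φ - pairing (v s) Φ - ∫ r in s..t, flux (v r) Φ

/-- A set of times of full measure in `(0, T)` at which the Euler equations hold in integrated form,
against every solenoidal test field. -/
structure IsRegularTimeSet (T θ M : ℝ) (v : ℝ → Fin 3 → T3 → ℝ) (G : Set ℝ) : Prop where
  subset : G ⊆ Ioo 0 T
  ae_mem : ∀ᵐ t, t ∈ Ioo 0 T → t ∈ G
  solenoidal : ∀ t ∈ G, IsBesovSolenoidal θ M (v t)
  momentumDefect_eq_zero : ∀ Φ, IsSolenoidalTest Φ → ∀ s ∈ G, ∀ t ∈ G, momentumDefect v s t Φ = 0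

variable {T θ M : ℝ} {v : ℝ → Fin 3 → T3 → ℝ} {Φ Ψ : Fin 3 → T3 → ℝ} {s t : ℝ}

lemma uIoc_subset_Ioo {a b : ℝ} (hs : s ∈ Ioo a b) (ht : t ∈ Ioo a b) : uIoc s t ⊆ Ioo a b :=
  uIoc_subset_uIcc.trans (ordConnected_Ioo.uIcc_subset hs ht)

namespace IsEulerFamily

lemma integrableOn_pairing (hv : IsEulerFamily T θ M v) (hM : 0 ≤ M)
    (hΦ : ∀ i, Continuous (Φ i)) : IntegrableOn (fun t => pairing (v t) Φ) (Ioo 0 T) := by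
  obtain ⟨C, hC0, hC⟩ := exists_forall_abs_le hΦ
  have hm : AEStronglyMeasurable (fun q : ℝ × T3 => ∑ i, v q.1 i q.2 * Φ i q.2)
      ((volume.restrict (Ioo 0 T)).prod volume) :=
    Finset.aestronglyMeasurable_fun_sum _ fun i _ => (hv.aesm i).mul
      (hΦ i).aestronglyMeasurable.comp_snd
  exact Integrable.of_bound hm.integral_prod_right' (3 * (M * C))
    (hv.solenoidal.mono fun t ht => abs_pairing_le ht.besov hM hC0 hΦ hC)

lemma integrableOn_flux (hv : IsEulerFamily T θ M v) (hM : 0 ≤ M) (hΦ : ∀ i, IsSmooth (Φ i)) :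
    IntegrableOn (fun t => flux (v t) Φ) (Ioo 0 T) := by
  obtain ⟨C, hC0, hC⟩ := exists_forall_abs_pd_le hΦ
  have hm : AEStronglyMeasurable
      (fun q : ℝ × T3 => ∑ i, ∑ j, v q.1 i q.2 * v q.1 j q.2 * pd j (Φ i) q.2)
      ((volume.restrict (Ioo 0 T)).prod volume) :=
    Finset.aestronglyMeasurable_fun_sum _ fun i _ => Finset.aestronglyMeasurable_fun_sum _
      fun j _ => ((hv.aesm i).mul (hv.aesm j)).mul
        ((hΦ i).pd j).continuous.aestronglyMeasurable.comp_snd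
  exact Integrable.of_bound hm.integral_prod_right' (9 * (M * M * C))
    (hv.solenoidal.mono fun t ht => abs_flux_le ht.besov hM hC0 hΦ hC)

lemma intervalIntegrable_flux (hv : IsEulerFamily T θ M v) (hM : 0 ≤ M)
    (hΦ : ∀ i, IsSmooth (Φ i)) (hs : s ∈ Icc 0 T) (ht : t ∈ Icc 0 T) :
    IntervalIntegrable (fun r => flux (v r) Φ) volume s t := by
  have hT : 0 ≤ T := hs.1.trans hs.2
  refine ((intervalIntegrable_iff_integrableOn_Ioo_of_le hT).2
    (hv.integrableOn_flux hM hΦ)).mono_set ?_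
  rw [uIcc_of_le hT]
  exact ordConnected_Icc.uIcc_subset hs ht

lemma exists_ae_pairing_eq (hv : IsEulerFamily T θ M v) (hM : 0 ≤ M) (hT : 0 < T)
    (hΦ : IsSolenoidalTest Φ) :
    ∃ m, ∀ᵐ t, t ∈ Ioo 0 T → pairing (v t) Φ = m + ∫ r in 0..t, flux (v r) Φ :=
  exists_ae_eq_const_add_integral hT
    (hv.integrableOn_pairing hM fun i => (hΦ.smooth i).continuous)
    (hv.integrableOn_flux hM hΦ.smooth) (hv.weak Φ hΦ)

lemma abs_integral_flux_le (hv : IsEulerFamily T θ M v) (hM : 0 ≤ M) {δ : ℝ} (hδ : 0 ≤ δ)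
    (hΦ : ∀ i, IsSmooth (Φ i)) (hΦδ : ∀ i j x, |pd j (Φ i) x| ≤ δ) (hs : s ∈ Ioo 0 T)
    (ht : t ∈ Ioo 0 T) : |∫ r in s..t, flux (v r) Φ| ≤ 9 * (M * M * δ) * |t - s| := by
  refine intervalIntegral.norm_integral_le_of_norm_le_const_ae (f := fun r => flux (v r) Φ) ?_
  filter_upwards [(ae_restrict_iff' measurableSet_Ioo).1 hv.solenoidal] with r hr hrI
  exact abs_flux_le (hr (uIoc_subset_Ioo hs ht hrI)).besov hM hδ hΦ hΦδ

lemma momentumDefect_sub (hv : IsEulerFamily T θ M v) (hM : 0 ≤ M) (hs : s ∈ Ioo 0 T)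
    (ht : t ∈ Ioo 0 T) (hvs : IsBesovSolenoidal θ M (v s)) (hvt : IsBesovSolenoidal θ M (v t))
    (hΦ : ∀ i, IsSmooth (Φ i)) (hΨ : ∀ i, IsSmooth (Ψ i)) :
    momentumDefect v s t (Φ - Ψ) = momentumDefect v s t Φ - momentumDefect v s t Ψ := by
  have hs' := Ioo_subset_Icc_self hs
  have ht' := Ioo_subset_Icc_self ht
  have pairing_sub_at {r} (hr : IsBesovSolenoidal θ M (v r)) :
      pairing (v r) (Φ - Ψ) = pairing (v r) Φ - pairing (v r) Ψ :=
    pairing_sub (fun i => (hr.besov i).integrable) (fun i => (hΦ i).continuous)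
      fun i => (hΨ i).continuous
  have integral_flux_sub : ∫ r in s..t, flux (v r) (Φ - Ψ) =
      (∫ r in s..t, flux (v r) Φ) - ∫ r in s..t, flux (v r) Ψ := by
    rw [← intervalIntegral.integral_sub (hv.intervalIntegrable_flux hM hΦ hs' ht')
      (hv.intervalIntegrable_flux hM hΨ hs' ht')]
    refine intervalIntegral.integral_congr_ae ?_
    filter_upwards [(ae_restrict_iff' measurableSet_Ioo).1 hv.solenoidal] with r hr hrI
    exact flux_sub (fun i => ((hr (uIoc_subset_Ioo hs ht hrI)).besov i).memLp_two) hΦ hΨ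
  rw [momentumDefect, pairing_sub_at hvs, pairing_sub_at hvt, integral_flux_sub, momentumDefect,
    momentumDefect]
  ring

lemma abs_momentumDefect_le (hv : IsEulerFamily T θ M v) (hM : 0 ≤ M) (hs : s ∈ Ioo 0 T)
    (ht : t ∈ Ioo 0 T) (hvs : IsBesovSolenoidal θ M (v s)) (hvt : IsBesovSolenoidal θ M (v t))
    {δ : ℝ} (hδ : 0 ≤ δ) (hΦ : ∀ i, IsSmooth (Φ i)) (hΦ0 : ∀ i x, |Φ i x| ≤ δ)
    (hΦ1 : ∀ i j x, |pd j (Φ i) x| ≤ δ) :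
    |momentumDefect v s t Φ| ≤ (6 * M + 9 * (M * M) * |t - s|) * δ := by
  have hΦc (i) := (hΦ i).continuous
  have hs' := abs_pairing_le hvs.besov hM hδ hΦc hΦ0
  have ht' := abs_pairing_le hvt.besov hM hδ hΦc hΦ0
  have hflux := hv.abs_integral_flux_le hM hδ hΦ hΦ1 hs ht
  rw [momentumDefect]
  linarith [abs_sub (pairing (v t) Φ - pairing (v s) Φ) (∫ r in s..t, flux (v r) Φ),
    abs_sub (pairing (v t) Φ) (pairing (v s) Φ)]

lemma momentumDefect_eq_zero_of_dense (hv : IsEulerFamily T θ M v) (hM : 0 ≤ M)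
    (hs : s ∈ Ioo 0 T) (ht : t ∈ Ioo 0 T) (hvs : IsBesovSolenoidal θ M (v s))
    (hvt : IsBesovSolenoidal θ M (v t)) (hΦ : IsSolenoidalTest Φ) {Ψ : ℕ → Fin 3 → T3 → ℝ}
    (hΨ : ∀ n, IsSolenoidalTest (Ψ n)) (hdefect : ∀ n, momentumDefect v s t (Ψ n) = 0)
    (hdense : ∀ δ > 0, ∃ n, (∀ i x, |(Φ - Ψ n) i x| ≤ δ) ∧ ∀ i j x, |pd j ((Φ - Ψ n) i) x| ≤ δ) :
    momentumDefect v s t Φ = 0 := by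
  have small : ∀ δ > 0, |momentumDefect v s t Φ| ≤ (6 * M + 9 * (M * M) * |t - s|) * δ := by
    intro δ hδ
    obtain ⟨n, hn0, hn1⟩ := hdense δ hδ
    have h := hv.abs_momentumDefect_le hM hs ht hvs hvt hδ.le (hΦ.sub (hΨ n)).smooth hn0 hn1
    rwa [hv.momentumDefect_sub hM hs ht hvs hvt hΦ.smooth (hΨ n).smooth, hdefect n, sub_zero] at h
  have hlim : Tendsto (fun δ : ℝ => (6 * M + 9 * (M * M) * |t - s|) * δ) (𝓝[>] 0) (𝓝 0) := by
    simpa only [mul_zero, id] using ((tendsto_id (x := 𝓝 (0 : ℝ))).const_mul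
      (6 * M + 9 * (M * M) * |t - s|)).mono_left nhdsWithin_le_nhds
  exact abs_nonpos_iff.1 (ge_of_tendsto hlim (eventually_mem_nhdsWithin.mono small))

lemma exists_isRegularTimeSet (hv : IsEulerFamily T θ M v) (hM : 0 ≤ M) (hT : 0 < T) :
    ∃ G, IsRegularTimeSet T θ M v G := by
  obtain ⟨Ψ, hΨ, hdense⟩ := exists_seq_dense_isSolenoidalTest
  choose m hm using fun n => hv.exists_ae_pairing_eq hM hT (hΨ n)
  refine ⟨{t | t ∈ Ioo 0 T ∧ IsBesovSolenoidal θ M (v t) ∧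
    ∀ n, pairing (v t) (Ψ n) = m n + ∫ r in 0..t, flux (v r) (Ψ n)}, fun t ht => ht.1, ?_,
    fun t ht => ht.2.1, fun Φ hΦ s hs t ht => ?_⟩
  · filter_upwards [(ae_restrict_iff' measurableSet_Ioo).1 hv.solenoidal, ae_all_iff.2 hm]
      with t hsol heq ht
    exact ⟨ht, hsol ht, fun n => heq n ht⟩
  · refine hv.momentumDefect_eq_zero_of_dense hM hs.1 ht.1 hs.2.1 ht.2.1 hΦ hΨ (fun n => ?_)
      (hdense Φ hΦ)
    have hint {r} (hr : r ∈ Ioo 0 T) := hv.intervalIntegrable_flux hM (hΨ n).smooth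
      (left_mem_Icc.2 hT.le) (Ioo_subset_Icc_self hr)
    rw [momentumDefect, ht.2.2 n, hs.2.2 n,
      ← intervalIntegral.integral_interval_sub_left (hint ht.1) (hint hs.1)]
    ring

end IsEulerFamily

end EulerFamily

/-! ### Evolution of the mollified helicity -/

namespace IsRegularTimeSet

variable {T θ M ε s t : ℝ} {v : ℝ → Fin 3 → T3 → ℝ} {G : Set ℝ}

lemma subset_closure (hG : IsRegularTimeSet T θ M v G) : Ioo 0 T ⊆ closure G := by
  intro t ht
  refine mem_closure_iff.2 fun U hU htU => ?_
  have hpos := (hU.inter isOpen_Ioo).measure_pos volume ⟨t, htU, ht⟩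
  obtain ⟨r, hr, hrG⟩ := Measure.exists_mem_of_measure_ne_zero_of_ae hpos.ne'
    (ae_restrict_of_ae hG.ae_mem)
  exact ⟨r, hr.1, hrG hr.2⟩

lemma integrable (hG : IsRegularTimeSet T θ M v G) (ht : t ∈ G) (i : Fin 3) : Integrable (v t i) :=
  ((hG.solenoidal t ht).besov i).integrable

lemma pairing_sub_pairing (hG : IsRegularTimeSet T θ M v G) {Φ : Fin 3 → T3 → ℝ}
    (hΦ : IsSolenoidalTest Φ) (hs : s ∈ G) (ht : t ∈ G) :
    pairing (v t) Φ - pairing (v s) Φ = ∫ r in s..t, flux (v r) Φ :=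
  sub_eq_zero.1 (hG.momentumDefect_eq_zero Φ hΦ s hs t ht)

lemma abs_pairing_sub_le (hG : IsRegularTimeSet T θ M v G) {Φ : Fin 3 → T3 → ℝ}
    (hΦ : IsSolenoidalTest Φ) {B : ℝ} (hs : s ∈ G) (ht : t ∈ G)
    (hB : ∀ r ∈ G, r ∈ uIoc s t → |flux (v r) Φ| ≤ B) :
    |pairing (v t) Φ - pairing (v s) Φ| ≤ B * |t - s| := by
  rw [hG.pairing_sub_pairing hΦ hs ht]
  refine intervalIntegral.norm_integral_le_of_norm_le_const_ae (f := fun r => flux (v r) Φ) ?_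
  filter_upwards [hG.ae_mem] with r hr hrI
  exact hB r (hr (uIoc_subset_Ioo (hG.subset hs) (hG.subset ht) hrI)) hrI

lemma exists_abs_curl_convolution_sub_le (hG : IsRegularTimeSet T θ M v G) (hM : 0 ≤ M)
    {k : T3 → ℝ} (hk : IsSmooth k) (i : Fin 3) :
    ∃ L, 0 ≤ L ∧ ∀ s ∈ G, ∀ t ∈ G, ∀ x,
      |curl (fun l => k ⋆ v t l) i x - curl (fun l => k ⋆ v s l) i x| ≤ L * |t - s| := by
  have hsmooth := isSmooth_single hk i
  obtain ⟨D, hD0, hD⟩ := exists_forall_abs_pd_le (isSmooth_curl hsmooth)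
  refine ⟨9 * (M * M * D), by positivity, fun s hs t ht x => ?_⟩
  have htest := isSolenoidalTest_curl fun l => (hsmooth l).comp_sub_left x
  rw [curl_convolution_eq_pairing (fun _ => hG.integrable ht _) hk,
    curl_convolution_eq_pairing (fun _ => hG.integrable hs _) hk]
  refine hG.abs_pairing_sub_le htest hs ht fun r hr _ =>
    abs_flux_le (hG.solenoidal r hr).besov hM hD0 htest.smooth fun a b z => ?_
  rw [pd_curl_comp_sub_left hsmooth]
  exact hD a b _

lemma exists_abs_pd_mollifiedCurl_sub_le (hG : IsRegularTimeSet T θ M v G) (hM : 0 ≤ M)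
    (h0 : 0 < ε) (h1 : ε ≤ 1) : ∃ L, 0 ≤ L ∧ ∀ s ∈ G, ∀ t ∈ G, ∀ i j x,
      |pd j ((mollifiedCurl ε (v t) - mollifiedCurl ε (v s)) i) x| ≤ L * |t - s| := by
  have hk := isMollifier_mollifier h0 h1
  choose L hL0 hL using fun i j => hG.exists_abs_curl_convolution_sub_le hM (hk.smooth.pd j) i
  have hle (i j) : L i j ≤ ∑ i, ∑ j, L i j :=
    (Finset.single_le_sum (fun j _ => hL0 i j) (Finset.mem_univ j)).trans
      (Finset.single_le_sum (f := fun i => ∑ j, L i j)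
        (fun i _ => Finset.sum_nonneg fun j _ => hL0 i j) (Finset.mem_univ i))
  refine ⟨∑ i, ∑ j, L i j, Finset.sum_nonneg fun i _ => Finset.sum_nonneg fun j _ => hL0 i j,
    fun s hs t ht i j x => ?_⟩
  have hcurl {r} (hr : r ∈ G) : IsSmooth (curl (mollify ε (v r)) i) :=
    isSmooth_curl (fun _ => isSmooth_mollify h0 h1 (hG.integrable hr _)) i
  have hint {r} (hr : r ∈ G) : Integrable (curl (mollify ε (v r)) i) :=
    integrable_of_continuous (hcurl hr).continuous
  have hpd {r} (hr : r ∈ G) : pd j (curl (mollify ε (v r)) i) =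
      curl (fun l => pd j (mollifier ε) ⋆ v r l) i :=
    pd_curl_convolution (fun _ => hG.integrable hr _) hk.smooth i j
  have hdiff : (mollifiedCurl ε (v t) - mollifiedCurl ε (v s)) i =
      mollifier ε ⋆ fun y => curl (mollify ε (v t)) i y - curl (mollify ε (v s)) i y :=
    funext fun y => (convolution_fun_sub hk.smooth.continuous (hint ht) (hint hs) y).symm
  rw [hdiff, pd_convolution_eq_convolution_pd hk.smooth ((hcurl ht).sub (hcurl hs))]
  refine abs_convolution_le hk.smooth.continuous hk.nonneg hk.integral_eq_one (fun y => ?_) x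
  rw [pd_sub (hcurl ht) (hcurl hs), hpd ht, hpd hs]
  exact (hL i j s hs t ht y).trans (mul_le_mul_of_nonneg_right (hle i j) (abs_nonneg _))

lemma abs_flux_mollifiedCurl_le (hG : IsRegularTimeSet T θ M v G) (hM : 0 ≤ M) (hθ : 0 ≤ θ)
    (h0 : 0 < ε) (h1 : ε ≤ 1) {δ : ℝ} (hδ : 0 ≤ δ) {q r : ℝ} (hq : q ∈ G) (hr : r ∈ G)
    (hpd : ∀ i j x, |pd j ((mollifiedCurl ε (v q) - mollifiedCurl ε (v r)) i) x| ≤ δ) :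
    |flux (v r) (mollifiedCurl ε (v q))| ≤
      36 * (mollifierConst * M ^ 3 * ε ^ (3 * θ - 2)) + 9 * (M * M * δ) := by
  have hsol := hG.solenoidal r hr
  have htest {r} (hr : r ∈ G) := isSolenoidalTest_mollifiedCurl h0 h1 (hG.integrable hr)
  have same_time := hsol.abs_flux_mollifiedCurl_le hθ hM h0 h1
  have other_time := abs_flux_le hsol.besov hM hδ ((htest hq).sub (htest hr)).smooth hpd
  rw [flux_sub (fun i => (hsol.besov i).memLp_two) (htest hq).smooth (htest hr).smooth]
    at other_time
  linarith [abs_sub_abs_le_abs_sub (flux (v r) (mollifiedCurl ε (v q)))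
    (flux (v r) (mollifiedCurl ε (v r)))]

/- By the symmetry of the helicity form, its increment is the sum of two increments with a frozen
test field, that is, of two time integrals of the flux. -/
lemma pairing_mollifiedCurl_sub (hG : IsRegularTimeSet T θ M v G) (h0 : 0 < ε) (h1 : ε ≤ 1)
    (hs : s ∈ G) (ht : t ∈ G) :
    pairing (v t) (mollifiedCurl ε (v t)) - pairing (v s) (mollifiedCurl ε (v s)) =
      (pairing (v t) (mollifiedCurl ε (v t)) - pairing (v s) (mollifiedCurl ε (v t)))
        + (pairing (v t) (mollifiedCurl ε (v s)) - pairing (v s) (mollifiedCurl ε (v s))) := by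
  rw [pairing_mollifiedCurl_comm h0 h1 (hG.integrable ht) (hG.integrable hs)]
  ring

lemma dist_pairing_mollifiedCurl_le (hG : IsRegularTimeSet T θ M v G) (hM : 0 ≤ M) (hθ : 0 ≤ θ)
    (h0 : 0 < ε) (h1 : ε ≤ 1) : ∀ s ∈ G, ∀ t ∈ G,
      dist (pairing (v s) (mollifiedCurl ε (v s))) (pairing (v t) (mollifiedCurl ε (v t))) ≤
        2 * (36 * (mollifierConst * M ^ 3 * ε ^ (3 * θ - 2))) * dist s t := by
  obtain ⟨L, hL0, hL⟩ := hG.exists_abs_pd_mollifiedCurl_sub_le hM h0 h1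
  refine dist_le_of_dist_le_quadratic (f := fun t => pairing (v t) (mollifiedCurl ε (v t)))
    (L := 2 * (9 * (M * M * L))) (convex_Ioo 0 T) hG.subset hG.subset_closure fun s hs t ht => ?_
  have increment_le {q} (hq : q ∈ G) (hnear : ∀ r ∈ uIoc s t, |q - r| ≤ |t - s|) :
      |pairing (v t) (mollifiedCurl ε (v q)) - pairing (v s) (mollifiedCurl ε (v q))| ≤
        (36 * (mollifierConst * M ^ 3 * ε ^ (3 * θ - 2)) + 9 * (M * M * (L * |t - s|)))
          * |t - s| := by
    refine hG.abs_pairing_sub_le (isSolenoidalTest_mollifiedCurl h0 h1 (hG.integrable hq)) hs ht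
      fun r hr hrI => hG.abs_flux_mollifiedCurl_le hM hθ h0 h1 (by positivity) hq hr
        fun i j x => (hL r hr q hq i j x).trans ?_
    exact mul_le_mul_of_nonneg_left (hnear r hrI) hL0
  have left := increment_le hs fun r hr => by
    rw [abs_sub_comm]
    exact abs_sub_left_of_mem_uIcc (uIoc_subset_uIcc hr)
  have right := increment_le ht fun r hr => abs_sub_right_of_mem_uIcc (uIoc_subset_uIcc hr)
  rw [dist_comm, dist_comm s, Real.dist_eq, Real.dist_eq, hG.pairing_mollifiedCurl_sub h0 h1 hs ht]
  refine (abs_add_le _ _).trans ((add_le_add right left).trans_eq ?_)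
  ring

end IsRegularTimeSet

/-! ### Weak Euler solutions of Besov regularity -/

section WeakSolution

variable {T θ M : ℝ}

lemma eLpNorm_components_le {q : ℝ≥0∞} (v : T3 → E3) (i : Fin 3) :
    eLpNorm (components v i) q volume ≤ eLpNorm v q volume :=
  eLpNorm_mono fun x => PiLp.norm_apply_le (v x) i

lemma eLpNorm_increment_le {v : T3 → E3} (hM : 0 ≤ M)
    (h : besovNorm θ 3 v ≤ ENNReal.ofReal M) {y : E3} (hy : y ≠ 0) :
    eLpNorm (fun x => v (x + proj y) - v x) 3 volume ≤ ENNReal.ofReal (M * ‖y‖ ^ θ) := by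
  have hpos : 0 < ‖y‖ ^ θ := Real.rpow_pos_of_pos (norm_pos_iff.2 hy) _
  rw [ENNReal.ofReal_mul hM, ← ENNReal.div_le_iff (by simpa using hpos) ENNReal.ofReal_ne_top]
  exact (le_iSup₂ (f := fun (y : E3) (_ : y ≠ 0) =>
    eLpNorm (fun x => v (x + proj y) - v x) 3 volume / ENNReal.ofReal (‖y‖ ^ θ)) y hy).trans
      (le_add_self.trans h)

lemma isBesov_components {v : T3 → E3} (hv : AEStronglyMeasurable v) (hM : 0 ≤ M)
    (h : besovNorm θ 3 v ≤ ENNReal.ofReal M) (i : Fin 3) : IsBesov θ M (components v i) := by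
  refine ⟨(EuclideanSpace.proj (𝕜 := ℝ) i).continuous.comp_aestronglyMeasurable hv,
    (eLpNorm_components_le v i).trans (le_self_add.trans h), fun z => ?_⟩
  obtain ⟨y, hyz, hy⟩ := exists_proj_eq_norm_eq (-z)
  rw [torusAbs_neg] at hy
  have component_increment : (fun x => components v i (x - z) - components v i x) =
      components (fun x => v (x + proj y) - v x) i := by
    simp only [hyz, ← sub_eq_add_neg]
    rfl
  rw [component_increment, ← hy]
  refine (eLpNorm_components_le _ i).trans ?_
  rcases eq_or_ne y 0 with rfl | hy0
  · simp [proj_zero]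
  · exact eLpNorm_increment_le hM h hy0

lemma isTestField_mul {η : ℝ → ℝ} (hη : ContDiff ℝ ∞ η) (hηc : HasCompactSupport η)
    (hηT : tsupport η ⊆ Ioo 0 T) {Φ : Fin 3 → T3 → ℝ} (hΦ : ∀ i, IsSmooth (Φ i)) :
    IsTestField T fun t x => (WithLp.toLp 2 fun i => η t * Φ i x : E3) := by
  have eq_zero (q : ℝ × T3) (hq : q ∉ tsupport η ×ˢ univ) :
      Function.uncurry (fun t x => (WithLp.toLp 2 fun i => η t * Φ i x : E3)) q = 0 := by
    have hηq : η q.1 = 0 := image_eq_zero_of_notMem_tsupport fun h => hq ⟨h, mem_univ _⟩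
    ext i
    simp [Function.uncurry, hηq]
  exact {
    smooth := contDiff_euclidean.2 fun i => (hη.comp contDiff_fst).mul
      (ContDiff.comp (g := fun y => Φ i (proj y)) (hΦ i) contDiff_snd)
    compact := HasCompactSupport.intro (hηc.isCompact.prod isCompact_univ) eq_zero
    support := (closure_minimal (fun q hq => not_imp_comm.1 (eq_zero q) hq)
      ((isClosed_tsupport η).prod isClosed_univ)).trans (prod_mono_left hηT) }

lemma integral_momentum_mul {η : ℝ → ℝ} (hη : Differentiable ℝ η) {v : T3 → E3}
    (hv : ∀ i, MemLp (components v i) 2) {Φ : Fin 3 → T3 → ℝ} (hΦ : IsSolenoidalTest Φ)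
    (q : T3 → ℝ) (t : ℝ) :
    ∫ x, ((∑ i, deriv (fun s => η s * Φ i x) t * v x i)
      + (∑ i, ∑ j, v x i * v x j * pd j (fun y => η t * Φ i y) x)
      + q x * ∑ i, pd i (fun y => η t * Φ i y) x) =
        deriv η t * pairing (components v) Φ + η t * flux (components v) Φ := by
  have hderiv (i x) : deriv (fun s => η s * Φ i x) t = deriv η t * Φ i x :=
    deriv_mul_const (hη t) _
  rw [pairing, flux, ← integral_const_mul, ← integral_const_mul,
    ← integral_add ((integrable_pairing (fun i => (hv i).integrable one_le_two)
      fun i => (hΦ.smooth i).continuous).const_mul _)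
      ((integrable_flux hv hΦ.smooth).const_mul _)]
  congr 1 with x
  simp only [hderiv, pd_const_mul (hΦ.smooth _), ← Finset.mul_sum, hΦ.div_eq_zero, mul_zero,
    add_zero, mul_left_comm _ (η t), mul_assoc]
  simp only [components, Finset.mul_sum, mul_comm, mul_left_comm]

lemma exists_isEulerFamily {u : ℝ → T3 → E3} {p : ℝ → T3 → ℝ} (hu : MemLinftyBesov T θ 3 u)
    (hE : IsWeakEulerSolution T u p) :
    ∃ M, 0 ≤ M ∧ IsEulerFamily T θ M fun t => components (u t) := by
  obtain ⟨C, hC⟩ := hu.bound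
  have hm : AEStronglyMeasurable (Function.uncurry u)
      ((volume.restrict (Ioo 0 T)).prod volume) := by
    simpa only [Measure.volume_eq_prod, ← Measure.prod_restrict, Measure.restrict_univ]
      using hu.measurable
  have solenoidal : ∀ᵐ t ∂(volume.restrict (Ioo 0 T)),
      IsBesovSolenoidal θ (max C 0) (components (u t)) := by
    filter_upwards [hC, hm.prodMk_left, hE.divergence_free] with t hnorm hmeas hdiv
    exact ⟨isBesov_components hmeas (le_max_right _ _)
      (hnorm.trans (ENNReal.ofReal_le_ofReal (le_max_left _ _))), hdiv⟩
  refine ⟨max C 0, le_max_right _ _,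
    fun i => (EuclideanSpace.proj (𝕜 := ℝ) i).continuous.comp_aestronglyMeasurable hm, solenoidal,
    fun Φ hΦ η hη hηc hηT => ?_⟩
  refine Eq.trans (integral_congr_ae ?_) (hE.momentum _ (isTestField_mul hη hηc hηT hΦ.smooth))
  filter_upwards [solenoidal] with t ht
  exact (integral_momentum_mul (hη.differentiable (by simp)) (fun i => (ht.besov i).memLp_two) hΦ
    (p t) t).symm

end WeakSolution

/-! ### Hölder continuity of the helicity -/

section HelicityHolder

open scoped NNReal

lemma exists_rpow_eq_rpow_mul {a c d : ℝ} (hc : c < a) (h0 : 0 < d) (h1 : d ≤ 1) :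
    ∃ ε, 0 < ε ∧ ε ≤ 1 ∧ ε ^ a = d ^ (a / (a - c)) ∧ ε ^ c * d = d ^ (a / (a - c)) := by
  have hac : 0 < a - c := sub_pos.2 hc
  have hexp : c / (a - c) + 1 = a / (a - c) := by
    field_simp
    ring
  refine ⟨d ^ (1 / (a - c)), Real.rpow_pos_of_pos h0 _,
    Real.rpow_le_one h0.le h1 (by positivity), ?_, ?_⟩
  · rw [← Real.rpow_mul h0.le, one_div_mul_eq_div]
  · rw [← Real.rpow_mul h0.le, one_div_mul_eq_div, ← hexp, Real.rpow_add_one h0.ne']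

/- Two points are compared through the approximation at the scale `ε` at which both errors are
balanced, `ε ^ a = ε ^ c * (dist s t / T)`. -/
lemma exists_holderOnWith_of_approx {X Y : Type*} [MetricSpace X] [PseudoMetricSpace Y]
    {f : X → Y} {F : ℝ → X → Y} {G : Set X} {A B T a c : ℝ} (hT : 0 < T) (ha : 0 < a) (hc : c < a)
    (hG : ∀ s ∈ G, ∀ t ∈ G, dist s t ≤ T)
    (happrox : ∀ ε, 0 < ε → ε ≤ 1 → ∀ s ∈ G, dist (f s) (F ε s) ≤ A * ε ^ a)
    (hlip : ∀ ε, 0 < ε → ε ≤ 1 → ∀ s ∈ G, ∀ t ∈ G,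
      dist (F ε s) (F ε t) ≤ B * ε ^ c * dist s t) :
    ∃ K : ℝ≥0, HolderOnWith K (a / (a - c)).toNNReal f G := by
  have hr : 0 ≤ a / (a - c) := (div_pos ha (sub_pos.2 hc)).le
  refine ⟨((2 * A + B * T) / T ^ (a / (a - c))).toNNReal,
    holderOnWith_of_dist_le fun s hs t ht => ?_⟩
  rw [Real.coe_toNNReal _ hr]
  rcases eq_or_ne s t with rfl | hst
  · rw [dist_self]
    positivity
  obtain ⟨ε, hε0, hε1, pow_a, pow_c⟩ := exists_rpow_eq_rpow_mul hc
    (div_pos (dist_pos.2 hst) hT) ((div_le_one hT).2 (hG s hs t ht))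
  calc dist (f s) (f t)
      ≤ dist (f s) (F ε s) + dist (F ε s) (F ε t) + dist (F ε t) (f t) := dist_triangle4 _ _ _ _
    _ ≤ A * ε ^ a + B * ε ^ c * dist s t + A * ε ^ a := by
        rw [dist_comm _ (f t)]
        exact add_le_add (add_le_add (happrox ε hε0 hε1 s hs) (hlip ε hε0 hε1 s hs t ht))
          (happrox ε hε0 hε1 t ht)
    _ = 2 * (A * ε ^ a) + B * T * (ε ^ c * (dist s t / T)) := by
        field_simp
        ring
    _ = (2 * A + B * T) / T ^ (a / (a - c)) * dist s t ^ (a / (a - c)) := by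
        rw [pow_a, pow_c, Real.div_rpow dist_nonneg hT.le]
        ring
    _ ≤ _ := mul_le_mul_of_nonneg_right (Real.le_coe_toNNReal _) (by positivity)

lemma IsRegularTimeSet.exists_holderOnWith_helicity {T θ M : ℝ} {u : ℝ → T3 → E3} {G : Set ℝ}
    (hG : IsRegularTimeSet T θ M (fun t => components (u t)) G) (hT : 0 < T) (hM : 0 ≤ M)
    (hθ : θ ∈ Ioo (1 / 2) 1) :
    ∃ K : ℝ≥0, HolderOnWith K ((2 * θ - 1) / (1 - θ)).toNNReal (fun t => helicity (u t)) G := by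
  have hexp : 1 - θ = (2 * θ - 1) - (3 * θ - 2) := by ring
  rw [hexp]
  refine exists_holderOnWith_of_approx
    (F := fun ε t => pairing (components (u t)) (mollifiedCurl ε (components (u t))))
    (A := 6 * (geomConst (2 * θ - 1) * ((1 + mollifierConst) * M) ^ 2))
    (B := 2 * (36 * (mollifierConst * M ^ 3)))
    hT (by linarith [hθ.1]) (by linarith [hθ.2]) (fun s hs t ht => ?_)
    (fun ε h0 h1 t ht => ?_) (fun ε h0 h1 s hs t ht => ?_)
  · simpa using Real.dist_le_of_mem_Icc (Ioo_subset_Icc_self (hG.subset hs))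
      (Ioo_subset_Icc_self (hG.subset ht))
  · have hint := hG.integrable ht
    rw [Real.dist_eq, ← curlPairing_mollify_eq_pairing h0 h1 hint hint]
    refine (abs_helicity_sub_curlPairing_le hθ.1 hθ.2.le hM (hG.solenoidal t ht).besov h0
      h1).trans_eq ?_
    ring
  · refine (hG.dist_pairing_mollifiedCurl_le hM (by linarith [hθ.1]) h0 h1 s hs t ht).trans_eq ?_
    ring

end HelicityHolder

/-! ### The support of a distributional derivative -/

section Distribution

open scoped NNReal

variable {T : ℝ} {H g : ℝ → ℝ}

lemma regularDistribution_congr (h : H =ᵐ[volume.restrict (Ioo 0 T)] g) :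
    regularDistribution T H = regularDistribution T g := by
  refine DFunLike.ext _ _ fun η => ?_
  have hint : ∫ t, η t * H t = ∫ t, η t * g t := by
    refine integral_congr_ae ?_
    filter_upwards [(ae_restrict_iff' measurableSet_Ioo).1 h] with t ht
    by_cases htT : t ∈ Ioo 0 T
    · rw [ht htT]
    · rw [image_eq_zero_of_notMem_tsupport fun hη => htT (η.tsupport_subset hη), zero_mul, zero_mul]
  have hloc : LocallyIntegrableOn H (timeInterval T) ↔ LocallyIntegrableOn g (timeInterval T) :=
    locallyIntegrableOn_congr h
  simp only [regularDistribution, ContinuousLinearMap.toUniformConvergenceCLM_apply,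
    TestFunction.integralAgainstBilinCLM_apply, ContinuousLinearMap.mul_apply', hint]
  classical exact if_congr hloc rfl rfl

lemma lineDeriv_regularDistribution_apply (hH : LocallyIntegrableOn H (Ioo 0 T))
    (η : 𝓓(timeInterval T, ℝ)) :
    (∂_{(1 : ℝ)} (regularDistribution T H)) η = -∫ t, deriv η t * H t := by
  rw [Distribution.lineDerivOp_apply_apply, map_neg, regularDistribution,
    ContinuousLinearMap.toUniformConvergenceCLM_apply,
    TestFunction.integralAgainstBilinCLM_eq_integral hH]
  rfl

lemma lineDeriv_regularDistribution_eq_zero {m : ℝ} (h : EqOn H (fun _ => m) (Ioo 0 T)) :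
    ∂_{(1 : ℝ)} (regularDistribution T H) = 0 := by
  have hconst : regularDistribution T H = regularDistribution T fun _ => m :=
    regularDistribution_congr ((ae_restrict_iff' measurableSet_Ioo).2 (.of_forall h))
  refine DFunLike.ext _ _ fun η => ?_
  rw [hconst,
    lineDeriv_regularDistribution_apply ((locallyIntegrable_const m).locallyIntegrableOn _),
    integral_mul_const,
    integral_eq_zero_of_hasDerivAt_of_integrable
      (fun t => (η.contDiff.differentiable (by simp) t).hasDerivAt)
      ((η.contDiff.continuous_deriv (by simp)).integrable_of_hasCompactSupport
        η.hasCompactSupport.deriv)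
      (η.continuous.integrable_of_hasCompactSupport η.hasCompactSupport), zero_mul, neg_zero]
  rfl

lemma eventually_eq_of_notMem_spt (hg : ContinuousOn g (Ioo 0 T)) {t : ℝ}
    (ht : t ∈ Ioo 0 T \ spt (∂_{(1 : ℝ)} (regularDistribution T g))) :
    ∀ᶠ s in 𝓝 t, g s = g t := by
  obtain ⟨U, hvanish, hU, htU⟩ := (Distribution.notMem_dsupport_iff t).1 fun h => ht.2 ⟨ht.1, h⟩
  obtain ⟨a, b, htab, hab⟩ := mem_nhds_iff_exists_Ioo_subset.1
    ((hU.inter isOpen_Ioo).mem_nhds ⟨htU, ht.1⟩)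
  have habU : Ioo a b ⊆ U := hab.trans inter_subset_left
  have habT : Ioo a b ⊆ Ioo 0 T := hab.trans inter_subset_right
  have hgint : LocallyIntegrableOn g (Ioo 0 T) := hg.locallyIntegrableOn measurableSet_Ioo
  obtain ⟨m, hm⟩ := exists_ae_eq_const (htab.1.trans htab.2) (hgint.mono_set habT)
    fun η hη hηc hηab => by
      have h := hvanish (⟨η, hη, hηc, hηab.trans habT⟩ : 𝓓(timeInterval T, ℝ)) (hηab.trans habU)
      rwa [lineDeriv_regularDistribution_apply hgint, neg_eq_zero] at h
  have heq : EqOn g (fun _ => m) (Ioo a b) :=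
    Measure.eqOn_open_of_ae_eq ((ae_restrict_iff' measurableSet_Ioo).2 hm) isOpen_Ioo
      (hg.mono habT) continuousOn_const
  filter_upwards [Ioo_mem_nhds htab.1 htab.2] with s hs
  exact (heq hs).trans (heq htab).symm

lemma le_dimH_spt_lineDeriv {C r : ℝ≥0} (hr : 0 < r) (hg : HolderOnWith C r g (Ioo 0 T))
    (hne : ∂_{(1 : ℝ)} (regularDistribution T g) ≠ 0) :
    r ≤ dimH (spt (∂_{(1 : ℝ)} (regularDistribution T g))) := by
  by_contra! hlt
  have hconst {s t : ℝ} (hs : s ∈ Ioo 0 T) (ht : t ∈ Ioo 0 T) : g s = g t :=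
    eq_of_dimH_lt isPreconnected_Ioo hg hr
      (fun t ht => eventually_eq_of_notMem_spt (hg.continuousOn hr) ht) hlt hs ht
  rcases (Ioo 0 T).eq_empty_or_nonempty with hempty | ⟨t, ht⟩
  · exact hne (lineDeriv_regularDistribution_eq_zero (m := 0) (by simp [hempty]))
  · exact hne (lineDeriv_regularDistribution_eq_zero fun s hs => hconst hs ht)

end Distribution

end EulerHelicity

end

theorem mainTheorem4_general (T θ : ℝ) (hT : 0 < T) (hθ : θ ∈ Set.Ioo (1 / 2 : ℝ) 1)
    (u : ℝ → EulerHelicity.T3 → EulerHelicity.E3) (p : ℝ → EulerHelicity.T3 → ℝ)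
    (hu : EulerHelicity.MemLinftyBesov T θ 3 u)
    (hE : EulerHelicity.IsWeakEulerSolution T u p) :
    (∀ᵐ t ∂(MeasureTheory.volume.restrict (Set.Ioo 0 T)),
      EulerHelicity.HasHelicity (u t) (EulerHelicity.helicity (u t))) ∧
    MeasureTheory.LocallyIntegrableOn (fun t => EulerHelicity.helicity (u t)) (Set.Ioo 0 T) ∧
    (EulerHelicity.helicityDeriv T u ≠ 0 →
      ENNReal.ofReal ((2 * θ - 1) / (1 - θ)) ≤
        dimH (EulerHelicity.spt (EulerHelicity.helicityDeriv T u))) := by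
  obtain ⟨M, hM, hv⟩ := EulerHelicity.exists_isEulerFamily hu hE
  obtain ⟨G, hG⟩ := hv.exists_isRegularTimeSet hM hT
  have hr : 0 < ((2 * θ - 1) / (1 - θ)).toNNReal :=
    Real.toNNReal_pos.2 (div_pos (by linarith [hθ.1]) (by linarith [hθ.2]))
  obtain ⟨K, hK⟩ := hG.exists_holderOnWith_helicity hT hM hθ
  obtain ⟨g, hg, hgG⟩ := EulerHelicity.exists_holderOnWith_closure hK hr
  replace hg := hg.mono hG.subset_closure
  have ae_mem : ∀ᵐ t ∂(volume.restrict (Ioo 0 T)), t ∈ G :=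
    (ae_restrict_iff' measurableSet_Ioo).2 hG.ae_mem
  have ae_eq : g =ᵐ[volume.restrict (Ioo 0 T)] fun t => EulerHelicity.helicity (u t) :=
    ae_mem.mono fun t ht => hgG ht
  refine ⟨ae_mem.mono fun t ht => EulerHelicity.hasHelicity_helicity hθ.1 hθ.2.le hM
      (hG.solenoidal t ht).besov,
    ((hg.continuousOn hr).locallyIntegrableOn measurableSet_Ioo).congr ae_eq, ?_⟩
  rw [EulerHelicity.helicityDeriv, ← EulerHelicity.regularDistribution_congr ae_eq]
  exact EulerHelicity.le_dimH_spt_lineDeriv hr hg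

theorem mainTheorem4 (T θ : ℝ) (hT : 0 < T) (hθ : θ ∈ Set.Ioc (1 / 2 : ℝ) (2 / 3))
    (u : ℝ → EulerHelicity.T3 → EulerHelicity.E3) (p : ℝ → EulerHelicity.T3 → ℝ)
    (hu : EulerHelicity.MemLinftyBesov T θ 3 u)
    (hE : EulerHelicity.IsWeakEulerSolution T u p) :
    (∀ᵐ t ∂(MeasureTheory.volume.restrict (Set.Ioo 0 T)),
      EulerHelicity.HasHelicity (u t) (EulerHelicity.helicity (u t))) ∧
    MeasureTheory.LocallyIntegrableOn (fun t => EulerHelicity.helicity (u t)) (Set.Ioo 0 T) ∧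
    (EulerHelicity.helicityDeriv T u ≠ 0 →
      ENNReal.ofReal ((2 * θ - 1) / (1 - θ)) ≤
        dimH (EulerHelicity.spt (EulerHelicity.helicityDeriv T u))) :=
  mainTheorem4_general T θ hT ⟨hθ.1, hθ.2.trans_lt (by norm_num)⟩ u p hu hE
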